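/- **Theorem 1 (Outer bound).** Let $\mathcal X,\mathcal Y_1,\mathcal Y_2,\mathcal Z$ be finite sets and let $P_{Y_1Y_2Z|X}$ be a memoryless broadcast channel with two legitimate receivers (outputs $Y_1$, $Y_2$) and an external eavesdropper (output $Z$). A code of block length $n$ has independent uniform messages $W_j\in\{1,\dots,M_{jn}\}$, $j=1,2$, a possibly randomized encoder $P_{X^n|W_1W_2}$, and decoders that map $Y_j^n$ to an estimate $\hat W_j$ or an error. A pair $(R_1,R_2)$ with $R_1,R_2\ge 0$ is achievable if there is a sequence of codes with $$\liminf_n \tfrac1n\log_2 M_{jn}\ge R_j\ (j=1,2),\qquad \lim_n \mathbb P\big((\hat W_1,\hat W_2)\ne(W_1,W_2)\big)=0,$$ $$\liminf_n \tfrac1n H(W_1W_2|Z^n)\ge R_1+R_2,\qquad \lim_n \tfrac1n I(W_1W_2;Z^n)=0 .$$ The secrecy capacity region is the closure of the set of achievable pairs. Let $\mathcal R_o$ be the set of pairs $(R_1,R_2)$, $R_1,R_2\ge0$, for which there are auxiliary random variables $T,V_1,V_2,U_1,U_2,S_1,S_2$ with finite alphabets (of any size) and joint law $P_{TV_1V_2U_1U_2S_1S_2}\,P_{X|U_1U_2S_1S_2}\,P_{Y_1Y_2Z|X}$,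 so that $(T,V_1,V_2,S_1,S_2,U_1,U_2)\to X\to(Y_1,Y_2,Z)$ is a Markov chain, such that $$\begin{aligned} R_1&\le I(U_1;Y_1|TV_1)-I(U_1;Z|TV_1),\\ R_1&\le I(U_1;Y_1Y_2|TV_1V_2)-I(U_1;Z|TV_1V_2),\\ R_1&\le I(U_1;Y_1|TV_1U_2)-I(U_1;Z|TV_1U_2),\\ R_1&\le I(U_1;Y_1Y_2|TV_1U_2V_2)-I(U_1;Z|TV_1U_2V_2),\\ R_2&\le I(U_2;Y_2|TV_2)-I(U_2;Z|TV_2),\\ R_2&\le I(U_2;Y_2Y_1|TV_1V_2)-I(U_2;Z|TV_1V_2),\\ R_2&\le I(U_2;Y_2|TV_2U_1)-I(U_2;Z|TV_2U_1),\\ R_2&\le I(U_2;Y_2Y_1|TU_1V_1V_2)-I(U_2;Z|TU_1V_1V_2),\\ R_1+R_2&\le I(X;Y_2|TZV_1)+I(U_1S_1;Y_1|TV_1)-I(U_1S_1;ZY_2|TV_1),\\ R_1+R_2&\le I(X;Y_2|TZV_1V_2)+I(U_1S_1;Y_1Y_2|TV_1V_2)-I(U_1S_1;ZY_2|TV_1V_2),\\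 R_1+R_2&\le I(X;Y_1|TZV_2)+I(U_2S_2;Y_2|TV_2)-I(U_2S_2;ZY_1|TV_2),\\ R_1+R_2&\le I(X;Y_1|TZV_1V_2)+I(U_2S_2;Y_2Y_1|TV_1V_2)-I(U_2S_2;ZY_1|TV_1V_2). \end{aligned}$$ Then the secrecy capacity region is contained in the closure of $\mathcal R_o$. Moreover, if there is no secrecy constraint, i.e. $Z$ is constant, then $\mathcal R_o$ equals the Nair–El Gamal region: the set of pairs $(R_1,R_2)$, $R_1,R_2\ge0$, such that for some finite-alphabet $(U,V)\to X\to(Y_1,Y_2)$, $$R_1\le I(U;Y_1),\quad R_2\le I(V;Y_2),\quad R_1+R_2\le I(U;Y_1)+I(X;Y_2|U),\quad R_1+R_2\le I(V;Y_2)+I(X;Y_1|V).$$ -/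

import Mathlib

open Filter Topology

noncomputable section

namespace WiretapBC

/-! ### Information measures (in bits) of random variables on a finite probability space

A finite probability space is a finite type `Ω` with a probability vector `p : Ω → ℝ`
(`p ∈ stdSimplex ℝ Ω`); a random variable is a function on `Ω` with values in a finite type. -/

section Information

variable {Ω α β γ : Type*} [Fintype Ω] [Fintype α] [Fintype β] [Fintype γ]

/-- The pair `(A, B)` of two random variables. -/
def pair (A : Ω → α) (B : Ω → β) : Ω → α × β := fun ω => (A ω, B ω)

open Classical in
/-- The probability of an event. -/
def prob (p : Ω → ℝ) (E : Ω → Prop) : ℝ := ∑ ω, if E ω then p ω else 0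

/-- The entropy `H(A)`. -/
def entropy (p : Ω → ℝ) (A : Ω → α) : ℝ :=
  -∑ a, prob p (fun ω => A ω = a) * Real.logb 2 (prob p (fun ω => A ω = a))

/-- The conditional entropy
`H(A | B) = -∑ P(A = a, B = b) log₂ P(A = a | B = b)`; terms of probability zero vanish. -/
def condEntropy (p : Ω → ℝ) (A : Ω → α) (B : Ω → β) : ℝ :=
  -∑ a, ∑ b, prob p (fun ω => A ω = a ∧ B ω = b) *
    Real.logb 2 (prob p (fun ω => A ω = a ∧ B ω = b) / prob p (fun ω => B ω = b))

/-- The mutual information `I(A ; B) = H(A) - H(A | B)`. -/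
def mutualInfo (p : Ω → ℝ) (A : Ω → α) (B : Ω → β) : ℝ :=
  entropy p A - condEntropy p A B

/-- The conditional mutual information `I(A ; B | C) = H(A | C) - H(A | B, C)`. -/
def condMutualInfo (p : Ω → ℝ) (A : Ω → α) (B : Ω → β) (C : Ω → γ) : ℝ :=
  condEntropy p A C - condEntropy p A (pair B C)

end Information

infixr:70 " ⋈ " => pair

/-! ### The channel, codes, and the secrecy capacity region -/

/-- A memoryless broadcast channel with input alphabet `𝒳`, outputs `𝒴₁`, `𝒴₂` at the two
legitimate receivers and output `𝒵` at the eavesdropper: `W x (y₁, y₂, z) = P(y₁, y₂, z | x)`. -/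
structure Channel (𝒳 𝒴₁ 𝒴₂ 𝒵 : Type*) [Fintype 𝒴₁] [Fintype 𝒴₂] [Fintype 𝒵] where
  W : 𝒳 → 𝒴₁ × 𝒴₂ × 𝒵 → ℝ
  isPMF : ∀ x, W x ∈ stdSimplex ℝ (𝒴₁ × 𝒴₂ × 𝒵)

/-- A code of block length `n`: message sets of sizes `M₁, M₂ ≥ 1`, an encoder
`enc w₁ w₂ xⁿ = P(xⁿ | w₁, w₂)` that may randomize (a deterministic encoder is a point mass), and
two decoders, which output a message or declare an error (`none`). -/
structure Code (𝒳 𝒴₁ 𝒴₂ : Type*) [Fintype 𝒳] (n : ℕ) where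
  M₁ : ℕ
  M₂ : ℕ
  M₁_pos : 0 < M₁
  M₂_pos : 0 < M₂
  enc : Fin M₁ → Fin M₂ → (Fin n → 𝒳) → ℝ
  enc_isPMF : ∀ w₁ w₂, enc w₁ w₂ ∈ stdSimplex ℝ (Fin n → 𝒳)
  dec₁ : (Fin n → 𝒴₁) → Option (Fin M₁)
  dec₂ : (Fin n → 𝒴₂) → Option (Fin M₂)

variable {𝒳 𝒴₁ 𝒴₂ 𝒵 : Type*} [Fintype 𝒳] [Fintype 𝒴₁] [Fintype 𝒴₂] [Fintype 𝒵]

namespace Code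

variable {n : ℕ}

/-- The sample space of one block transmission: `(w₁, w₂, xⁿ, y₁ⁿ, y₂ⁿ, zⁿ)`. -/
abbrev Space (𝒵 : Type*) (c : Code 𝒳 𝒴₁ 𝒴₂ n) : Type _ :=
  Fin c.M₁ × Fin c.M₂ × (Fin n → 𝒳) × (Fin n → 𝒴₁) × (Fin n → 𝒴₂) × (Fin n → 𝒵)

/-- The joint law of messages, input and outputs: the messages are independent and uniform, and
the channel is used `n` times without memory or feedback. -/
def law (P : Channel 𝒳 𝒴₁ 𝒴₂ 𝒵) (c : Code 𝒳 𝒴₁ 𝒴₂ n) : c.Space 𝒵 → ℝ :=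
  fun (w₁, w₂, x, y₁, y₂, z) =>
    (1 / ((c.M₁ : ℝ) * (c.M₂ : ℝ))) * c.enc w₁ w₂ x * ∏ i, P.W (x i) (y₁ i, y₂ i, z i)

/-- The pair `(W₁, W₂)` of messages. -/
def messages (c : Code 𝒳 𝒴₁ 𝒴₂ n) : c.Space 𝒵 → Fin c.M₁ × Fin c.M₂ :=
  fun (w₁, w₂, _, _, _, _) => (w₁, w₂)

/-- The eavesdropper's observation `Zⁿ`. -/
def eavesdropper (c : Code 𝒳 𝒴₁ 𝒴₂ n) : c.Space 𝒵 → (Fin n → 𝒵) :=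
  fun (_, _, _, _, _, z) => z

/-- The probability that at least one of the two receivers does not recover its message. -/
def errorProb (P : Channel 𝒳 𝒴₁ 𝒴₂ 𝒵) (c : Code 𝒳 𝒴₁ 𝒴₂ n) : ℝ :=
  prob (c.law P) (fun (w₁, w₂, _, y₁, y₂, _) => c.dec₁ y₁ ≠ some w₁ ∨ c.dec₂ y₂ ≠ some w₂)

/-- The equivocation `H(W₁ W₂ | Zⁿ)`. -/
def equivocation (P : Channel 𝒳 𝒴₁ 𝒴₂ 𝒵) (c : Code 𝒳 𝒴₁ 𝒴₂ n) : ℝ :=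
  condEntropy (c.law P) c.messages c.eavesdropper

/-- The leakage `I(W₁ W₂ ; Zⁿ)`. -/
def leakage (P : Channel 𝒳 𝒴₁ 𝒴₂ 𝒵) (c : Code 𝒳 𝒴₁ 𝒴₂ n) : ℝ :=
  mutualInfo (c.law P) c.messages c.eavesdropper

end Code

/-- `liminf aₙ ≥ r` (also when the liminf is `+∞`). -/
def LiminfGE (a : ℕ → ℝ) (r : ℝ) : Prop := ∀ ε > 0, ∀ᶠ n in atTop, r - ε ≤ a n

/-- A rate pair is achievable if some sequence of codes has asymptotic rates at least `R₁`, `R₂`,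
vanishing error probability, normalized equivocation asymptotically at least `R₁ + R₂`, and
vanishing normalized leakage about the messages. -/
def Achievable (P : Channel 𝒳 𝒴₁ 𝒴₂ 𝒵) (R : ℝ × ℝ) : Prop :=
  0 ≤ R.1 ∧ 0 ≤ R.2 ∧ ∃ c : ∀ n : ℕ, Code 𝒳 𝒴₁ 𝒴₂ n,
    LiminfGE (fun n => Real.logb 2 (c n).M₁ / n) R.1 ∧
    LiminfGE (fun n => Real.logb 2 (c n).M₂ / n) R.2 ∧
    Tendsto (fun n => (c n).errorProb P) atTop (𝓝 0) ∧
    LiminfGE (fun n => (c n).equivocation P / n) (R.1 + R.2) ∧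
    Tendsto (fun n => (c n).leakage P / n) atTop (𝓝 0)

/-- The secrecy capacity region: the closure of the set of achievable rate pairs. -/
def secrecyCapacityRegion (P : Channel 𝒳 𝒴₁ 𝒴₂ 𝒵) : Set (ℝ × ℝ) :=
  closure {R | Achievable P R}

/-! ### The outer bound -/

/-- The twelve constraints, for random variables on a finite probability space. -/
structure OuterConstraints {Ω 𝒯 𝒱₁ 𝒱₂ 𝒰₁ 𝒰₂ 𝒮₁ 𝒮₂ : Type*} [Fintype Ω]
    [Fintype 𝒯] [Fintype 𝒱₁] [Fintype 𝒱₂] [Fintype 𝒰₁] [Fintype 𝒰₂] [Fintype 𝒮₁] [Fintype 𝒮₂]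
    (p : Ω → ℝ) (T : Ω → 𝒯) (V₁ : Ω → 𝒱₁) (V₂ : Ω → 𝒱₂) (U₁ : Ω → 𝒰₁) (U₂ : Ω → 𝒰₂)
    (S₁ : Ω → 𝒮₁) (S₂ : Ω → 𝒮₂) (X : Ω → 𝒳) (Y₁ : Ω → 𝒴₁) (Y₂ : Ω → 𝒴₂) (Z : Ω → 𝒵)
    (R₁ R₂ : ℝ) : Prop where
  r₁_a : R₁ ≤ condMutualInfo p U₁ Y₁ (T ⋈ V₁) - condMutualInfo p U₁ Z (T ⋈ V₁)
  r₁_b : R₁ ≤ condMutualInfo p U₁ (Y₁ ⋈ Y₂) (T ⋈ V₁ ⋈ V₂) - condMutualInfo p U₁ Z (T ⋈ V₁ ⋈ V₂)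
  r₁_c : R₁ ≤ condMutualInfo p U₁ Y₁ (T ⋈ V₁ ⋈ U₂) - condMutualInfo p U₁ Z (T ⋈ V₁ ⋈ U₂)
  r₁_d : R₁ ≤ condMutualInfo p U₁ (Y₁ ⋈ Y₂) (T ⋈ V₁ ⋈ U₂ ⋈ V₂)
    - condMutualInfo p U₁ Z (T ⋈ V₁ ⋈ U₂ ⋈ V₂)
  r₂_a : R₂ ≤ condMutualInfo p U₂ Y₂ (T ⋈ V₂) - condMutualInfo p U₂ Z (T ⋈ V₂)
  r₂_b : R₂ ≤ condMutualInfo p U₂ (Y₂ ⋈ Y₁) (T ⋈ V₁ ⋈ V₂) - condMutualInfo p U₂ Z (T ⋈ V₁ ⋈ V₂)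
  r₂_c : R₂ ≤ condMutualInfo p U₂ Y₂ (T ⋈ V₂ ⋈ U₁) - condMutualInfo p U₂ Z (T ⋈ V₂ ⋈ U₁)
  r₂_d : R₂ ≤ condMutualInfo p U₂ (Y₂ ⋈ Y₁) (T ⋈ U₁ ⋈ V₁ ⋈ V₂)
    - condMutualInfo p U₂ Z (T ⋈ U₁ ⋈ V₁ ⋈ V₂)
  sum_a : R₁ + R₂ ≤ condMutualInfo p X Y₂ (T ⋈ Z ⋈ V₁)
    + condMutualInfo p (U₁ ⋈ S₁) Y₁ (T ⋈ V₁)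
    - condMutualInfo p (U₁ ⋈ S₁) (Z ⋈ Y₂) (T ⋈ V₁)
  sum_b : R₁ + R₂ ≤ condMutualInfo p X Y₂ (T ⋈ Z ⋈ V₁ ⋈ V₂)
    + condMutualInfo p (U₁ ⋈ S₁) (Y₁ ⋈ Y₂) (T ⋈ V₁ ⋈ V₂)
    - condMutualInfo p (U₁ ⋈ S₁) (Z ⋈ Y₂) (T ⋈ V₁ ⋈ V₂)
  sum_c : R₁ + R₂ ≤ condMutualInfo p X Y₁ (T ⋈ Z ⋈ V₂)
    + condMutualInfo p (U₂ ⋈ S₂) Y₂ (T ⋈ V₂)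
    - condMutualInfo p (U₂ ⋈ S₂) (Z ⋈ Y₁) (T ⋈ V₂)
  sum_d : R₁ + R₂ ≤ condMutualInfo p X Y₁ (T ⋈ Z ⋈ V₁ ⋈ V₂)
    + condMutualInfo p (U₂ ⋈ S₂) (Y₂ ⋈ Y₁) (T ⋈ V₁ ⋈ V₂)
    - condMutualInfo p (U₂ ⋈ S₂) (Z ⋈ Y₁) (T ⋈ V₁ ⋈ V₂)

section Joint

variable {𝒯 𝒱₁ 𝒱₂ 𝒰₁ 𝒰₂ 𝒮₁ 𝒮₂ : Type}

/-- The joint law of `(T, V₁, V₂, U₁, U₂, S₁, S₂, X, Y₁, Y₂, Z)` given by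
`q = P_{T V₁ V₂ U₁ U₂ S₁ S₂}`, `r = P_{X | U₁ U₂ S₁ S₂}` and the channel; in particular
`(T, V₁, V₂, S₁, S₂, U₁, U₂) → X → (Y₁, Y₂, Z)` is a Markov chain. -/
def jointLaw (P : Channel 𝒳 𝒴₁ 𝒴₂ 𝒵) (q : 𝒯 × 𝒱₁ × 𝒱₂ × 𝒰₁ × 𝒰₂ × 𝒮₁ × 𝒮₂ → ℝ)
    (r : 𝒰₁ × 𝒰₂ × 𝒮₁ × 𝒮₂ → 𝒳 → ℝ) :
    (𝒯 × 𝒱₁ × 𝒱₂ × 𝒰₁ × 𝒰₂ × 𝒮₁ × 𝒮₂) × 𝒳 × 𝒴₁ × 𝒴₂ × 𝒵 → ℝ :=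
  fun ((t, v₁, v₂, u₁, u₂, s₁, s₂), x, y₁, y₂, z) =>
    q (t, v₁, v₂, u₁, u₂, s₁, s₂) * r (u₁, u₂, s₁, s₂) x * P.W x (y₁, y₂, z)

end Joint

/-- The rate pairs that satisfy the twelve constraints for some auxiliary random variables
`T, V₁, V₂, U₁, U₂, S₁, S₂` with (arbitrarily large) finite alphabets. -/
def outerRegion (P : Channel 𝒳 𝒴₁ 𝒴₂ 𝒵) : Set (ℝ × ℝ) :=
  {R | 0 ≤ R.1 ∧ 0 ≤ R.2 ∧
    ∃ (𝒯 𝒱₁ 𝒱₂ 𝒰₁ 𝒰₂ 𝒮₁ 𝒮₂ : Type) (_ : Fintype 𝒯) (_ : Fintype 𝒱₁) (_ : Fintype 𝒱₂)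
      (_ : Fintype 𝒰₁) (_ : Fintype 𝒰₂) (_ : Fintype 𝒮₁) (_ : Fintype 𝒮₂)
      (q : 𝒯 × 𝒱₁ × 𝒱₂ × 𝒰₁ × 𝒰₂ × 𝒮₁ × 𝒮₂ → ℝ) (r : 𝒰₁ × 𝒰₂ × 𝒮₁ × 𝒮₂ → 𝒳 → ℝ),
      q ∈ stdSimplex ℝ (𝒯 × 𝒱₁ × 𝒱₂ × 𝒰₁ × 𝒰₂ × 𝒮₁ × 𝒮₂) ∧
      (∀ a, r a ∈ stdSimplex ℝ 𝒳) ∧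
      OuterConstraints (jointLaw P q r)
        (T := fun ((t, _, _, _, _, _, _), _, _, _, _) => t)
        (V₁ := fun ((_, v₁, _, _, _, _, _), _, _, _, _) => v₁)
        (V₂ := fun ((_, _, v₂, _, _, _, _), _, _, _, _) => v₂)
        (U₁ := fun ((_, _, _, u₁, _, _, _), _, _, _, _) => u₁)
        (U₂ := fun ((_, _, _, _, u₂, _, _), _, _, _, _) => u₂)
        (S₁ := fun ((_, _, _, _, _, s₁, _), _, _, _, _) => s₁)
        (S₂ := fun ((_, _, _, _, _, _, s₂), _, _, _, _) => s₂)
        (X := fun (_, x, _, _, _) => x)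
        (Y₁ := fun (_, _, y₁, _, _) => y₁)
        (Y₂ := fun (_, _, _, y₂, _) => y₂)
        (Z := fun (_, _, _, _, z) => z)
        R.1 R.2}

/-! ### The Nair–El Gamal region of the broadcast channel without eavesdropper -/

/-- The four constraints of the Nair–El Gamal outer bound. -/
structure NairElGamalConstraints {Ω 𝒰 𝒱 : Type*} [Fintype Ω] [Fintype 𝒰] [Fintype 𝒱]
    (p : Ω → ℝ) (U : Ω → 𝒰) (V : Ω → 𝒱) (X : Ω → 𝒳) (Y₁ : Ω → 𝒴₁) (Y₂ : Ω → 𝒴₂)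
    (R₁ R₂ : ℝ) : Prop where
  r₁ : R₁ ≤ mutualInfo p U Y₁
  r₂ : R₂ ≤ mutualInfo p V Y₂
  sum_a : R₁ + R₂ ≤ mutualInfo p U Y₁ + condMutualInfo p X Y₂ U
  sum_b : R₁ + R₂ ≤ mutualInfo p V Y₂ + condMutualInfo p X Y₁ V

/-- The Nair–El Gamal region of the broadcast channel `X → (Y₁, Y₂)`, the eavesdropper's output
being ignored: `(U, V) → X → (Y₁, Y₂)` with `q = P_{U V X}`. -/
def nairElGamalRegion (P : Channel 𝒳 𝒴₁ 𝒴₂ 𝒵) : Set (ℝ × ℝ) :=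
  {R | 0 ≤ R.1 ∧ 0 ≤ R.2 ∧
    ∃ (𝒰 𝒱 : Type) (_ : Fintype 𝒰) (_ : Fintype 𝒱) (q : 𝒰 × 𝒱 × 𝒳 → ℝ),
      q ∈ stdSimplex ℝ (𝒰 × 𝒱 × 𝒳) ∧
      NairElGamalConstraints
        (p := fun ((u, v, x), y₁, y₂, z) => q (u, v, x) * P.W x (y₁, y₂, z))
        (U := fun ((u, _, _), _, _, _) => u)
        (V := fun ((_, v, _), _, _, _) => v)
        (X := fun ((_, _, x), _, _, _) => x)
        (Y₁ := fun (_, y₁, _, _) => y₁)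
        (Y₂ := fun (_, _, y₂, _) => y₂)
        R.1 R.2}

end WiretapBC

end

/-! Every information quantity here is a signed sum of joint entropies, and an entropy sees a
variable only through its level sets. Identities thus become bookkeeping on fibres
(`entropy_congr`), and inequalities follow from submodularity (`entropy_submod`), which, like Fano's
inequality, is Gibbs' inequality for a suitable kernel.

Outer bound. For a block code let `U_j` be the message `W_j`, `V_j` the past of `Y_j`, `T` a uniform
time together with the future of `Z`, `S₁` the future of `Y₂` and `S₂` the future of `Y₁`. Fano's
inequality and small leakage give n-letter bounds (`rate_bound`, `sum_rate_bound`). Csiszár's sum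
identity, a telescoping of entropies of hybrid sequences (past of `Y`, future of `Z`), turns them
into sums of single-letter terms (`sum_condMutualInfo_sub`, `le_sum_condMutualInfo`); for the sum
rate, memorylessness controls the noise term (`sum_condEntropy_le`). Two gaps remain. The region
wants the input generated from `U₁, U₂, S₁, S₂` alone: a one-time pad splits the input into shares
placed in `S₁` and `S₂`, and no constraint contains both (`OuterSatisfiable.of_isMarkov`). The
region also wants nonnegative rates, while the converse only yields rates slightly below the target:
on the axes one message is given up and its variable moved into `S` (`mem_closure_outerRegion`).

Constant `Z`. From the twelve constraints, `U = (U₁, S₁, T, V₁)` and `V = (U₂, S₂, T, V₂)` satisfy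
the Nair–El Gamal bounds. Conversely, `V₁` and `V₂` are taken to be independent keys that mask the
codewords in `U₁` and `U₂`, so that conditioning on the other codeword without its key tells nothing
(`OuterSatisfiable.of_masked`). When both keys are present, the constraint that survives is `R₁ ≤
I(X; Y₁Y₂ | V)`, or its mirror image. It may fail if `R₂ < I(V; Y₂)`, so `V` is first erased at
random until `R₂ = I(V; Y₂)`; the unerased copy is kept in `S₂` for the sum rate. -/

set_option linter.unusedSectionVars false

noncomputable section

namespace WiretapBC

/-! ### Entropy calculus on finite probability spaces -/

section Calculus

variable {Ω Ω' α β γ δ : Type*} [Fintype Ω] [Fintype Ω'] [Fintype α] [Fintype β] [Fintype γ]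
  [Fintype δ]

theorem prob_nonneg {p : Ω → ℝ} (hp : ∀ ω, 0 ≤ p ω) (E : Ω → Prop) : 0 ≤ prob p E :=
  Finset.sum_nonneg fun ω _ => by split_ifs <;> simp [hp]

theorem prob_mono {p : Ω → ℝ} (hp : ∀ ω, 0 ≤ p ω) {E F : Ω → Prop} (h : ∀ ω, E ω → F ω) :
    prob p E ≤ prob p F := by
  refine Finset.sum_le_sum fun ω _ => ?_
  by_cases hE : E ω
  · simp [hE, h ω hE]
  · by_cases hF : F ω <;> simp [hE, hF, hp]

theorem prob_congr (p : Ω → ℝ) {E F : Ω → Prop} (h : ∀ ω, E ω ↔ F ω) : prob p E = prob p F := by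
  rw [funext fun ω => propext (h ω)]

theorem le_prob {p : Ω → ℝ} (hp : ∀ ω, 0 ≤ p ω) {E : Ω → Prop} {ω : Ω} (h : E ω) :
    p ω ≤ prob p E := by
  have := Finset.single_le_sum (f := fun ω => @ite ℝ (E ω) (Classical.propDecidable _) (p ω) 0)
    (fun ω _ => by split_ifs <;> simp [hp]) (Finset.mem_univ ω)
  simpa [h, prob] using this

theorem prob_self_pos {p : Ω → ℝ} (hp : p ∈ stdSimplex ℝ Ω) (A : Ω → α) {ω : Ω} (h : 0 < p ω) :
    0 < prob p fun ω' => A ω' = A ω :=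
  h.trans_le (le_prob hp.1 rfl)

theorem sum_prob_mul (p : Ω → ℝ) (A : Ω → α) (f : α → ℝ) :
    ∑ a, prob p (fun ω => A ω = a) * f a = ∑ ω, p ω * f (A ω) := by
  classical
  simp only [prob, Finset.sum_mul]
  rw [Finset.sum_comm]
  refine Finset.sum_congr rfl fun ω _ => ?_
  rw [Finset.sum_eq_single (A ω)]
  · simp
  · intro b _ hb
    simp [hb.symm]
  · simp

theorem sum_prob (p : Ω → ℝ) (A : Ω → α) : ∑ a, prob p (fun ω => A ω = a) = ∑ ω, p ω := by
  simpa using sum_prob_mul p A fun _ => 1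

theorem sum_prob_and (p : Ω → ℝ) (A : Ω → α) (E : Ω → Prop) :
    ∑ a, prob p (fun ω => E ω ∧ A ω = a) = prob p E := by
  classical
  simp only [prob]
  rw [Finset.sum_comm]
  refine Finset.sum_congr rfl fun ω _ => ?_
  by_cases h : E ω <;> simp [h]

/-- As an expectation over sample points, entropy involves a variable only through the probability
of the fibre of each point. Points of mass zero drop out, so logarithms are only split where all
probabilities are positive. -/
theorem entropy_eq (p : Ω → ℝ) (A : Ω → α) :
    entropy p A = -∑ ω, p ω * Real.logb 2 (prob p fun ω' => A ω' = A ω) := by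
  rw [entropy, sum_prob_mul p A fun a => Real.logb 2 (prob p fun ω' => A ω' = a)]

/-- The entropy depends only on the partition into level sets. -/
theorem entropy_congr (p : Ω → ℝ) {A : Ω → α} {B : Ω → β} (h : ∀ ω ω', A ω = A ω' ↔ B ω = B ω') :
    entropy p A = entropy p B := by
  simp only [entropy_eq, h]

theorem entropy_mono {p : Ω → ℝ} (hp : p ∈ stdSimplex ℝ Ω) {A : Ω → α} {B : Ω → β}
    (h : ∀ ω ω', B ω = B ω' → A ω = A ω') : entropy p A ≤ entropy p B := by
  rw [entropy_eq, entropy_eq, neg_le_neg_iff]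
  refine Finset.sum_le_sum fun ω _ => ?_
  rcases (hp.1 ω).eq_or_lt with h0 | h0
  · simp [← h0]
  · refine mul_le_mul_of_nonneg_left ?_ h0.le
    exact Real.logb_le_logb_of_le (by norm_num) (h0.trans_le (le_prob hp.1 rfl))
      (prob_mono hp.1 fun ω' => h ω' ω)

/-- The law of `F`, as a probability vector. -/
def law (p : Ω → ℝ) (F : Ω → Ω') : Ω' → ℝ := fun ω' => prob p fun ω => F ω = ω'

theorem law_mem {p : Ω → ℝ} (hp : p ∈ stdSimplex ℝ Ω) (F : Ω → Ω') :
    law p F ∈ stdSimplex ℝ Ω' :=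
  ⟨fun _ => prob_nonneg hp.1 _, (sum_prob p F).trans hp.2⟩

theorem prob_law (p : Ω → ℝ) (F : Ω → Ω') (E : Ω' → Prop) :
    prob (law p F) E = prob p fun ω => E (F ω) := by
  classical
  have := sum_prob_mul p F fun ω' => if E ω' then 1 else 0
  simp only [mul_ite, mul_one, mul_zero] at this
  simp only [prob, law] at this ⊢
  convert this

theorem entropy_law (p : Ω → ℝ) (F : Ω → Ω') (A : Ω' → α) :
    entropy (law p F) A = entropy p fun ω => A (F ω) := by
  simp only [entropy, prob_law]

theorem entropy_comp_equiv (p : Ω → ℝ) (p' : Ω' → ℝ) (e : Ω' ≃ Ω) (h : ∀ ω, p (e ω) = p' ω)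
    (A : Ω → α) : entropy p' (fun ω => A (e ω)) = entropy p A := by
  have : ∀ E : Ω → Prop, prob p' (fun ω => E (e ω)) = prob p E := fun E => by
    classical
    simp only [prob]
    rw [← Equiv.sum_comp e]
    simp only [h]
  rw [entropy, entropy]
  congr 1
  refine Finset.sum_congr rfl fun a _ => ?_
  rw [this fun ω => A ω = a]

theorem condEntropy_eq {p : Ω → ℝ} (hp : p ∈ stdSimplex ℝ Ω) (A : Ω → α) (B : Ω → β) :
    condEntropy p A B = entropy p (A ⋈ B) - entropy p B := by
  have h1 : condEntropy p A B = -∑ c : α × β, prob p (fun ω => (A ⋈ B) ω = c) *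
      Real.logb 2 (prob p (fun ω => (A ⋈ B) ω = c) / prob p (fun ω => B ω = c.2)) := by
    rw [condEntropy, Fintype.sum_prod_type]
    simp only [pair, Prod.mk.injEq]
  rw [h1, sum_prob_mul p (A ⋈ B) fun c => Real.logb 2 (prob p (fun ω => (A ⋈ B) ω = c) /
    prob p (fun ω => B ω = c.2)), entropy_eq, entropy_eq, sub_neg_eq_add, neg_add_eq_sub,
    ← Finset.sum_sub_distrib, ← Finset.sum_neg_distrib]
  refine Finset.sum_congr rfl fun ω _ => ?_
  rcases (hp.1 ω).eq_or_lt with h0 | h0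
  · simp [← h0]
  · have := Real.logb_div (b := 2) (prob_self_pos hp (A ⋈ B) h0).ne' (prob_self_pos hp B h0).ne'
    simp only [pair] at this ⊢
    rw [this]
    ring

theorem mutualInfo_eq {p : Ω → ℝ} (hp : p ∈ stdSimplex ℝ Ω) (A : Ω → α) (B : Ω → β) :
    mutualInfo p A B = entropy p A + entropy p B - entropy p (A ⋈ B) := by
  rw [mutualInfo, condEntropy_eq hp]
  ring

theorem condMutualInfo_eq {p : Ω → ℝ} (hp : p ∈ stdSimplex ℝ Ω) (A : Ω → α) (B : Ω → β)
    (C : Ω → γ) : condMutualInfo p A B C =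
      entropy p (A ⋈ C) + entropy p (B ⋈ C) - entropy p (A ⋈ B ⋈ C) - entropy p C := by
  rw [condMutualInfo, condEntropy_eq hp, condEntropy_eq hp]
  ring

/-- Gibbs' inequality, in conditional form. -/
theorem entropy_gibbs {p : Ω → ℝ} (hp : p ∈ stdSimplex ℝ Ω) (A : Ω → α) (B : Ω → β)
    (Q : α → β → ℝ) (hQ0 : ∀ a b, 0 ≤ Q a b) (hQ1 : ∀ b, ∑ a, Q a b ≤ 1)
    (hQ : ∀ ω, 0 < p ω → 0 < Q (A ω) (B ω)) :
    entropy p (A ⋈ B) - entropy p B ≤ -∑ ω, p ω * Real.logb 2 (Q (A ω) (B ω)) := by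
  set PB : β → ℝ := fun b => prob p fun ω => B ω = b with hPB
  set PAB : α × β → ℝ := fun c => prob p fun ω => (A ⋈ B) ω = c with hPAB
  have hl2 : 0 < Real.log 2 := Real.log_pos (by norm_num)
  -- The expected likelihood ratio is at most one; the bound `log x ≤ x - 1` applied to this ratio
  -- then gives the claim.
  have key : ∑ ω, p ω * (PB (B ω) * Q (A ω) (B ω) / PAB (A ω, B ω)) ≤ 1 := by
    have h5 := sum_prob_mul p (A ⋈ B) fun c => PB c.2 * Q c.1 c.2 / PAB c
    simp only [pair] at h5
    rw [← h5]
    calc _ ≤ ∑ c : α × β, PB c.2 * Q c.1 c.2 := by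
          refine Finset.sum_le_sum fun c _ => ?_
          have h0 : 0 ≤ PB c.2 * Q c.1 c.2 := mul_nonneg (prob_nonneg hp.1 _) (hQ0 _ _)
          change PAB c * _ ≤ _
          by_cases hc : PAB c = 0
          · simpa [hc] using h0
          · rw [mul_div_cancel₀ _ hc]
      _ = ∑ b, PB b * ∑ a, Q a b := by
          rw [Fintype.sum_prod_type_right]
          simp only [Finset.mul_sum]
      _ ≤ ∑ b, PB b := Finset.sum_le_sum fun b _ =>
          mul_le_of_le_one_right (prob_nonneg hp.1 _) (hQ1 b)
      _ = 1 := (sum_prob p B).trans hp.2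
  have hterm : ∀ ω, p ω * Real.logb 2 (PB (B ω)) - p ω * Real.logb 2 (PAB (A ω, B ω)) +
      p ω * Real.logb 2 (Q (A ω) (B ω)) ≤
      (p ω * (PB (B ω) * Q (A ω) (B ω) / PAB (A ω, B ω)) - p ω) / Real.log 2 := by
    intro ω
    rcases (hp.1 ω).eq_or_lt with h0 | h0
    · simp [← h0]
    · have hB : 0 < PB (B ω) := h0.trans_le (le_prob hp.1 rfl)
      have hAB : 0 < PAB (A ω, B ω) := h0.trans_le (le_prob hp.1 rfl)
      have hq := hQ ω h0
      have := Real.log_le_sub_one_of_pos (div_pos (mul_pos hB hq) hAB)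
      rw [Real.log_div (mul_pos hB hq).ne' hAB.ne', Real.log_mul hB.ne' hq.ne'] at this
      have h3 := div_le_div_of_nonneg_right (mul_le_mul_of_nonneg_left this h0.le) hl2.le
      simp only [Real.logb]
      refine (le_of_eq ?_).trans (h3.trans (le_of_eq ?_)) <;> ring
  have hsum := Finset.sum_le_sum fun ω (_ : ω ∈ Finset.univ) => hterm ω
  rw [← Finset.sum_div, Finset.sum_sub_distrib, Finset.sum_add_distrib, Finset.sum_sub_distrib,
    hp.2] at hsum
  have h4 : (∑ ω, p ω * (PB (B ω) * Q (A ω) (B ω) / PAB (A ω, B ω)) - 1) / Real.log 2 ≤ 0 :=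
    div_nonpos_of_nonpos_of_nonneg (by linarith) hl2.le
  rw [entropy_eq, entropy_eq]
  change -∑ ω, p ω * Real.logb 2 (PAB (A ω, B ω)) - -∑ ω, p ω * Real.logb 2 (PB (B ω)) ≤ _
  linarith

/-- Submodularity of entropy. -/
theorem entropy_submod {p : Ω → ℝ} (hp : p ∈ stdSimplex ℝ Ω) (A : Ω → α) (B : Ω → β) (C : Ω → γ) :
    entropy p (A ⋈ B ⋈ C) + entropy p C ≤ entropy p (A ⋈ C) + entropy p (B ⋈ C) := by
  -- Gibbs' inequality with the kernel P(a | c), which ignores `B`: this is H(A | BC) ≤ H(A | C).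
  have h := entropy_gibbs hp A (B ⋈ C)
    (fun a bc => prob p (fun ω => (A ⋈ C) ω = (a, bc.2)) / prob p (fun ω => C ω = bc.2))
    (fun a b => div_nonneg (prob_nonneg hp.1 _) (prob_nonneg hp.1 _)) (fun b => by
      rw [← Finset.sum_div]
      have : ∑ a, prob p (fun ω => (A ⋈ C) ω = (a, b.2)) = prob p (fun ω => C ω = b.2) := by
        rw [← sum_prob_and p A]
        simp only [pair, Prod.mk.injEq, and_comm]
      rw [this]
      exact div_self_le_one _)
    (fun ω h => div_pos (h.trans_le (le_prob hp.1 rfl)) (h.trans_le (le_prob hp.1 rfl)))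
  have h2 : -∑ ω, p ω * Real.logb 2 (prob p (fun ω' => (A ⋈ C) ω' = (A ω, ((B ⋈ C) ω).2)) /
      prob p (fun ω' => C ω' = ((B ⋈ C) ω).2)) = entropy p (A ⋈ C) - entropy p C := by
    rw [entropy_eq, entropy_eq, sub_neg_eq_add, neg_add_eq_sub,
      ← Finset.sum_sub_distrib, ← Finset.sum_neg_distrib]
    refine Finset.sum_congr rfl fun ω _ => ?_
    rcases (hp.1 ω).eq_or_lt with h0 | h0
    · simp [← h0]
    · have := Real.logb_div (b := 2) (prob_self_pos hp (A ⋈ C) h0).ne' (prob_self_pos hp C h0).ne'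
      simp only [pair] at this ⊢
      rw [this]
      ring
  linarith

theorem entropy_const {p : Ω → ℝ} (hp : p ∈ stdSimplex ℝ Ω) {A : Ω → α}
    (h : ∀ ω ω', A ω = A ω') : entropy p A = 0 := by
  rw [entropy_eq]
  have : ∀ ω, prob p (fun ω' => A ω' = A ω) = 1 := fun ω => by
    rw [← hp.2]
    simp [prob, h _ ω]
  simp [this]

theorem entropy_subadd {p : Ω → ℝ} (hp : p ∈ stdSimplex ℝ Ω) (A : Ω → α) (B : Ω → β) :
    entropy p (A ⋈ B) ≤ entropy p A + entropy p B := by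
  have h := entropy_submod hp A B fun _ => ()
  rw [entropy_const hp (A := fun _ => ()) fun _ _ => rfl] at h
  rw [entropy_congr p (A := A ⋈ B) (B := A ⋈ B ⋈ fun _ => ()) (by simp [pair]),
    entropy_congr p (A := A) (B := A ⋈ fun _ => ()) (by simp [pair]),
    entropy_congr p (A := B) (B := B ⋈ fun _ => ()) (by simp [pair])]
  linarith

theorem entropy_le_log_card {p : Ω → ℝ} (hp : p ∈ stdSimplex ℝ Ω) (A : Ω → α) :
    entropy p A ≤ Real.logb 2 (Fintype.card α) := by
  obtain ⟨ω⟩ : Nonempty Ω := by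
    by_contra h
    rw [not_nonempty_iff] at h
    simpa using hp.2
  have : Nonempty α := ⟨A ω⟩
  have h := entropy_gibbs hp A (fun _ => ()) (fun _ _ => 1 / (Fintype.card α : ℝ))
    (fun _ _ => by positivity) (by simp) (fun _ _ => by positivity)
  rw [entropy_const hp (A := fun _ => ()) fun _ _ => rfl,
    entropy_congr p (B := A) (by simp [pair]), ← Finset.sum_mul, hp.2] at h
  simpa using h

/-- Fano's inequality, for a decoder that may declare an error. -/
theorem fano {p : Ω → ℝ} (hp : p ∈ stdSimplex ℝ Ω) (A : Ω → α) (B : Ω → β) (g : β → Option α) :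
    entropy p (A ⋈ B) - entropy p B ≤
      1 + prob p (fun ω => g (B ω) ≠ some (A ω)) * Real.logb 2 (Fintype.card α) := by
  classical
  obtain ⟨ω⟩ : Nonempty Ω := by
    by_contra h
    rw [not_nonempty_iff] at h
    simpa using hp.2
  have : Nonempty α := ⟨A ω⟩
  have hM : (1 : ℝ) ≤ Fintype.card α := by exact_mod_cast Fintype.card_pos
  -- The kernel is dominated by an equal mixture of the decoder's guess and the uniform law, so its
  -- mass is at most one even if the decoder declares an error. Its cost is one bit on a correct
  -- guess and `1 + log₂ |α|` bits otherwise.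
  have h := entropy_gibbs hp A B
    (fun a b => if g b = some a then 1 / 2 else 1 / (2 * (Fintype.card α : ℝ)))
    (fun _ _ => by split_ifs <;> positivity) (fun b => by
      calc _ ≤ ∑ a : α, ((if g b = some a then 1 / 2 else 0) + 1 / (2 * (Fintype.card α : ℝ))) := by
            refine Finset.sum_le_sum fun a _ => ?_
            split_ifs
            · simp
            · simp
        _ ≤ 1 / 2 + 1 / 2 := by
            rw [Finset.sum_add_distrib]
            refine add_le_add ?_ ?_
            · rcases g b with _ | a
              · simp
              · simp
            · simp only [Finset.sum_const, Finset.card_univ, nsmul_eq_mul]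
              rw [le_iff_eq_or_lt]; left; field_simp
        _ = 1 := by norm_num)
    (fun _ _ => by split_ifs <;> positivity)
  refine h.trans (le_of_eq ?_)
  have h1 : (1 : ℝ) = ∑ ω, p ω := hp.2.symm
  rw [prob, Finset.sum_mul]
  nth_rewrite 3 [h1]
  rw [← Finset.sum_add_distrib, ← Finset.sum_neg_distrib]
  refine Finset.sum_congr rfl fun ω _ => ?_
  by_cases hg : g (B ω) = some (A ω)
  · simp only [hg, if_true, ne_eq, not_true_eq_false, if_false]
    rw [Real.logb_div (by norm_num) (by norm_num)]
    simp
  · simp only [hg, if_false, ne_eq, not_false_eq_true, if_true]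
    rw [Real.logb_div (by norm_num) (by positivity), Real.logb_mul (by norm_num) (by positivity)]
    simp
    ring

/-! ### Product laws -/

/-- The law of two independent variables. -/
def prodLaw {ι : Type*} (p : Ω → ℝ) (ρ : ι → ℝ) : Ω × ι → ℝ := fun x => p x.1 * ρ x.2

variable {ι : Type*} [Fintype ι]

theorem prodLaw_mem {p : Ω → ℝ} (hp : p ∈ stdSimplex ℝ Ω) {ρ : ι → ℝ} (hρ : ρ ∈ stdSimplex ℝ ι) :
    prodLaw p ρ ∈ stdSimplex ℝ (Ω × ι) := by
  refine ⟨fun x => mul_nonneg (hp.1 _) (hρ.1 _), ?_⟩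
  simp only [prodLaw]
  rw [Fintype.sum_prod_type, ← Fintype.sum_mul_sum, hp.2, hρ.2, one_mul]

theorem prob_prodLaw (p : Ω → ℝ) (ρ : ι → ℝ) (E : Ω × ι → Prop) :
    prob (prodLaw p ρ) E = ∑ i, ρ i * prob p fun ω => E (ω, i) := by
  classical
  simp only [prob, prodLaw, Fintype.sum_prod_type_right, Finset.mul_sum, mul_ite, mul_zero,
    mul_comm]

/-- The entropy of a mixture with revealed mixing variable. -/
theorem entropy_prodLaw_mix {p : Ω → ℝ} (hp : p ∈ stdSimplex ℝ Ω) {ρ : ι → ℝ}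
    (hρ : ρ ∈ stdSimplex ℝ ι) (A : ι → Ω → α) :
    entropy (prodLaw p ρ) (fun x => (x.2, A x.2 x.1)) =
      entropy ρ id + ∑ i, ρ i * entropy p (A i) := by
  classical
  have h1 : ∀ i a, prob (prodLaw p ρ) (fun x => (x.2, A x.2 x.1) = (i, a)) =
      ρ i * prob p fun ω => A i ω = a := fun i a => by
    rw [prob_prodLaw, Finset.sum_eq_single i]
    · simp
    · intro j _ hj
      simp [prob, hj]
    · simp
  have h2 : ∀ i, prob ρ (fun j => id j = id i) = ρ i := fun i => by simp [prob]
  rw [entropy_eq, entropy_eq, Fintype.sum_prod_type_right]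
  simp only [h1, h2, entropy_eq, prodLaw]
  rw [← Finset.sum_neg_distrib, ← Finset.sum_neg_distrib, ← Finset.sum_add_distrib]
  refine Finset.sum_congr rfl fun i _ => ?_
  rcases (hρ.1 i).eq_or_lt with h0 | h0
  · simp [← h0]
  · have : ∀ ω, p ω * ρ i * Real.logb 2 (ρ i * prob p fun ω' => A i ω' = A i ω) =
        p ω * (ρ i * Real.logb 2 (ρ i)) +
          ρ i * (p ω * Real.logb 2 (prob p fun ω' => A i ω' = A i ω)) := fun ω => by
      rcases (hp.1 ω).eq_or_lt with h3 | h3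
      · simp [← h3]
      · rw [Real.logb_mul h0.ne' (prob_self_pos hp (A i) h3).ne']
        ring
    simp only [this, Finset.sum_add_distrib, ← Finset.sum_mul, ← Finset.mul_sum, hp.2]
    ring

theorem entropy_prodLaw_fst (p : Ω → ℝ) {ρ : ι → ℝ} (hρ : ρ ∈ stdSimplex ℝ ι) (A : Ω → α) :
    entropy (prodLaw p ρ) (fun x => A x.1) = entropy p A := by
  have : ∀ a, prob (prodLaw p ρ) (fun x => A x.1 = a) = prob p fun ω => A ω = a := fun a => by
    rw [prob_prodLaw]
    simp only
    rw [← Finset.sum_mul, hρ.2, one_mul]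
  simp only [entropy, this]

/-- The uniform law. -/
def unif (ι : Type*) [Fintype ι] : ι → ℝ := fun _ => 1 / (Fintype.card ι : ℝ)

theorem unif_mem (ι : Type*) [Fintype ι] [Nonempty ι] : unif ι ∈ stdSimplex ℝ ι :=
  ⟨fun _ => by unfold unif; positivity, by simp [unif]⟩

theorem entropy_unif (ι : Type*) [Fintype ι] [Nonempty ι] :
    entropy (unif ι) id = Real.logb 2 (Fintype.card ι) := by
  classical
  rw [entropy_eq]
  simp [prob, unif]

/-- A variable masked by an independent uniform key is uniform and independent. -/
theorem entropy_pad {G : Type*} [Fintype G] [AddGroup G] {p : Ω → ℝ} (hp : p ∈ stdSimplex ℝ Ω)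
    (A : Ω → α) (F : Ω → G) :
    entropy (prodLaw p (unif G)) (fun x => (A x.1, F x.1 + x.2)) =
      entropy p A + Real.logb 2 (Fintype.card G) := by
  let e : Ω × G ≃ Ω × G :=
    { toFun := fun x => (x.1, F x.1 + x.2)
      invFun := fun x => (x.1, -F x.1 + x.2)
      left_inv := fun x => by simp
      right_inv := fun x => by simp }
  have h := entropy_comp_equiv (prodLaw p (unif G)) (prodLaw p (unif G)) e
    (fun x => by simp [prodLaw, unif, e]) (fun x => (A x.1, x.2))
  change entropy _ (fun x : Ω × G => (A x.1, F x.1 + x.2)) = _ at h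
  rw [h, entropy_congr _ (B := fun x : Ω × G => (x.2, (fun _ : G => A) x.2 x.1))
    (by simp; tauto), entropy_prodLaw_mix hp (unif_mem G) fun _ : G => A, entropy_unif,
    ← Finset.sum_mul, (unif_mem G).2]
  ring

/-! ### Markov chains -/

variable {𝒳 𝒴 : Type*} [Fintype 𝒳] [Fintype 𝒴]

/-- `A → X → Y` is a Markov chain whose second transition is `W`. -/
def IsMarkov (W : 𝒳 → 𝒴 → ℝ) (p : Ω → ℝ) (A : Ω → α) (X : Ω → 𝒳) (Y : Ω → 𝒴) : Prop :=
  ∀ a x y, prob p (fun ω => A ω = a ∧ X ω = x ∧ Y ω = y) =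
    prob p (fun ω => A ω = a ∧ X ω = x) * W x y

theorem IsMarkov.comp {W : 𝒳 → 𝒴 → ℝ} {p : Ω → ℝ} {A : Ω → α} {X : Ω → 𝒳} {Y : Ω → 𝒴}
    (h : IsMarkov W p A X Y) (f : α → β) : IsMarkov W p (fun ω => f (A ω)) X Y := by
  classical
  intro b x y
  have key : ∀ E : Ω → Prop, prob p (fun ω => f (A ω) = b ∧ E ω) =
      ∑ a, if f a = b then prob p (fun ω => A ω = a ∧ E ω) else 0 := fun E => by
    rw [← sum_prob_and p A]
    refine Finset.sum_congr rfl fun a _ => ?_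
    split_ifs with hf
    · exact prob_congr p fun ω => ⟨fun h => ⟨h.2, h.1.2⟩, fun h => ⟨⟨by rw [h.1, hf], h.2⟩, h.1⟩⟩
    · unfold prob
      refine Finset.sum_eq_zero fun ω _ => if_neg ?_
      rintro ⟨⟨h1, -⟩, rfl⟩
      exact hf h1
  rw [key, key, Finset.sum_mul]
  refine Finset.sum_congr rfl fun a _ => ?_
  split_ifs
  · exact h a x y
  · simp

/-- The form used throughout: auxiliary variables are recognized as functions of a large Markov
variable by comparing fibres, without naming the function. -/
theorem IsMarkov.of_factor {W : 𝒳 → 𝒴 → ℝ} {p : Ω → ℝ} {A : Ω → α} {X : Ω → 𝒳} {Y : Ω → 𝒴}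
    (h : IsMarkov W p A X Y) {B : Ω → β} (hB : ∀ ω ω', A ω = A ω' → B ω = B ω') :
    IsMarkov W p B X Y := by
  rcases isEmpty_or_nonempty Ω with hΩ | ⟨⟨ω₀⟩⟩
  · intro b x y
    simp [prob]
  · have : Nonempty β := ⟨B ω₀⟩
    obtain ⟨f, rfl⟩ := (Function.factorsThrough_iff (f := A) B).1 fun ω ω' => hB ω ω'
    exact h.comp f

/-- P(a, x, y) and P(x, y) carry the same factor `W x y`, whose logarithm cancels. -/
theorem IsMarkov.entropy_eq {W : 𝒳 → 𝒴 → ℝ} {p : Ω → ℝ} (hp : p ∈ stdSimplex ℝ Ω) {A : Ω → α}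
    {X : Ω → 𝒳} {Y : Ω → 𝒴} (h : IsMarkov W p A X Y) :
    entropy p (A ⋈ X ⋈ Y) + entropy p X = entropy p (A ⋈ X) + entropy p (X ⋈ Y) := by
  have h0 : ∀ ω, prob p (fun ω' => (X ⋈ Y) ω' = (X ⋈ Y) ω) =
      prob p (fun ω' => X ω' = X ω) * W (X ω) (Y ω) := fun ω => by
    have := h.comp (fun _ => ()) () (X ω) (Y ω)
    simpa [pair] using this
  have h1 : ∀ ω, prob p (fun ω' => (A ⋈ X ⋈ Y) ω' = (A ⋈ X ⋈ Y) ω) =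
      prob p (fun ω' => (A ⋈ X) ω' = (A ⋈ X) ω) * W (X ω) (Y ω) := fun ω => by
    simpa [pair] using h (A ω) (X ω) (Y ω)
  simp only [WiretapBC.entropy_eq]
  rw [← neg_add, ← neg_add, ← Finset.sum_add_distrib, ← Finset.sum_add_distrib]
  congr 1
  refine Finset.sum_congr rfl fun ω _ => ?_
  rcases (hp.1 ω).eq_or_lt with h2 | h2
  · simp [← h2]
  · have h3 : 0 < prob p (fun ω' => (A ⋈ X ⋈ Y) ω' = (A ⋈ X ⋈ Y) ω) := h2.trans_le (le_prob hp.1 rfl)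
    have h4 : 0 < prob p (fun ω' => (A ⋈ X) ω' = (A ⋈ X) ω) := h2.trans_le (le_prob hp.1 rfl)
    have h5 : 0 < prob p (fun ω' => X ω' = X ω) := h2.trans_le (le_prob hp.1 rfl)
    have h6 : W (X ω) (Y ω) ≠ 0 := fun h6 => by simp [h1, h6] at h3
    rw [h0, h1, Real.logb_mul h4.ne' h6, Real.logb_mul h5.ne' h6]
    ring

/-- Markov chains, entropically: `I(B; D | X C) = 0` for functions `B` of `A` and `C, D` of `Y`. -/
theorem IsMarkov.entropy_eq_of_factor {W : 𝒳 → 𝒴 → ℝ} {p : Ω → ℝ} (hp : p ∈ stdSimplex ℝ Ω)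
    {A : Ω → α} {X : Ω → 𝒳} {Y : Ω → 𝒴} (h : IsMarkov W p A X Y) {B : Ω → β} {C : Ω → γ}
    {D : Ω → δ} (hB : ∀ ω ω', A ω = A ω' → B ω = B ω') (hC : ∀ ω ω', Y ω = Y ω' → C ω = C ω')
    (hD : ∀ ω ω', Y ω = Y ω' → D ω = D ω') :
    entropy p (B ⋈ X ⋈ C ⋈ D) + entropy p (X ⋈ C) =
      entropy p (B ⋈ X ⋈ C) + entropy p (X ⋈ C ⋈ D) := by
  -- Here 0 = I(B; Y | X) = I(B; C | X) + I(B; D | XC) + I(B; Y | XCD), by the chain rule. All three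
  -- terms are nonnegative, so each vanishes.
  have h1 := (h.of_factor hB).entropy_eq hp
  have h2 := entropy_submod hp B C X
  have h3 := entropy_submod hp B D (X ⋈ C)
  have h4 := entropy_submod hp B Y (X ⋈ C ⋈ D)
  have e1 : entropy p (B ⋈ C ⋈ X) = entropy p (B ⋈ X ⋈ C) :=
    entropy_congr p (by simp only [pair, Prod.mk.injEq]; tauto)
  have e2 : entropy p (C ⋈ X) = entropy p (X ⋈ C) :=
    entropy_congr p (by simp only [pair, Prod.mk.injEq]; tauto)
  have e3 : entropy p (B ⋈ D ⋈ X ⋈ C) = entropy p (B ⋈ X ⋈ C ⋈ D) :=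
    entropy_congr p (by simp only [pair, Prod.mk.injEq]; tauto)
  have e4 : entropy p (D ⋈ X ⋈ C) = entropy p (X ⋈ C ⋈ D) :=
    entropy_congr p (by simp only [pair, Prod.mk.injEq]; tauto)
  have e5 : entropy p (B ⋈ Y ⋈ X ⋈ C ⋈ D) = entropy p (B ⋈ X ⋈ Y) := entropy_congr p
    fun ω ω' => by have := hC ω ω'; have := hD ω ω'; simp only [pair, Prod.mk.injEq]; tauto
  have e6 : entropy p (Y ⋈ X ⋈ C ⋈ D) = entropy p (X ⋈ Y) := entropy_congr p
    fun ω ω' => by have := hC ω ω'; have := hD ω ω'; simp only [pair, Prod.mk.injEq]; tauto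
  linarith

/-- Since the transition `W` is the same for every index, a random index may join the first
variable; this serves for keys, coins and the time index alike. -/
theorem IsMarkov.prodLaw {W : 𝒳 → 𝒴 → ℝ} {p : Ω → ℝ} {A : ι → Ω → α} {X : ι → Ω → 𝒳}
    {Y : ι → Ω → 𝒴} (h : ∀ i, IsMarkov W p (A i) (X i) (Y i)) (ρ : ι → ℝ) :
    IsMarkov W (prodLaw p ρ) (fun z : Ω × ι => (z.2, A z.2 z.1)) (fun z => X z.2 z.1)
      (fun z => Y z.2 z.1) := by
  classical
  rintro ⟨i, a⟩ x y
  have key : ∀ E : Ω × ι → Prop, prob (WiretapBC.prodLaw p ρ)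
      (fun z => (z.2, A z.2 z.1) = (i, a) ∧ E z) =
        ρ i * prob p fun ω => A i ω = a ∧ E (ω, i) := fun E => by
    rw [prob_prodLaw, Finset.sum_eq_single i]
    · simp
    · intro j _ hj
      simp [prob, hj]
    · simp
  rw [key fun z => X z.2 z.1 = x ∧ Y z.2 z.1 = y, key fun z => X z.2 z.1 = x, h i a x y]
  ring

theorem isMarkov_of_equiv {W : 𝒳 → 𝒴 → ℝ} (hW : ∀ x, ∑ y, W x y = 1) {p : Ω → ℝ}
    (e : Ω' × 𝒴 ≃ Ω) (g : Ω' → ℝ) (X' : Ω' → 𝒳) (hp : ∀ ω y, p (e (ω, y)) = g ω * W (X' ω) y)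
    {A : Ω → α} {X : Ω → 𝒳} {Y : Ω → 𝒴} (hA : ∀ ω y y', A (e (ω, y)) = A (e (ω, y')))
    (hX : ∀ ω y, X (e (ω, y)) = X' ω) (hY : ∀ ω y, Y (e (ω, y)) = y) : IsMarkov W p A X Y := by
  classical
  intro a x y
  have key : ∀ E : Ω → Prop, prob p E = ∑ ω, ∑ y, if E (e (ω, y)) then g ω * W (X' ω) y else 0 :=
    fun E => by
      simp only [prob]
      rw [← Equiv.sum_comp e, Fintype.sum_prod_type]
      simp only [hp]
  rw [key, key, Finset.sum_mul]
  refine Finset.sum_congr rfl fun ω _ => ?_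
  simp only [hX, hY, hA ω _ y]
  by_cases h : A (e (ω, y)) = a ∧ X' ω = x
  · simp [h, ← Finset.mul_sum, hW]
  · simp only [if_neg h, Finset.sum_const_zero, zero_mul]
    exact Finset.sum_eq_zero fun y' _ => if_neg fun h' => h ⟨h'.1, h'.2.1⟩

end Calculus

/-! ### Transport of information quantities to the law of a map -/

section Realization

variable {Ω Ω' α β γ α' β' γ' : Type*} [Fintype Ω] [Fintype Ω'] [Fintype α] [Fintype β] [Fintype γ]
  [Fintype α'] [Fintype β'] [Fintype γ']

theorem entropy_law_congr {p : Ω → ℝ} (F : Ω → Ω') {A' : Ω' → α'} {A : Ω → α}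
    (h : ∀ ω ω', A' (F ω) = A' (F ω') ↔ A ω = A ω') :
    entropy (law p F) A' = entropy p A := by
  rw [entropy_law]
  exact entropy_congr p h

theorem condMutualInfo_law_congr {p : Ω → ℝ} (hp : p ∈ stdSimplex ℝ Ω) (F : Ω → Ω')
    {A' : Ω' → α'} {B' : Ω' → β'} {C' : Ω' → γ'} {A : Ω → α} {B : Ω → β} {C : Ω → γ}
    (hA : ∀ ω ω', A' (F ω) = A' (F ω') ↔ A ω = A ω')
    (hB : ∀ ω ω', B' (F ω) = B' (F ω') ↔ B ω = B ω')
    (hC : ∀ ω ω', C' (F ω) = C' (F ω') ↔ C ω = C ω') :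
    condMutualInfo (law p F) A' B' C' = condMutualInfo p A B C := by
  rw [condMutualInfo_eq hp, condMutualInfo_eq (law_mem hp F),
    entropy_law_congr F (A := A ⋈ C) (by simp [pair, hA, hC]),
    entropy_law_congr F (A := B ⋈ C) (by simp [pair, hB, hC]),
    entropy_law_congr F (A := A ⋈ B ⋈ C) (by simp [pair, hA, hB, hC]),
    entropy_law_congr F hC]

theorem mutualInfo_law_congr {p : Ω → ℝ} (hp : p ∈ stdSimplex ℝ Ω) (F : Ω → Ω')
    {A' : Ω' → α'} {B' : Ω' → β'} {A : Ω → α} {B : Ω → β}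
    (hA : ∀ ω ω', A' (F ω) = A' (F ω') ↔ A ω = A ω')
    (hB : ∀ ω ω', B' (F ω) = B' (F ω') ↔ B ω = B ω') :
    mutualInfo (law p F) A' B' = mutualInfo p A B := by
  rw [mutualInfo_eq hp, mutualInfo_eq (law_mem hp F),
    entropy_law_congr F (A' := A' ⋈ B') (A := A ⋈ B) (by simp [pair, hA, hB]),
    entropy_law_congr F hA, entropy_law_congr F hB]

theorem condMutualInfo_law_fst {ι : Type*} [Fintype ι] {p : Ω → ℝ} (hp : p ∈ stdSimplex ℝ Ω)
    {ρ : ι → ℝ} (hρ : ρ ∈ stdSimplex ℝ ι) (F : Ω × ι → Ω')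
    {A' : Ω' → α'} {B' : Ω' → β'} {C' : Ω' → γ'} {A : Ω → α} {B : Ω → β} {C : Ω → γ}
    (hA : ∀ ω ω', A' (F ω) = A' (F ω') ↔ A ω.1 = A ω'.1)
    (hB : ∀ ω ω', B' (F ω) = B' (F ω') ↔ B ω.1 = B ω'.1)
    (hC : ∀ ω ω', C' (F ω) = C' (F ω') ↔ C ω.1 = C ω'.1) :
    condMutualInfo (law (prodLaw p ρ) F) A' B' C' = condMutualInfo p A B C := by
  have hq := prodLaw_mem hp hρ
  rw [condMutualInfo_law_congr hq F (A := fun x => A x.1) (B := fun x => B x.1)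
    (C := fun x => C x.1) hA hB hC, condMutualInfo_eq hq, condMutualInfo_eq hp,
    ← entropy_prodLaw_fst p hρ (A ⋈ C), ← entropy_prodLaw_fst p hρ (B ⋈ C),
    ← entropy_prodLaw_fst p hρ (A ⋈ B ⋈ C), ← entropy_prodLaw_fst p hρ C]
  rfl

/-- Appending a masked variable, without its key, does not change a mutual information. -/
theorem condMutualInfo_law_pad {G : Type*} [Fintype G] [AddGroup G] {p : Ω → ℝ}
    (hp : p ∈ stdSimplex ℝ Ω) (F : Ω × G → Ω') (M : Ω → G)
    {A' : Ω' → α'} {B' : Ω' → β'} {C' : Ω' → γ'} {A : Ω → α} {B : Ω → β} {C : Ω → γ}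
    (hA : ∀ ω ω', A' (F ω) = A' (F ω') ↔ A ω.1 = A ω'.1 ∧ M ω.1 + ω.2 = M ω'.1 + ω'.2)
    (hB : ∀ ω ω', B' (F ω) = B' (F ω') ↔ B ω.1 = B ω'.1)
    (hC : ∀ ω ω', C' (F ω) = C' (F ω') ↔ C ω.1 = C ω'.1) :
    condMutualInfo (law (prodLaw p (unif G)) F) A' B' C' = condMutualInfo p A B C := by
  have hq := prodLaw_mem hp (unif_mem G)
  rw [condMutualInfo_eq (law_mem hq F), condMutualInfo_eq hp,
    entropy_law_congr F (A := fun x => ((A ⋈ C) x.1, M x.1 + x.2)) (by simp [pair, hA, hC]; tauto),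
    entropy_law_congr F (A := fun x => (B ⋈ C) x.1) (by simp [pair, hB, hC]),
    entropy_law_congr F (A := fun x => ((A ⋈ B ⋈ C) x.1, M x.1 + x.2))
      (by simp [pair, hA, hB, hC]; tauto),
    entropy_law_congr F (A := fun x => C x.1) hC,
    entropy_pad hp, entropy_pad hp, entropy_prodLaw_fst p (unif_mem G),
    entropy_prodLaw_fst p (unif_mem G)]
  ring

variable {𝒳 𝒴 : Type*} [Fintype 𝒳] [Fintype 𝒴]

/-- Allows auxiliary variables that are functions of the input itself, such as its one-time-pad
shares. -/
theorem IsMarkov.pair_self {W : 𝒳 → 𝒴 → ℝ} {p : Ω → ℝ} {A : Ω → α} {X : Ω → 𝒳} {Y : Ω → 𝒴}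
    (h : IsMarkov W p A X Y) : IsMarkov W p (A ⋈ X) X Y := by
  rintro ⟨a, x'⟩ x y
  by_cases hx : x' = x
  · subst hx
    have := h a x' y
    rw [prob_congr p (E := fun ω => (A ⋈ X) ω = (a, x') ∧ X ω = x' ∧ Y ω = y)
        (F := fun ω => A ω = a ∧ X ω = x' ∧ Y ω = y) (by simp [pair]; tauto),
      prob_congr p (E := fun ω => (A ⋈ X) ω = (a, x') ∧ X ω = x')
        (F := fun ω => A ω = a ∧ X ω = x') (by simp [pair]), this]
  · have h0 : ∀ E : Ω → Prop, (∀ ω, ¬ E ω) → prob p E = 0 := fun E hE => by simp [prob, hE]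
    rw [h0, h0, zero_mul]
    · rintro ω ⟨h1, h2⟩
      simp only [pair, Prod.mk.injEq] at h1
      exact hx (h1.2.symm.trans h2)
    · rintro ω ⟨h1, h2, -⟩
      simp only [pair, Prod.mk.injEq] at h1
      exact hx (h1.2.symm.trans h2)

end Realization

/-! ### Realizing auxiliary variables: the one-time pad -/

section OuterRegion

variable {𝒳 𝒴₁ 𝒴₂ 𝒵 : Type*} [Fintype 𝒳] [Fintype 𝒴₁] [Fintype 𝒴₂] [Fintype 𝒵]

/-- The twelve constraints are satisfiable by auxiliary variables as in `outerRegion`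
(the rates may be negative). -/
def OuterSatisfiable (P : Channel 𝒳 𝒴₁ 𝒴₂ 𝒵) (R₁ R₂ : ℝ) : Prop :=
  ∃ (𝒯 𝒱₁ 𝒱₂ 𝒰₁ 𝒰₂ 𝒮₁ 𝒮₂ : Type) (_ : Fintype 𝒯) (_ : Fintype 𝒱₁) (_ : Fintype 𝒱₂)
      (_ : Fintype 𝒰₁) (_ : Fintype 𝒰₂) (_ : Fintype 𝒮₁) (_ : Fintype 𝒮₂)
      (q : 𝒯 × 𝒱₁ × 𝒱₂ × 𝒰₁ × 𝒰₂ × 𝒮₁ × 𝒮₂ → ℝ) (r : 𝒰₁ × 𝒰₂ × 𝒮₁ × 𝒮₂ → 𝒳 → ℝ),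
      q ∈ stdSimplex ℝ (𝒯 × 𝒱₁ × 𝒱₂ × 𝒰₁ × 𝒰₂ × 𝒮₁ × 𝒮₂) ∧
      (∀ a, r a ∈ stdSimplex ℝ 𝒳) ∧
      OuterConstraints (jointLaw P q r)
        (T := fun ((t, _, _, _, _, _, _), _, _, _, _) => t)
        (V₁ := fun ((_, v₁, _, _, _, _, _), _, _, _, _) => v₁)
        (V₂ := fun ((_, _, v₂, _, _, _, _), _, _, _, _) => v₂)
        (U₁ := fun ((_, _, _, u₁, _, _, _), _, _, _, _) => u₁)
        (U₂ := fun ((_, _, _, _, u₂, _, _), _, _, _, _) => u₂)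
        (S₁ := fun ((_, _, _, _, _, s₁, _), _, _, _, _) => s₁)
        (S₂ := fun ((_, _, _, _, _, _, s₂), _, _, _, _) => s₂)
        (X := fun (_, x, _, _, _) => x)
        (Y₁ := fun (_, _, y₁, _, _) => y₁)
        (Y₂ := fun (_, _, _, y₂, _) => y₂)
        (Z := fun (_, _, _, _, z) => z)
        R₁ R₂

theorem mem_outerRegion {P : Channel 𝒳 𝒴₁ 𝒴₂ 𝒵} {R : ℝ × ℝ} :
    R ∈ outerRegion P ↔ 0 ≤ R.1 ∧ 0 ≤ R.2 ∧ OuterSatisfiable P R.1 R.2 :=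
  Iff.rfl

variable {Ω 𝒯 𝒱₁ 𝒱₂ 𝒰₁ 𝒰₂ 𝒮₁ 𝒮₂ : Type*} [Fintype Ω]
    [Fintype 𝒯] [Fintype 𝒱₁] [Fintype 𝒱₂] [Fintype 𝒰₁] [Fintype 𝒰₂] [Fintype 𝒮₁] [Fintype 𝒮₂]

/-- Auxiliary variables on any finite space may be used, and the input need not be independent of
`T, V₁, V₂` given the others: sharing the input between `S₁` and `S₂` by a one-time pad makes it
a function of `(S₁, S₂)` without affecting the constraints. -/
theorem OuterSatisfiable.of_isMarkov (P : Channel 𝒳 𝒴₁ 𝒴₂ 𝒵) {p : Ω → ℝ}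
    (hp : p ∈ stdSimplex ℝ Ω) {T : Ω → 𝒯} {V₁ : Ω → 𝒱₁} {V₂ : Ω → 𝒱₂} {U₁ : Ω → 𝒰₁} {U₂ : Ω → 𝒰₂}
    {S₁ : Ω → 𝒮₁} {S₂ : Ω → 𝒮₂} {X : Ω → 𝒳} {Y₁ : Ω → 𝒴₁} {Y₂ : Ω → 𝒴₂} {Z : Ω → 𝒵}
    (hM : IsMarkov P.W p (T ⋈ V₁ ⋈ V₂ ⋈ U₁ ⋈ U₂ ⋈ S₁ ⋈ S₂) X (Y₁ ⋈ Y₂ ⋈ Z)) {R₁ R₂ : ℝ}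
    (h : OuterConstraints p T V₁ V₂ U₁ U₂ S₁ S₂ X Y₁ Y₂ Z R₁ R₂) : OuterSatisfiable P R₁ R₂ := by
  classical
  obtain ⟨ω₀⟩ : Nonempty Ω := by
    by_contra h
    rw [not_nonempty_iff] at h
    simpa using hp.2
  have : NeZero (Fintype.card 𝒳) := ⟨(Fintype.card_pos_iff.2 ⟨X ω₀⟩).ne'⟩
  let e := Fintype.equivFin 𝒳
  let eT := Fintype.equivFin 𝒯
  let eV₁ := Fintype.equivFin 𝒱₁
  let eV₂ := Fintype.equivFin 𝒱₂
  let eU₁ := Fintype.equivFin 𝒰₁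
  let eU₂ := Fintype.equivFin 𝒰₂
  let eS₁ := Fintype.equivFin 𝒮₁
  let eS₂ := Fintype.equivFin 𝒮₂
  let G := Fin (Fintype.card 𝒳)
  have hu := unif_mem G
  have hq := prodLaw_mem hp hu
  -- The share in `S₁` is the input plus the key, the share in `S₂` is the key. Either share alone
  -- is uniform and independent of the original variables. Alphabets are replaced by `Fin` types
  -- because the region asks for alphabets in `Type`.
  let Aux : Ω × G → Fin (Fintype.card 𝒯) × Fin (Fintype.card 𝒱₁) × Fin (Fintype.card 𝒱₂) ×
      Fin (Fintype.card 𝒰₁) × Fin (Fintype.card 𝒰₂) × (Fin (Fintype.card 𝒮₁) × G) ×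
      (Fin (Fintype.card 𝒮₂) × G) := fun x => (eT (T x.1), eV₁ (V₁ x.1), eV₂ (V₂ x.1), eU₁ (U₁ x.1),
        eU₂ (U₂ x.1), (eS₁ (S₁ x.1), e (X x.1) + x.2), (eS₂ (S₂ x.1), x.2))
  let F := fun x : Ω × G => (Aux x, X x.1, Y₁ x.1, Y₂ x.1, Z x.1)
  let r : Fin (Fintype.card 𝒰₁) × Fin (Fintype.card 𝒰₂) × (Fin (Fintype.card 𝒮₁) × G) ×
      (Fin (Fintype.card 𝒮₂) × G) → 𝒳 → ℝ :=
    fun a x => if e x = a.2.2.1.2 - a.2.2.2.2 then 1 else 0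
  have hr : ∀ a, r a ∈ stdSimplex ℝ 𝒳 := fun a => by
    refine ⟨fun x => by simp only [r]; split_ifs <;> simp, ?_⟩
    simp only [r, ← Equiv.eq_symm_apply]
    simp
  have hM' := (IsMarkov.prodLaw (fun _ : G => hM.pair_self) (unif G)).of_factor (B := Aux)
    (by simp only [pair, Prod.mk.injEq, Aux]; rintro ⟨_, _⟩ ⟨_, _⟩; simp; intros; simp [*])
  -- The input is the difference of the shares, so generating it by `r` and then applying the
  -- channel reproduces the actual joint law.
  have hlaw : jointLaw P (law (prodLaw p (unif G)) Aux) r = law (prodLaw p (unif G)) F := by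
    funext ⟨a, x, y₁, y₂, z⟩
    have h1 := hM' a x (y₁, y₂, z)
    have h2 : prob (prodLaw p (unif G)) (fun ω => Aux ω = a ∧ X ω.1 = x) =
        prob (prodLaw p (unif G)) (fun ω => Aux ω = a) * r a.2.2.2 x := by
      simp only [r]
      split_ifs with hx
      · rw [mul_one]
        refine prob_congr _ fun ω => and_iff_left_of_imp ?_
        rintro rfl
        apply e.injective
        rw [hx]
        simp [Aux]
      · rw [mul_zero]
        unfold prob
        refine Finset.sum_eq_zero fun ω _ => if_neg ?_
        rintro ⟨rfl, rfl⟩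
        simp [Aux] at hx
    change prob _ _ * r a.2.2.2 x * P.W x (y₁, y₂, z) = prob _ _
    rw [← h2, ← h1]
    refine prob_congr _ fun ω => ?_
    simp [F, pair]
  refine ⟨_, _, _, _, _, _, _, inferInstance, inferInstance, inferInstance, inferInstance,
    inferInstance, inferInstance, inferInstance, law (prodLaw p (unif G)) Aux, r, law_mem hq _, hr,
    ?_⟩
  rw [hlaw]
  obtain ⟨h1, h2, h3, h4, h5, h6, h7, h8, h9, h10, h11, h12⟩ := h
  -- The eight individual constraints contain neither share; each sum-rate constraint contains one,
  -- and appending it to the first argument changes no mutual information by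
  -- `condMutualInfo_law_pad`.
  constructor
  · refine h1.trans_eq ?_
    congr 1 <;> refine (condMutualInfo_law_fst hp hu F ?_ ?_ ?_).symm <;> simp [F, Aux, pair]
  · refine h2.trans_eq ?_
    congr 1 <;> refine (condMutualInfo_law_fst hp hu F ?_ ?_ ?_).symm <;> simp [F, Aux, pair]
  · refine h3.trans_eq ?_
    congr 1 <;> refine (condMutualInfo_law_fst hp hu F ?_ ?_ ?_).symm <;> simp [F, Aux, pair]
  · refine h4.trans_eq ?_
    congr 1 <;> refine (condMutualInfo_law_fst hp hu F ?_ ?_ ?_).symm <;> simp [F, Aux, pair]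
  · refine h5.trans_eq ?_
    congr 1 <;> refine (condMutualInfo_law_fst hp hu F ?_ ?_ ?_).symm <;> simp [F, Aux, pair]
  · refine h6.trans_eq ?_
    congr 1 <;> refine (condMutualInfo_law_fst hp hu F ?_ ?_ ?_).symm <;> simp [F, Aux, pair]
  · refine h7.trans_eq ?_
    congr 1 <;> refine (condMutualInfo_law_fst hp hu F ?_ ?_ ?_).symm <;> simp [F, Aux, pair]
  · refine h8.trans_eq ?_
    congr 1 <;> refine (condMutualInfo_law_fst hp hu F ?_ ?_ ?_).symm <;> simp [F, Aux, pair]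
  · refine h9.trans_eq ?_
    congr 1
    · congr 1
      · refine (condMutualInfo_law_fst hp hu F ?_ ?_ ?_).symm <;> simp [F, Aux, pair]
      · refine (condMutualInfo_law_pad hp F (fun ω => e (X ω)) ?_ ?_ ?_).symm <;>
          simp [F, Aux, pair, and_assoc]
    · refine (condMutualInfo_law_pad hp F (fun ω => e (X ω)) ?_ ?_ ?_).symm <;>
          simp [F, Aux, pair, and_assoc]
  · refine h10.trans_eq ?_
    congr 1
    · congr 1
      · refine (condMutualInfo_law_fst hp hu F ?_ ?_ ?_).symm <;> simp [F, Aux, pair]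
      · refine (condMutualInfo_law_pad hp F (fun ω => e (X ω)) ?_ ?_ ?_).symm <;>
          simp [F, Aux, pair, and_assoc]
    · refine (condMutualInfo_law_pad hp F (fun ω => e (X ω)) ?_ ?_ ?_).symm <;>
          simp [F, Aux, pair, and_assoc]
  · refine h11.trans_eq ?_
    congr 1
    · congr 1
      · refine (condMutualInfo_law_fst hp hu F ?_ ?_ ?_).symm <;> simp [F, Aux, pair]
      · refine (condMutualInfo_law_pad hp F (fun _ => 0) ?_ ?_ ?_).symm <;>
          simp [F, Aux, pair, and_assoc]
    · refine (condMutualInfo_law_pad hp F (fun _ => 0) ?_ ?_ ?_).symm <;>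
          simp [F, Aux, pair, and_assoc]
  · refine h12.trans_eq ?_
    congr 1
    · congr 1
      · refine (condMutualInfo_law_fst hp hu F ?_ ?_ ?_).symm <;> simp [F, Aux, pair]
      · refine (condMutualInfo_law_pad hp F (fun _ => 0) ?_ ?_ ?_).symm <;>
          simp [F, Aux, pair, and_assoc]
    · refine (condMutualInfo_law_pad hp F (fun _ => 0) ?_ ?_ ?_).symm <;>
          simp [F, Aux, pair, and_assoc]

end OuterRegion

/-! ### Invariance and vanishing of conditional mutual information -/

section Basic

variable {Ω α β γ α' β' γ' : Type*} [Fintype Ω] [Fintype α] [Fintype β] [Fintype γ]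
  [Fintype α'] [Fintype β'] [Fintype γ']

theorem condMutualInfo_congr {p : Ω → ℝ} (hp : p ∈ stdSimplex ℝ Ω)
    {A' : Ω → α'} {B' : Ω → β'} {C' : Ω → γ'} {A : Ω → α} {B : Ω → β} {C : Ω → γ}
    (hA : ∀ ω ω', A' ω = A' ω' ↔ A ω = A ω') (hB : ∀ ω ω', B' ω = B' ω' ↔ B ω = B ω')
    (hC : ∀ ω ω', C' ω = C' ω' ↔ C ω = C ω') :
    condMutualInfo p A' B' C' = condMutualInfo p A B C := by
  rw [condMutualInfo_eq hp, condMutualInfo_eq hp,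
    entropy_congr p (A := A' ⋈ C') (B := A ⋈ C) (by simp [pair, hA, hC]),
    entropy_congr p (A := B' ⋈ C') (B := B ⋈ C) (by simp [pair, hB, hC]),
    entropy_congr p (A := A' ⋈ B' ⋈ C') (B := A ⋈ B ⋈ C) (by simp [pair, hA, hB, hC]),
    entropy_congr p hC]

theorem condMutualInfo_nonneg {p : Ω → ℝ} (hp : p ∈ stdSimplex ℝ Ω) (A : Ω → α) (B : Ω → β)
    (C : Ω → γ) : 0 ≤ condMutualInfo p A B C := by
  rw [condMutualInfo_eq hp]
  linarith [entropy_submod hp A B C]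

theorem condMutualInfo_const_left {p : Ω → ℝ} (hp : p ∈ stdSimplex ℝ Ω) {A : Ω → α}
    (hA : ∀ ω ω', A ω = A ω') (B : Ω → β) (C : Ω → γ) : condMutualInfo p A B C = 0 := by
  rw [condMutualInfo_eq hp, entropy_congr p (A := A ⋈ C) (B := C) (by intro ω ω'; simp [pair, hA ω ω']),
    entropy_congr p (A := A ⋈ B ⋈ C) (B := B ⋈ C) (by intro ω ω'; simp [pair, hA ω ω'])]
  ring

theorem condMutualInfo_const_right {p : Ω → ℝ} (hp : p ∈ stdSimplex ℝ Ω) (A : Ω → α) {B : Ω → β}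
    (hB : ∀ ω ω', B ω = B ω') (C : Ω → γ) : condMutualInfo p A B C = 0 := by
  rw [condMutualInfo_eq hp, entropy_congr p (A := B ⋈ C) (B := C) (by intro ω ω'; simp [pair, hB ω ω']),
    entropy_congr p (A := A ⋈ B ⋈ C) (B := A ⋈ C) (by intro ω ω'; simp [pair, hB ω ω'])]
  ring

end Basic

/-! ### Points on the axes: giving up one message -/

section Constraints

variable {𝒳 𝒴₁ 𝒴₂ 𝒵 : Type*} [Fintype 𝒳] [Fintype 𝒴₁] [Fintype 𝒴₂] [Fintype 𝒵]

variable {Ω 𝒯 𝒱₁ 𝒱₂ 𝒰₁ 𝒰₂ 𝒮₁ 𝒮₂ : Type*} [Fintype Ω]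
    [Fintype 𝒯] [Fintype 𝒱₁] [Fintype 𝒱₂] [Fintype 𝒰₁] [Fintype 𝒰₂] [Fintype 𝒮₁] [Fintype 𝒮₂]

variable {p : Ω → ℝ} {T : Ω → 𝒯} {V₁ : Ω → 𝒱₁} {V₂ : Ω → 𝒱₂} {U₁ : Ω → 𝒰₁} {U₂ : Ω → 𝒰₂}
    {S₁ : Ω → 𝒮₁} {S₂ : Ω → 𝒮₂} {X : Ω → 𝒳} {Y₁ : Ω → 𝒴₁} {Y₂ : Ω → 𝒴₂} {Z : Ω → 𝒵}

/-- Merging `U₁` into `S₁` leaves the pair `(U₁, S₁)`, hence the first two sum bounds, unchanged,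
while all constraints on the first rate become trivial. Those on the second rate that were
conditioned on `U₁` reduce to the ones that were not. -/
theorem OuterConstraints.zero_left (hp : p ∈ stdSimplex ℝ Ω) {a b c : ℝ}
    (h : OuterConstraints p T V₁ V₂ U₁ U₂ S₁ S₂ X Y₁ Y₂ Z a b) (hb : c ≤ b) (hab : c ≤ a + b) :
    OuterConstraints p T V₁ V₂ (fun _ => ()) U₂ (U₁ ⋈ S₁) S₂ X Y₁ Y₂ Z 0 c := by
  obtain ⟨-, -, -, -, h5, h6, -, -, h9, h10, h11, h12⟩ := h
  constructor
  · rw [condMutualInfo_const_left hp (A := fun _ => ()) fun _ _ => rfl,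
      condMutualInfo_const_left hp (A := fun _ => ()) fun _ _ => rfl, sub_zero]
  · rw [condMutualInfo_const_left hp (A := fun _ => ()) fun _ _ => rfl,
      condMutualInfo_const_left hp (A := fun _ => ()) fun _ _ => rfl, sub_zero]
  · rw [condMutualInfo_const_left hp (A := fun _ => ()) fun _ _ => rfl,
      condMutualInfo_const_left hp (A := fun _ => ()) fun _ _ => rfl, sub_zero]
  · rw [condMutualInfo_const_left hp (A := fun _ => ()) fun _ _ => rfl,
      condMutualInfo_const_left hp (A := fun _ => ()) fun _ _ => rfl, sub_zero]
  · linarith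
  · linarith
  · refine hb.trans (h5.trans_eq ?_)
    congr 1 <;> refine condMutualInfo_congr hp ?_ ?_ ?_ <;> simp [pair]
  · refine hb.trans (h6.trans_eq ?_)
    congr 1 <;> refine condMutualInfo_congr hp ?_ ?_ ?_ <;> simp [pair]
  · rw [zero_add]
    refine hab.trans (h9.trans_eq ?_)
    congr 1
    · congr 1
      refine condMutualInfo_congr hp ?_ ?_ ?_ <;> simp [pair]
    · refine condMutualInfo_congr hp ?_ ?_ ?_ <;> simp [pair]
  · rw [zero_add]
    refine hab.trans (h10.trans_eq ?_)
    congr 1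
    · congr 1
      refine condMutualInfo_congr hp ?_ ?_ ?_ <;> simp [pair]
    · refine condMutualInfo_congr hp ?_ ?_ ?_ <;> simp [pair]
  · linarith
  · linarith

theorem OuterConstraints.zero_right (hp : p ∈ stdSimplex ℝ Ω) {a b c : ℝ}
    (h : OuterConstraints p T V₁ V₂ U₁ U₂ S₁ S₂ X Y₁ Y₂ Z a b) (hb : c ≤ a) (hab : c ≤ a + b) :
    OuterConstraints p T V₁ V₂ U₁ (fun _ => ()) S₁ (U₂ ⋈ S₂) X Y₁ Y₂ Z c 0 := by
  obtain ⟨h1, h2, -, -, -, -, -, -, h9, h10, h11, h12⟩ := h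
  constructor
  · linarith
  · linarith
  · refine hb.trans (h1.trans_eq ?_)
    congr 1 <;> refine condMutualInfo_congr hp ?_ ?_ ?_ <;> simp [pair]
  · refine hb.trans (h2.trans_eq ?_)
    congr 1 <;> refine condMutualInfo_congr hp ?_ ?_ ?_ <;> simp [pair]
  · rw [condMutualInfo_const_left hp (A := fun _ => ()) fun _ _ => rfl,
      condMutualInfo_const_left hp (A := fun _ => ()) fun _ _ => rfl, sub_zero]
  · rw [condMutualInfo_const_left hp (A := fun _ => ()) fun _ _ => rfl,
      condMutualInfo_const_left hp (A := fun _ => ()) fun _ _ => rfl, sub_zero]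
  · rw [condMutualInfo_const_left hp (A := fun _ => ()) fun _ _ => rfl,
      condMutualInfo_const_left hp (A := fun _ => ()) fun _ _ => rfl, sub_zero]
  · rw [condMutualInfo_const_left hp (A := fun _ => ()) fun _ _ => rfl,
      condMutualInfo_const_left hp (A := fun _ => ()) fun _ _ => rfl, sub_zero]
  · linarith
  · linarith
  · rw [add_zero]
    refine hab.trans (h11.trans_eq ?_)
    congr 1
    · congr 1
      refine condMutualInfo_congr hp ?_ ?_ ?_ <;> simp [pair]
    · refine condMutualInfo_congr hp ?_ ?_ ?_ <;> simp [pair]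
  · rw [add_zero]
    refine hab.trans (h12.trans_eq ?_)
    congr 1
    · congr 1
      refine condMutualInfo_congr hp ?_ ?_ ?_ <;> simp [pair]
    · refine condMutualInfo_congr hp ?_ ?_ ?_ <;> simp [pair]

theorem outerConstraints_zero (hp : p ∈ stdSimplex ℝ Ω) :
    OuterConstraints p T V₁ V₂ (fun _ => ()) (fun _ => ()) (fun _ => ()) (fun _ => ())
      X Y₁ Y₂ Z 0 0 := by
  constructor
  · rw [condMutualInfo_const_left hp (A := fun _ => ()) fun _ _ => rfl,
      condMutualInfo_const_left hp (A := fun _ => ()) fun _ _ => rfl, sub_zero]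
  · rw [condMutualInfo_const_left hp (A := fun _ => ()) fun _ _ => rfl,
      condMutualInfo_const_left hp (A := fun _ => ()) fun _ _ => rfl, sub_zero]
  · rw [condMutualInfo_const_left hp (A := fun _ => ()) fun _ _ => rfl,
      condMutualInfo_const_left hp (A := fun _ => ()) fun _ _ => rfl, sub_zero]
  · rw [condMutualInfo_const_left hp (A := fun _ => ()) fun _ _ => rfl,
      condMutualInfo_const_left hp (A := fun _ => ()) fun _ _ => rfl, sub_zero]
  · rw [condMutualInfo_const_left hp (A := fun _ => ()) fun _ _ => rfl,
      condMutualInfo_const_left hp (A := fun _ => ()) fun _ _ => rfl, sub_zero]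
  · rw [condMutualInfo_const_left hp (A := fun _ => ()) fun _ _ => rfl,
      condMutualInfo_const_left hp (A := fun _ => ()) fun _ _ => rfl, sub_zero]
  · rw [condMutualInfo_const_left hp (A := fun _ => ()) fun _ _ => rfl,
      condMutualInfo_const_left hp (A := fun _ => ()) fun _ _ => rfl, sub_zero]
  · rw [condMutualInfo_const_left hp (A := fun _ => ()) fun _ _ => rfl,
      condMutualInfo_const_left hp (A := fun _ => ()) fun _ _ => rfl, sub_zero]
  · rw [condMutualInfo_const_left hp (A := (fun _ => ()) ⋈ fun _ => ()) fun _ _ => rfl,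
      condMutualInfo_const_left hp (A := (fun _ => ()) ⋈ fun _ => ()) fun _ _ => rfl, sub_zero,
      add_zero, add_zero]
    exact condMutualInfo_nonneg hp _ _ _
  · rw [condMutualInfo_const_left hp (A := (fun _ => ()) ⋈ fun _ => ()) fun _ _ => rfl,
      condMutualInfo_const_left hp (A := (fun _ => ()) ⋈ fun _ => ()) fun _ _ => rfl, sub_zero,
      add_zero, add_zero]
    exact condMutualInfo_nonneg hp _ _ _
  · rw [condMutualInfo_const_left hp (A := (fun _ => ()) ⋈ fun _ => ()) fun _ _ => rfl,
      condMutualInfo_const_left hp (A := (fun _ => ()) ⋈ fun _ => ()) fun _ _ => rfl, sub_zero,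
      add_zero, add_zero]
    exact condMutualInfo_nonneg hp _ _ _
  · rw [condMutualInfo_const_left hp (A := (fun _ => ()) ⋈ fun _ => ()) fun _ _ => rfl,
      condMutualInfo_const_left hp (A := (fun _ => ()) ⋈ fun _ => ()) fun _ _ => rfl, sub_zero,
      add_zero, add_zero]
    exact condMutualInfo_nonneg hp _ _ _

theorem OuterConstraints.mono {a b a' b' : ℝ}
    (h : OuterConstraints p T V₁ V₂ U₁ U₂ S₁ S₂ X Y₁ Y₂ Z a b) (ha : a' ≤ a) (hb : b' ≤ b) :
    OuterConstraints p T V₁ V₂ U₁ U₂ S₁ S₂ X Y₁ Y₂ Z a' b' := by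
  obtain ⟨h1, h2, h3, h4, h5, h6, h7, h8, h9, h10, h11, h12⟩ := h
  constructor <;> linarith

end Constraints

/-! ### Joint laws and the passage to the closure -/

section JointLaw

variable {𝒳 𝒴₁ 𝒴₂ 𝒵 : Type*} [Fintype 𝒳] [Fintype 𝒴₁] [Fintype 𝒴₂] [Fintype 𝒵]

theorem kernel_mem {α β : Type*} [Fintype α] [Fintype β] {q : α → ℝ} (hq : q ∈ stdSimplex ℝ α)
    {W : α → β → ℝ} (hW : ∀ a, W a ∈ stdSimplex ℝ β) :
    (fun x : α × β => q x.1 * W x.1 x.2) ∈ stdSimplex ℝ (α × β) := by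
  refine ⟨fun x => mul_nonneg (hq.1 _) ((hW _).1 _), ?_⟩
  rw [Fintype.sum_prod_type]
  simp only [← Finset.mul_sum, (hW _).2, mul_one, hq.2]

variable {𝒯 𝒱₁ 𝒱₂ 𝒰₁ 𝒰₂ 𝒮₁ 𝒮₂ : Type}
    [Fintype 𝒯] [Fintype 𝒱₁] [Fintype 𝒱₂] [Fintype 𝒰₁] [Fintype 𝒰₂] [Fintype 𝒮₁] [Fintype 𝒮₂]

theorem jointLaw_mem (P : Channel 𝒳 𝒴₁ 𝒴₂ 𝒵) {q : 𝒯 × 𝒱₁ × 𝒱₂ × 𝒰₁ × 𝒰₂ × 𝒮₁ × 𝒮₂ → ℝ}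
    {r : 𝒰₁ × 𝒰₂ × 𝒮₁ × 𝒮₂ → 𝒳 → ℝ} (hq : q ∈ stdSimplex ℝ (𝒯 × 𝒱₁ × 𝒱₂ × 𝒰₁ × 𝒰₂ × 𝒮₁ × 𝒮₂))
    (hr : ∀ a, r a ∈ stdSimplex ℝ 𝒳) : jointLaw P q r ∈ stdSimplex ℝ _ := by
  have h := kernel_mem hq (W := fun a (y : 𝒳 × 𝒴₁ × 𝒴₂ × 𝒵) => r a.2.2.2 y.1 * P.W y.1 y.2)
    fun a => kernel_mem (hr _) P.isPMF
  convert h using 1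
  funext x
  simp only [jointLaw]
  ring

theorem isMarkov_jointLaw (P : Channel 𝒳 𝒴₁ 𝒴₂ 𝒵) (q : 𝒯 × 𝒱₁ × 𝒱₂ × 𝒰₁ × 𝒰₂ × 𝒮₁ × 𝒮₂ → ℝ)
    (r : 𝒰₁ × 𝒰₂ × 𝒮₁ × 𝒮₂ → 𝒳 → ℝ) :
    IsMarkov P.W (jointLaw P q r) (fun x => x.1) (fun x => x.2.1) (fun x => x.2.2) :=
  isMarkov_of_equiv (fun x => (P.isPMF x).2) (Equiv.prodAssoc _ _ _)
    (fun a => q a.1 * r a.1.2.2.2 a.2) (fun a => a.2) (fun _ _ => rfl) (fun _ _ _ => rfl)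
    (fun _ _ => rfl) (fun _ _ => rfl)

theorem OuterSatisfiable.zero_left {P : Channel 𝒳 𝒴₁ 𝒴₂ 𝒵} {a b c : ℝ}
    (h : OuterSatisfiable P a b) (hb : c ≤ b) (hab : c ≤ a + b) : OuterSatisfiable P 0 c := by
  obtain ⟨𝒯, 𝒱₁, 𝒱₂, 𝒰₁, 𝒰₂, 𝒮₁, 𝒮₂, _, _, _, _, _, _, _, q, r, hq, hr, h⟩ := h
  refine .of_isMarkov P (jointLaw_mem P hq hr) ((isMarkov_jointLaw P q r).of_factor ?_)
    (h.zero_left (jointLaw_mem P hq hr) hb hab)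
  rintro ⟨x, _⟩ ⟨x', _⟩ (rfl : x = x')
  rfl

theorem OuterSatisfiable.zero_right {P : Channel 𝒳 𝒴₁ 𝒴₂ 𝒵} {a b c : ℝ}
    (h : OuterSatisfiable P a b) (hb : c ≤ a) (hab : c ≤ a + b) : OuterSatisfiable P c 0 := by
  obtain ⟨𝒯, 𝒱₁, 𝒱₂, 𝒰₁, 𝒰₂, 𝒮₁, 𝒮₂, _, _, _, _, _, _, _, q, r, hq, hr, h⟩ := h
  refine .of_isMarkov P (jointLaw_mem P hq hr) ((isMarkov_jointLaw P q r).of_factor ?_)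
    (h.zero_right (jointLaw_mem P hq hr) hb hab)
  rintro ⟨x, _⟩ ⟨x', _⟩ (rfl : x = x')
  rfl

theorem OuterSatisfiable.zero {P : Channel 𝒳 𝒴₁ 𝒴₂ 𝒵} {a b : ℝ}
    (h : OuterSatisfiable P a b) : OuterSatisfiable P 0 0 := by
  obtain ⟨𝒯, 𝒱₁, 𝒱₂, 𝒰₁, 𝒰₂, 𝒮₁, 𝒮₂, _, _, _, _, _, _, _, q, r, hq, hr, h⟩ := h
  refine .of_isMarkov P (jointLaw_mem P hq hr) (T := fun ((t, _, _, _, _, _, _), _, _, _, _) => t)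
        (V₁ := fun ((_, v₁, _, _, _, _, _), _, _, _, _) => v₁)
        (V₂ := fun ((_, _, v₂, _, _, _, _), _, _, _, _) => v₂)
        ((isMarkov_jointLaw P q r).of_factor ?_)
    (outerConstraints_zero (jointLaw_mem P hq hr))
  rintro ⟨x, _⟩ ⟨x', _⟩ (rfl : x = x')
  rfl

/-- If a coordinate is zero, lowering it by `ε` leaves the quadrant; the approximating point is then
moved back to the axis by `OuterSatisfiable.zero_left` or its mirror image. -/
theorem mem_closure_outerRegion {P : Channel 𝒳 𝒴₁ 𝒴₂ 𝒵} {R : ℝ × ℝ} (h₁ : 0 ≤ R.1) (h₂ : 0 ≤ R.2)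
    (h : ∀ ε > 0, OuterSatisfiable P (R.1 - ε) (R.2 - ε)) : R ∈ closure (outerRegion P) := by
  rw [Metric.mem_closure_iff]
  intro ε hε
  have key : ∀ a b : ℝ, |R.1 - a| < ε → |R.2 - b| < ε → 0 ≤ a → 0 ≤ b → OuterSatisfiable P a b →
      ∃ b ∈ outerRegion P, dist R b < ε := fun a b ha hb ha0 hb0 hab => by
    refine ⟨(a, b), mem_outerRegion.2 ⟨ha0, hb0, hab⟩, ?_⟩
    rw [Prod.dist_eq, max_lt_iff, Real.dist_eq, Real.dist_eq]
    exact ⟨ha, hb⟩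
  rcases h₁.eq_or_lt with h1 | h1 <;> rcases h₂.eq_or_lt with h2 | h2
  · exact key 0 0 (by simpa [← h1]) (by simpa [← h2]) le_rfl le_rfl (h 1 one_pos).zero
  · have hm : 0 < min ε R.2 := lt_min hε h2
    have h3 := min_le_left ε R.2
    have h4 := min_le_right ε R.2
    -- With a quarter of the minimum lost in each coordinate, the sum loses exactly half of it,
    -- which is the decrement of the surviving rate.
    refine key 0 (R.2 - min ε R.2 / 2) (by simpa [← h1]) ?_ le_rfl (by linarith)
      ((h (min ε R.2 / 4) (by positivity)).zero_left (by linarith) (by rw [← h1]; linarith))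
    rw [abs_lt]
    constructor <;> linarith
  · have hm : 0 < min ε R.1 := lt_min hε h1
    have h3 := min_le_left ε R.1
    have h4 := min_le_right ε R.1
    refine key (R.1 - min ε R.1 / 2) 0 ?_ (by simpa [← h2]) (by linarith) le_rfl
      ((h (min ε R.1 / 4) (by positivity)).zero_right (by linarith) (by rw [← h2]; linarith))
    rw [abs_lt]
    constructor <;> linarith
  · have hm : 0 < min ε (min R.1 R.2) := lt_min hε (lt_min h1 h2)
    have h3 := min_le_left ε (min R.1 R.2)
    have h4 := min_le_right ε (min R.1 R.2)
    have h5 := min_le_left R.1 R.2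
    have h6 := min_le_right R.1 R.2
    refine key (R.1 - min ε (min R.1 R.2) / 2) (R.2 - min ε (min R.1 R.2) / 2) ?_ ?_ (by linarith)
      (by linarith) (h _ (by positivity))
    · rw [abs_lt]
      constructor <;> linarith
    · rw [abs_lt]
      constructor <;> linarith

end JointLaw

/-! ### Constant eavesdropper: the outer region lies in the Nair–El Gamal region -/

section NairElGamal

variable {𝒳 𝒴 𝒴₁ 𝒴₂ 𝒵 : Type*} [Fintype 𝒳] [Fintype 𝒴] [Fintype 𝒴₁] [Fintype 𝒴₂] [Fintype 𝒵]
  {Ω 𝒯 𝒱 𝒰 𝒮 : Type*} [Fintype Ω] [Fintype 𝒯] [Fintype 𝒱] [Fintype 𝒰] [Fintype 𝒮]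

theorem condMutualInfo_le_mutualInfo {p : Ω → ℝ} (hp : p ∈ stdSimplex ℝ Ω) (T : Ω → 𝒯) (V : Ω → 𝒱)
    (U : Ω → 𝒰) (S : Ω → 𝒮) (Y : Ω → 𝒴) :
    condMutualInfo p U Y (T ⋈ V) ≤ mutualInfo p (U ⋈ S ⋈ T ⋈ V) Y := by
  rw [condMutualInfo_eq hp, mutualInfo_eq hp]
  have h1 := entropy_subadd hp Y (T ⋈ V)
  have h2 := entropy_submod hp S Y (U ⋈ T ⋈ V)
  rw [entropy_congr p (A := S ⋈ Y ⋈ U ⋈ T ⋈ V) (B := (U ⋈ S ⋈ T ⋈ V) ⋈ Y) (by simp [pair]; tauto),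
    entropy_congr p (A := S ⋈ U ⋈ T ⋈ V) (B := U ⋈ S ⋈ T ⋈ V) (by simp [pair]; tauto),
    entropy_congr p (A := Y ⋈ U ⋈ T ⋈ V) (B := U ⋈ Y ⋈ T ⋈ V) (by simp [pair]; tauto)] at h2
  linarith

/-- As `Z` carries nothing and `(U, S, T, V) → X → Y₂` is Markov, I(X; Y₂ | TV) - I(US; Y₂ | TV) =
I(X; Y₂ | USTV). The remaining term I(US; Y₁ | TV) only grows when `T, V` join the first argument.
-/
theorem sum_bound_le_of_subsingleton [Subsingleton 𝒵] {W : 𝒳 → 𝒴 → ℝ} {p : Ω → ℝ}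
    (hp : p ∈ stdSimplex ℝ Ω) {T : Ω → 𝒯} {V : Ω → 𝒱}
    {U : Ω → 𝒰} {S : Ω → 𝒮} {X : Ω → 𝒳} {Y : Ω → 𝒴} {Y₁ : Ω → 𝒴₁} {Y₂ : Ω → 𝒴₂} (Z : Ω → 𝒵)
    (hM : IsMarkov W p (U ⋈ S ⋈ T ⋈ V) X Y) (hY : ∀ ω ω', Y ω = Y ω' → Y₂ ω = Y₂ ω') :
    condMutualInfo p X Y₂ (T ⋈ Z ⋈ V) + condMutualInfo p (U ⋈ S) Y₁ (T ⋈ V) -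
        condMutualInfo p (U ⋈ S) (Z ⋈ Y₂) (T ⋈ V) ≤
      mutualInfo p (U ⋈ S ⋈ T ⋈ V) Y₁ + condMutualInfo p X Y₂ (U ⋈ S ⋈ T ⋈ V) := by
  have hZ : ∀ ω ω', Z ω = Z ω' := fun _ _ => Subsingleton.elim _ _
  rw [condMutualInfo_congr hp (A' := X) (B' := Y₂) (C' := T ⋈ Z ⋈ V) (A := X) (B := Y₂)
      (C := T ⋈ V) (by simp) (by simp) (by intro ω ω'; simp [pair, hZ ω ω']),
    condMutualInfo_congr hp (A' := U ⋈ S) (B' := Z ⋈ Y₂) (C' := T ⋈ V) (A := U ⋈ S) (B := Y₂)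
      (C := T ⋈ V) (by simp) (by intro ω ω'; simp [pair, hZ ω ω']) (by simp)]
  simp only [condMutualInfo_eq hp, mutualInfo_eq hp]
  have h1 := entropy_subadd hp Y₁ (T ⋈ V)
  have h2 := hM.entropy_eq_of_factor hp (B := U ⋈ S ⋈ T ⋈ V) (C := fun _ => ()) (D := Y₂)
    (by simp) (by simp) hY
  have h3 := hM.entropy_eq_of_factor hp (B := T ⋈ V) (C := fun _ => ()) (D := Y₂)
    (by simp [pair]) (by simp) hY
  rw [entropy_congr p (B := X ⋈ Y₂ ⋈ U ⋈ S ⋈ T ⋈ V) (by simp [pair]; tauto),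
    entropy_congr p (A := (U ⋈ S ⋈ T ⋈ V) ⋈ X ⋈ fun _ => ()) (B := X ⋈ U ⋈ S ⋈ T ⋈ V)
      (by simp [pair]; tauto)] at h2
  rw [entropy_congr p (B := X ⋈ Y₂ ⋈ T ⋈ V) (by simp [pair]; tauto),
    entropy_congr p (A := (T ⋈ V) ⋈ X ⋈ fun _ => ()) (B := X ⋈ T ⋈ V)
      (by simp [pair]; tauto)] at h3
  have e1 : entropy p ((U ⋈ S) ⋈ T ⋈ V) = entropy p (U ⋈ S ⋈ T ⋈ V) :=
    entropy_congr p (by simp [pair]; tauto)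
  have e2 : entropy p ((U ⋈ S) ⋈ Y₁ ⋈ T ⋈ V) = entropy p ((U ⋈ S ⋈ T ⋈ V) ⋈ Y₁) :=
    entropy_congr p (by simp [pair]; tauto)
  have e3 : entropy p ((U ⋈ S) ⋈ Y₂ ⋈ T ⋈ V) = entropy p (Y₂ ⋈ U ⋈ S ⋈ T ⋈ V) :=
    entropy_congr p (by simp [pair]; tauto)
  linarith

theorem outerRegion_subset_nairElGamalRegion [Subsingleton 𝒵] (P : Channel 𝒳 𝒴₁ 𝒴₂ 𝒵) :
    outerRegion P ⊆ nairElGamalRegion P := by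
  rintro ⟨R₁, R₂⟩ ⟨h1, h2, 𝒯, 𝒱₁, 𝒱₂, 𝒰₁, 𝒰₂, 𝒮₁, 𝒮₂, _, _, _, _, _, _, _, q, r, hq, hr, h⟩
  have hp := jointLaw_mem P hq hr
  have hM := isMarkov_jointLaw P q r
  -- The Nair–El Gamal variables are `U = (U₁, S₁, T, V₁)` and `V = (U₂, S₂, T, V₂)`.
  let Aux : (𝒯 × 𝒱₁ × 𝒱₂ × 𝒰₁ × 𝒰₂ × 𝒮₁ × 𝒮₂) × 𝒳 × 𝒴₁ × 𝒴₂ × 𝒵 →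
      (𝒰₁ × 𝒮₁ × 𝒯 × 𝒱₁) × (𝒰₂ × 𝒮₂ × 𝒯 × 𝒱₂) × 𝒳 := fun ((t, v₁, v₂, u₁, u₂, s₁, s₂), x, _) =>
    ((u₁, s₁, t, v₁), (u₂, s₂, t, v₂), x)
  let F := fun x : (𝒯 × 𝒱₁ × 𝒱₂ × 𝒰₁ × 𝒰₂ × 𝒮₁ × 𝒮₂) × 𝒳 × 𝒴₁ × 𝒴₂ × 𝒵 => (Aux x, x.2.2)
  refine ⟨h1, h2, _, _, inferInstance, inferInstance, law (jointLaw P q r) Aux, law_mem hp _, ?_⟩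
  have hlaw : (fun ((u, v, x), y₁, y₂, z) => law (jointLaw P q r) Aux (u, v, x) *
      P.W x (y₁, y₂, z)) = law (jointLaw P q r) F := by
    funext ⟨⟨u, v, x⟩, y⟩
    have h3 := (hM.pair_self.of_factor (B := Aux) (by
      rintro ⟨x, _, _⟩ ⟨x', _, _⟩ h
      simp only [pair, Prod.mk.injEq] at h
      obtain ⟨rfl, rfl⟩ := h
      rfl)) (u, v, x) x y
    change prob _ _ * _ = prob _ _
    rw [prob_congr _ (E := fun ω => F ω = ((u, v, x), y))
      (F := fun ω => Aux ω = (u, v, x) ∧ ω.2.1 = x ∧ ω.2.2 = y) (by simp [F, Aux]; tauto), h3]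
    congr 1
    refine prob_congr _ ?_
    simp [Aux]
  have hF : ∀ y, F y = (Aux y, y.2.2) := fun _ => rfl
  rw [hlaw]
  have n1 := condMutualInfo_nonneg hp (A := fun ((_, _, _, u₁, _, _, _), _, _, _, _) => u₁)
    (B := fun (_, _, _, _, z) => z)
    (C := pair (fun ((t, _, _, _, _, _, _), _, _, _, _) => t)
      (fun ((_, v₁, _, _, _, _, _), _, _, _, _) => v₁))
  have n2 := condMutualInfo_nonneg hp (A := fun ((_, _, _, _, u₂, _, _), _, _, _, _) => u₂)
    (B := fun (_, _, _, _, z) => z)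
    (C := pair (fun ((t, _, _, _, _, _, _), _, _, _, _) => t)
      (fun ((_, _, v₂, _, _, _, _), _, _, _, _) => v₂))
  constructor
  · refine (h.r₁_a.trans ((sub_le_self _ n1).trans (condMutualInfo_le_mutualInfo hp _ _ _
      (fun ((_, _, _, _, _, s₁, _), _, _, _, _) => s₁) _))).trans_eq
      (mutualInfo_law_congr hp F ?_ ?_).symm <;> simp [F, Aux, pair]
  · refine (h.r₂_a.trans ((sub_le_self _ n2).trans (condMutualInfo_le_mutualInfo hp _ _ _
      (fun ((_, _, _, _, _, _, s₂), _, _, _, _) => s₂) _))).trans_eq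
      (mutualInfo_law_congr hp F ?_ ?_).symm <;> simp [F, Aux, pair]
  · refine h.sum_a.trans ((sum_bound_le_of_subsingleton hp _ (hM.of_factor ?_) ?_).trans_eq ?_)
    · rintro ⟨x, _⟩ ⟨x', _⟩ (rfl : x = x')
      rfl
    · rintro ⟨_, _, x⟩ ⟨_, _, x'⟩ (rfl : x = x')
      rfl
    · congr 1
      · refine (mutualInfo_law_congr hp F ?_ ?_).symm <;> simp [F, Aux, pair]
      · refine (condMutualInfo_law_congr hp F ?_ ?_ ?_).symm <;> simp [F, Aux, pair]
  · refine h.sum_c.trans ((sum_bound_le_of_subsingleton hp _ (hM.of_factor ?_) ?_).trans_eq ?_)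
    · rintro ⟨x, _⟩ ⟨x', _⟩ (rfl : x = x')
      rfl
    · rintro ⟨_, _, x⟩ ⟨_, _, x'⟩ (rfl : x = x')
      rfl
    · congr 1
      · refine (mutualInfo_law_congr hp F ?_ ?_).symm <;> simp [F, Aux, pair]
      · refine (condMutualInfo_law_congr hp F ?_ ?_ ?_).symm <;> simp [F, Aux, pair]

end NairElGamal

/-! ### Masking by uniform keys -/

section Masks

variable {Ω ι G κ κ' α β γ α' β' γ' : Type*} [Fintype Ω] [Fintype ι] [Fintype G] [AddGroup G]
  [Fintype κ] [Fintype κ'] [Fintype α] [Fintype β] [Fintype γ]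
  [Fintype α'] [Fintype β'] [Fintype γ']

theorem entropy_prodLaw_indep {p : Ω → ℝ} (hp : p ∈ stdSimplex ℝ Ω) {ρ : ι → ℝ}
    (hρ : ρ ∈ stdSimplex ℝ ι) (A : Ω → α) (K : ι → κ) :
    entropy (prodLaw p ρ) (fun x => (K x.2, A x.1)) = entropy p A + entropy ρ K := by
  have hlaw : law (prodLaw p ρ) (fun x => (x.1, K x.2)) = prodLaw p (law ρ K) := by
    classical
    funext ⟨ω, k⟩
    simp only [law, prob_prodLaw, prodLaw]
    simp only [prob, Prod.mk.injEq, Finset.mul_sum]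
    refine Finset.sum_congr rfl fun i _ => ?_
    rw [Finset.sum_eq_single ω]
    · by_cases h : K i = k <;> simp [h, mul_comm]
    · intro ω' _ h
      simp [h]
    · simp
  have h1 := entropy_law (prodLaw p ρ) (fun x => (x.1, K x.2)) (fun x : Ω × κ => (x.2, A x.1))
  rw [← h1, hlaw, entropy_prodLaw_mix hp (law_mem hρ K) fun _ => A, entropy_law, ← Finset.sum_mul,
    (law_mem hρ K).2]
  simp only [id]
  ring

/-- A function of a variable masked by a uniform key is independent of everything else. -/
theorem entropy_mask {p : Ω → ℝ} (hp : p ∈ stdSimplex ℝ Ω) (A : Ω → α) (f : Ω → G) (φ : G → κ) :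
    entropy (prodLaw p (unif G)) (fun x => (φ (f x.1 + x.2), A x.1)) =
      entropy p A + entropy (unif G) φ := by
  let e : Ω × G ≃ Ω × G :=
    { toFun := fun x => (x.1, f x.1 + x.2)
      invFun := fun x => (x.1, -f x.1 + x.2)
      left_inv := fun x => by simp
      right_inv := fun x => by simp }
  have h := entropy_comp_equiv (prodLaw p (unif G)) (prodLaw p (unif G)) e
    (fun x => by simp [prodLaw, unif, e]) (fun x => (φ x.2, A x.1))
  exact h.trans (entropy_prodLaw_indep hp (unif_mem G) A φ)

/-- Besides `C`, the conditioning reveals `φ` of a shifted key; together with the first argument it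
reveals `ψ` of a possibly different shift. Each shifted key is uniform and independent of the
unmasked variables, so its entropy splits off and cancels. The shifts may differ because no single
entropy contains both. -/
theorem condMutualInfo_mask {p : Ω → ℝ} (hp : p ∈ stdSimplex ℝ Ω) (f g : Ω → G) (φ : G → κ)
    (ψ : G → κ') {A' : Ω × G → α'} {B' : Ω × G → β'} {C' : Ω × G → γ'} (A : Ω → α) (B : Ω → β)
    (C : Ω → γ)
    (hA : ∀ x x', A' x = A' x' ∧ C' x = C' x' ↔ ψ (g x.1 + x.2) = ψ (g x'.1 + x'.2) ∧
      A x.1 = A x'.1 ∧ C x.1 = C x'.1)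
    (hB : ∀ x x', B' x = B' x' ↔ B x.1 = B x'.1)
    (hC : ∀ x x', C' x = C' x' ↔ φ (f x.1 + x.2) = φ (f x'.1 + x'.2) ∧ C x.1 = C x'.1) :
    condMutualInfo (prodLaw p (unif G)) A' B' C' = condMutualInfo p A B C := by
  rw [condMutualInfo_eq (prodLaw_mem hp (unif_mem G)), condMutualInfo_eq hp,
    entropy_congr _ (A := A' ⋈ C') (B := fun x => (ψ (g x.1 + x.2), (A ⋈ C) x.1))
      (by simpa only [pair, Prod.mk.injEq] using hA),
    entropy_congr _ (A := B' ⋈ C') (B := fun x => (φ (f x.1 + x.2), (B ⋈ C) x.1))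
      (by simp only [pair, Prod.mk.injEq, hB, hC]; tauto),
    entropy_congr _ (A := A' ⋈ B' ⋈ C') (B := fun x => (ψ (g x.1 + x.2), (A ⋈ B ⋈ C) x.1))
      (by intro x x'; have := hA x x'; have := hB x x'; simp only [pair, Prod.mk.injEq]; tauto),
    entropy_congr _ (A := C') (B := fun x => (φ (f x.1 + x.2), C x.1))
      (by simpa only [Prod.mk.injEq] using hC),
    entropy_mask hp, entropy_mask hp, entropy_mask hp, entropy_mask hp]
  ring

theorem mutualInfo_eq_condMutualInfo {p : Ω → ℝ} (hp : p ∈ stdSimplex ℝ Ω) (A : Ω → α)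
    (B : Ω → β) : mutualInfo p A B = condMutualInfo p A B fun _ => () := by
  rw [mutualInfo_eq hp, condMutualInfo_eq hp, entropy_const hp (A := fun _ => ()) fun _ _ => rfl,
    entropy_congr p (A := A ⋈ fun _ => ()) (B := A) (by simp [pair]),
    entropy_congr p (A := B ⋈ fun _ => ()) (B := B) (by simp [pair]),
    entropy_congr p (A := A ⋈ B ⋈ fun _ => ()) (B := A ⋈ B) (by simp [pair])]
  ring

theorem condMutualInfo_mono_left {p : Ω → ℝ} (hp : p ∈ stdSimplex ℝ Ω) {A' : Ω → α'} {A : Ω → α}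
    (h : ∀ ω ω', A ω = A ω' → A' ω = A' ω') (B : Ω → β) (C : Ω → γ) :
    condMutualInfo p A' B C ≤ condMutualInfo p A B C := by
  rw [condMutualInfo_eq hp, condMutualInfo_eq hp]
  have h1 := entropy_submod hp A B (A' ⋈ C)
  rw [entropy_congr p (A := A ⋈ B ⋈ A' ⋈ C) (B := A ⋈ B ⋈ C)
      (by intro ω ω'; have := h ω ω'; simp only [pair, Prod.mk.injEq]; tauto),
    entropy_congr p (A := A ⋈ A' ⋈ C) (B := A ⋈ C)
      (by intro ω ω'; have := h ω ω'; simp only [pair, Prod.mk.injEq]; tauto),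
    entropy_congr p (A := B ⋈ A' ⋈ C) (B := A' ⋈ B ⋈ C) (by simp [pair]; tauto)] at h1
  linarith

theorem condMutualInfo_comm {p : Ω → ℝ} (hp : p ∈ stdSimplex ℝ Ω) (A : Ω → α) (B : Ω → β)
    (C : Ω → γ) : condMutualInfo p A B C = condMutualInfo p B A C := by
  rw [condMutualInfo_eq hp, condMutualInfo_eq hp,
    entropy_congr p (A := A ⋈ B ⋈ C) (B := B ⋈ A ⋈ C) (by simp [pair]; tauto)]
  ring

theorem condMutualInfo_mono_right {p : Ω → ℝ} (hp : p ∈ stdSimplex ℝ Ω) (A : Ω → α) {B' : Ω → β'}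
    {B : Ω → β} (h : ∀ ω ω', B ω = B ω' → B' ω = B' ω') (C : Ω → γ) :
    condMutualInfo p A B' C ≤ condMutualInfo p A B C := by
  rw [condMutualInfo_comm hp A B', condMutualInfo_comm hp A B]
  exact condMutualInfo_mono_left hp h A C

/-- The chain rule for a Markov chain `A → X → Y`. -/
theorem IsMarkov.condMutualInfo_add {𝒳 𝒴 : Type*} [Fintype 𝒳] [Fintype 𝒴] {W : 𝒳 → 𝒴 → ℝ}
    {p : Ω → ℝ} (hp : p ∈ stdSimplex ℝ Ω) {A : Ω → α} {X : Ω → 𝒳} {Y : Ω → 𝒴}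
    (hM : IsMarkov W p A X Y) {B : Ω → β} (hB : ∀ ω ω', Y ω = Y ω' → B ω = B ω') :
    mutualInfo p A B + condMutualInfo p X B A = mutualInfo p X B := by
  have h := hM.entropy_eq_of_factor hp (B := A) (C := fun _ => ()) (D := B) (by simp) (by simp) hB
  rw [entropy_congr p (A := A ⋈ X ⋈ (fun _ => ()) ⋈ B) (B := X ⋈ B ⋈ A) (by simp [pair]; tauto),
    entropy_congr p (A := X ⋈ fun _ => ()) (B := X) (by simp [pair]),
    entropy_congr p (A := A ⋈ X ⋈ fun _ => ()) (B := X ⋈ A) (by simp [pair]; tauto),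
    entropy_congr p (A := X ⋈ (fun _ => ()) ⋈ B) (B := X ⋈ B) (by simp [pair])] at h
  rw [mutualInfo_eq hp, mutualInfo_eq hp, condMutualInfo_eq hp,
    entropy_congr p (A := B ⋈ A) (B := A ⋈ B) (by simp [pair]; tauto)]
  linarith

end Masks

/-! ### Twelve constraints from six, without an eavesdropper -/

section Masked

variable {𝒳 𝒴₁ 𝒴₂ 𝒵 : Type*} [Fintype 𝒳] [Fintype 𝒴₁] [Fintype 𝒴₂] [Fintype 𝒵]
  {Ω G₁ G₂ G₃ 𝒮₁ 𝒮₂ : Type*} [Fintype Ω] [Fintype 𝒮₁] [Fintype 𝒮₂] [Fintype G₁] [Fintype G₂]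
  [Fintype G₃] [AddCommGroup G₁] [AddCommGroup G₂] [AddCommGroup G₃]

/-- Without an eavesdropper, masking the two codewords by independent keys, known to the own
receiver only, and splitting the input by a third key removes most of the constraints. -/
theorem OuterSatisfiable.of_masked [Subsingleton 𝒵] (P : Channel 𝒳 𝒴₁ 𝒴₂ 𝒵) {p : Ω → ℝ}
    (hp : p ∈ stdSimplex ℝ Ω) {A : Ω → G₁} {B : Ω → G₂} {S₁ : Ω → 𝒮₁} {S₂ : Ω → 𝒮₂} {X : Ω → 𝒳}
    {Y₁ : Ω → 𝒴₁} {Y₂ : Ω → 𝒴₂} {Z : Ω → 𝒵} {M : Ω → G₃}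
    (hM : IsMarkov P.W p (A ⋈ B ⋈ S₁ ⋈ S₂) X (Y₁ ⋈ Y₂ ⋈ Z))
    (hX : ∀ ω ω', M ω = M ω' ↔ X ω = X ω') {R₁ R₂ : ℝ}
    (h1 : R₁ ≤ mutualInfo p A Y₁) (h2 : R₂ ≤ mutualInfo p B Y₂)
    (h3 : R₁ ≤ condMutualInfo p X (Y₁ ⋈ Y₂) B) (h4 : R₂ ≤ condMutualInfo p X (Y₁ ⋈ Y₂) A)
    (h5 : R₁ + R₂ ≤ mutualInfo p (A ⋈ S₁) Y₁ + condMutualInfo p X Y₂ (A ⋈ S₁))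
    (h6 : R₁ + R₂ ≤ mutualInfo p (B ⋈ S₂) Y₂ + condMutualInfo p X Y₁ (B ⋈ S₂)) :
    OuterSatisfiable P R₁ R₂ := by
  have hq := prodLaw_mem hp (unif_mem (G₁ × G₂ × G₃))
  have m1 := (hM.of_factor (B := A ⋈ S₁) (by simp [pair]; tauto)).condMutualInfo_add hp
    (B := Y₂) (by simp [pair]; tauto)
  have m2 := (hM.of_factor (B := B ⋈ S₂) (by simp [pair]; tauto)).condMutualInfo_add hp
    (B := Y₁) (by simp [pair]; tauto)
  simp only [mutualInfo_eq_condMutualInfo hp] at h1 h2 h5 h6 m1 m2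
  have hZ : ∀ x x' : Ω × G₁ × G₂ × G₃, Z x.1 = Z x'.1 := fun _ _ => Subsingleton.elim _ _
  have b1 := condMutualInfo_mono_right hp A (B' := Y₁) (B := Y₁ ⋈ Y₂) (by simp [pair]; tauto)
    fun _ => ()
  have b2 := condMutualInfo_mono_right hp B (B' := Y₂) (B := Y₂ ⋈ Y₁) (by simp [pair]; tauto)
    fun _ => ()
  have c1 := condMutualInfo_mono_left hp (A' := A) (A := A ⋈ M) (by simp [pair]; tauto) Y₁ fun _ => ()
  have c2 := condMutualInfo_mono_left hp (A' := B) (A := B ⋈ M) (by simp [pair]; tauto) Y₂ fun _ => ()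
  have d1 := condMutualInfo_mono_left hp (A' := X) (A := A ⋈ M) (by simp [pair, hX]) (Y₁ ⋈ Y₂) B
  have d2 := condMutualInfo_mono_left hp (A' := X) (A := B ⋈ M) (by simp [pair, hX]) (Y₂ ⋈ Y₁) A
  have e2 : condMutualInfo p X (Y₁ ⋈ Y₂) A = condMutualInfo p X (Y₂ ⋈ Y₁) A :=
    condMutualInfo_congr hp (by simp) (by simp [pair]; tauto) (by simp)
  have s1 := condMutualInfo_mono_right hp (A ⋈ S₁) (B' := Y₁) (B := Y₁ ⋈ Y₂) (by simp [pair]; tauto)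
    fun _ => ()
  have s2 := condMutualInfo_mono_right hp (B ⋈ S₂) (B' := Y₂) (B := Y₂ ⋈ Y₁) (by simp [pair]; tauto)
    fun _ => ()
  -- With keys `k₁, k₂, k₃`: `V₁ = k₁`, `V₂ = k₂`, `U₁ = (A + k₁, M + k₃)`, `U₂ = (B + k₂, k₃)`.
  -- Either of `U₁, U₂` alone hides `M`; both together reveal it.
  refine .of_isMarkov P hq (T := fun _ => ()) (V₁ := fun x => x.2.1) (V₂ := fun x => x.2.2.1)
    (U₁ := fun x => (A x.1 + x.2.1, M x.1 + x.2.2.2)) (U₂ := fun x => (B x.1 + x.2.2.1, x.2.2.2))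
    (S₁ := fun x => S₁ x.1) (S₂ := fun x => S₂ x.1) (X := fun x => X x.1) (Y₁ := fun x => Y₁ x.1)
    (Y₂ := fun x => Y₂ x.1) (Z := fun x => Z x.1)
    ((IsMarkov.prodLaw (fun _ => hM.pair_self) _).of_factor ?_) ?_
  · rintro ⟨ω, k⟩ ⟨ω', k'⟩
    have := hX ω ω'
    simp only [pair, Prod.mk.injEq]
    rintro ⟨rfl, ⟨h7, h8, h9, h10⟩, h11⟩
    simp [h7, h8, h9, h10, this.2 h11]
  -- The bounds on the first rate become, in order, I(A; Y₁), I(A; Y₁Y₂), I(AM; Y₁) and I(AM; Y₁Y₂ |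
  -- B). In the third, `k₂` is absent and keeps `B` hidden; only in the fourth is `B` exposed, which
  -- is where `h3` is needed. The second rate is symmetric.
  constructor
  · rw [condMutualInfo_const_right hq _ hZ, sub_zero]
    refine h1.trans_eq (condMutualInfo_mask hp 0 (fun ω => (0, 0, M ω)) (fun k => k.1)
      (fun k => (k.1, k.2.2)) _ _ _ ?_ ?_ ?_).symm
    all_goals
      rintro ⟨ω, k₁, k₂, k₃⟩ ⟨ω', k₁', k₂', k₃'⟩
      simp [pair]
    grind
  · rw [condMutualInfo_const_right hq _ hZ, sub_zero]
    refine (h1.trans b1).trans_eq (condMutualInfo_mask hp 0 (fun ω => (0, 0, M ω))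
      (fun k => (k.1, k.2.1)) (fun k => k) _ _ _ ?_ ?_ ?_).symm
    all_goals
      rintro ⟨ω, k₁, k₂, k₃⟩ ⟨ω', k₁', k₂', k₃'⟩
      simp [pair]
    grind
  · rw [condMutualInfo_const_right hq _ hZ, sub_zero]
    refine (h1.trans c1).trans_eq (condMutualInfo_mask hp (fun ω => (0, B ω, 0))
      (fun ω => (0, B ω, 0)) (fun k => k) (fun k => k) _ _ _ ?_ ?_ ?_).symm
    all_goals
      rintro ⟨ω, k₁, k₂, k₃⟩ ⟨ω', k₁', k₂', k₃'⟩
      simp [pair]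
    grind
  · rw [condMutualInfo_const_right hq _ hZ, sub_zero]
    refine (h3.trans d1).trans_eq (condMutualInfo_mask hp 0 0 (fun k => k) (fun k => k)
      _ _ _ ?_ ?_ ?_).symm
    all_goals
      rintro ⟨ω, k₁, k₂, k₃⟩ ⟨ω', k₁', k₂', k₃'⟩
      simp [pair]
    all_goals grind
  · rw [condMutualInfo_const_right hq _ hZ, sub_zero]
    refine h2.trans_eq (condMutualInfo_mask hp 0 0 (fun k => k.2.1)
      (fun k => (k.2.1, k.2.2)) _ _ _ ?_ ?_ ?_).symm
    all_goals
      rintro ⟨ω, k₁, k₂, k₃⟩ ⟨ω', k₁', k₂', k₃'⟩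
      simp [pair]
    grind
  · rw [condMutualInfo_const_right hq _ hZ, sub_zero]
    refine (h2.trans b2).trans_eq (condMutualInfo_mask hp 0 0
      (fun k => (k.1, k.2.1)) (fun k => k) _ _ _ ?_ ?_ ?_).symm
    all_goals
      rintro ⟨ω, k₁, k₂, k₃⟩ ⟨ω', k₁', k₂', k₃'⟩
      simp [pair]
    grind
  · rw [condMutualInfo_const_right hq _ hZ, sub_zero]
    refine (h2.trans c2).trans_eq (condMutualInfo_mask hp (fun ω => (A ω, 0, M ω))
      (fun ω => (A ω, 0, M ω)) (fun k => k) (fun k => k) _ _ _ ?_ ?_ ?_).symm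
    all_goals
      rintro ⟨ω, k₁, k₂, k₃⟩ ⟨ω', k₁', k₂', k₃'⟩
      simp [pair]
    all_goals grind
  · rw [condMutualInfo_const_right hq _ hZ, sub_zero]
    refine ((h4.trans_eq e2).trans d2).trans_eq (condMutualInfo_mask hp (fun ω => (0, 0, M ω))
      (fun ω => (0, 0, M ω)) (fun k => k) (fun k => k) _ _ _ ?_ ?_ ?_).symm
    all_goals
      rintro ⟨ω, k₁, k₂, k₃⟩ ⟨ω', k₁', k₂', k₃'⟩
      simp [pair]
    all_goals grind
  -- The keys drop out of all three terms, and the chain rule `m1` turns I(X; Y₂) - I(AS₁; Y₂) into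
  -- I(X; Y₂ | AS₁), as in `h5`. The other sum bounds are alike; providing both outputs only
  -- increases the middle term.
  · rw [condMutualInfo_mask hp 0 0 (fun k => k.1) (fun k => k.1) X Y₂ (fun _ => ()),
      condMutualInfo_mask hp 0 (fun ω => (0, 0, M ω)) (fun k => k.1) (fun k => (k.1, k.2.2))
        (A ⋈ S₁) Y₁ (fun _ => ()),
      condMutualInfo_mask hp 0 (fun ω => (0, 0, M ω)) (fun k => k.1) (fun k => (k.1, k.2.2))
        (A ⋈ S₁) Y₂ (fun _ => ())]
    · linarith
    all_goals
      rintro ⟨ω, k₁, k₂, k₃⟩ ⟨ω', k₁', k₂', k₃'⟩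
      have := hZ (ω, k₁, k₂, k₃) (ω', k₁', k₂', k₃')
      simp only at this
      simp [pair, this]
    all_goals grind
  · rw [condMutualInfo_mask hp 0 0 (fun k => (k.1, k.2.1)) (fun k => (k.1, k.2.1)) X Y₂
        (fun _ => ()),
      condMutualInfo_mask hp 0 (fun ω => (0, 0, M ω)) (fun k => (k.1, k.2.1)) (fun k => k)
        (A ⋈ S₁) (Y₁ ⋈ Y₂) (fun _ => ()),
      condMutualInfo_mask hp 0 (fun ω => (0, 0, M ω)) (fun k => (k.1, k.2.1)) (fun k => k)
        (A ⋈ S₁) Y₂ (fun _ => ())]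
    · linarith
    all_goals
      rintro ⟨ω, k₁, k₂, k₃⟩ ⟨ω', k₁', k₂', k₃'⟩
      have := hZ (ω, k₁, k₂, k₃) (ω', k₁', k₂', k₃')
      simp only at this
      simp [pair, this]
    all_goals grind
  · rw [condMutualInfo_mask hp 0 0 (fun k => k.2.1) (fun k => k.2.1) X Y₁ (fun _ => ()),
      condMutualInfo_mask hp 0 0 (fun k => k.2.1) (fun k => k.2) (B ⋈ S₂) Y₂ (fun _ => ()),
      condMutualInfo_mask hp 0 0 (fun k => k.2.1) (fun k => k.2) (B ⋈ S₂) Y₁ (fun _ => ())]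
    · linarith
    all_goals
      rintro ⟨ω, k₁, k₂, k₃⟩ ⟨ω', k₁', k₂', k₃'⟩
      have := hZ (ω, k₁, k₂, k₃) (ω', k₁', k₂', k₃')
      simp only at this
      simp [pair, this]
    all_goals grind
  · rw [condMutualInfo_mask hp 0 0 (fun k => (k.1, k.2.1)) (fun k => (k.1, k.2.1)) X Y₁
        (fun _ => ()),
      condMutualInfo_mask hp 0 0 (fun k => (k.1, k.2.1)) (fun k => k) (B ⋈ S₂) (Y₂ ⋈ Y₁)
        (fun _ => ()),
      condMutualInfo_mask hp 0 0 (fun k => (k.1, k.2.1)) (fun k => k) (B ⋈ S₂) Y₁ (fun _ => ())]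
    · linarith
    all_goals
      rintro ⟨ω, k₁, k₂, k₃⟩ ⟨ω', k₁', k₂', k₃'⟩
      have := hZ (ω, k₁, k₂, k₃) (ω', k₁', k₂', k₃')
      simp only at this
      simp [pair, this]
    all_goals grind

end Masked

/-! ### Random erasure of a variable -/

section Erasure

variable {Ω ι α β γ α' β' γ' 𝒳 𝒴 𝒰 : Type*} [Fintype Ω] [Fintype ι] [Fintype α] [Fintype β]
  [Fintype γ] [Fintype α'] [Fintype β'] [Fintype γ'] [Fintype 𝒳] [Fintype 𝒴] [Fintype 𝒰]

/-- The Bernoulli law. -/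
def bern (s : ℝ) : Bool → ℝ := fun b => if b then s else 1 - s

theorem bern_mem {s : ℝ} (h0 : 0 ≤ s) (h1 : s ≤ 1) : bern s ∈ stdSimplex ℝ Bool := by
  refine ⟨fun b => ?_, by simp [bern]⟩
  cases b <;> simp [bern, h0, h1]

/-- The variable `U` on the extended probability space, erased when the coin shows `false`. -/
def erase (U : Ω → 𝒰) : Ω × Bool → Option 𝒰 := fun x => if x.2 then some (U x.1) else none

/-- The erasure symbol shows the coin, so this is a mixture with revealed mixing variable. The coin
entropy cancels in every mutual information derived from it. -/
theorem entropy_erase {p : Ω → ℝ} (hp : p ∈ stdSimplex ℝ Ω) {s : ℝ} (h0 : 0 ≤ s) (h1 : s ≤ 1)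
    (U : Ω → 𝒰) (B : Ω → β) {R : Ω × Bool → α}
    (hR : ∀ x x', R x = R x' ↔ erase U x = erase U x' ∧ B x.1 = B x'.1) :
    entropy (prodLaw p (bern s)) R =
      entropy (bern s) id + (s * entropy p (U ⋈ B) + (1 - s) * entropy p B) := by
  rw [entropy_congr _ (B := fun x => (x.2, (fun (b : Bool) ω =>
      ((if b then some (U ω) else none : Option 𝒰), B ω)) x.2 x.1)),
    entropy_prodLaw_mix hp (bern_mem h0 h1) fun (b : Bool) ω =>
      ((if b then some (U ω) else none : Option 𝒰), B ω)]
  · simp only [Fintype.sum_bool, bern, if_true, Bool.false_eq_true, if_false]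
    rw [entropy_congr p (A := fun ω => (some (U ω), B ω)) (B := U ⋈ B) (by simp [pair]),
      entropy_congr p (A := fun ω => ((none : Option 𝒰), B ω)) (B := B) (by simp)]
  · rintro ⟨ω, b⟩ ⟨ω', b'⟩
    rw [hR]
    cases b <;> cases b' <;> simp [erase]

theorem mutualInfo_erase {p : Ω → ℝ} (hp : p ∈ stdSimplex ℝ Ω) {s : ℝ} (h0 : 0 ≤ s) (h1 : s ≤ 1)
    (U : Ω → 𝒰) (B : Ω → β) :
    mutualInfo (prodLaw p (bern s)) (erase U) (fun x => B x.1) = s * mutualInfo p U B := by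
  rw [mutualInfo_eq (prodLaw_mem hp (bern_mem h0 h1)), mutualInfo_eq hp,
    entropy_erase hp h0 h1 U (fun _ => ()) (R := erase U) (by simp),
    entropy_erase hp h0 h1 U B (R := erase U ⋈ fun x => B x.1) (by simp [pair]),
    entropy_prodLaw_fst p (bern_mem h0 h1),
    entropy_const hp (A := fun _ => ()) fun _ _ => rfl,
    entropy_congr p (A := U ⋈ fun _ => ()) (B := U) (by simp [pair])]
  ring

theorem condMutualInfo_erase {p : Ω → ℝ} (hp : p ∈ stdSimplex ℝ Ω) {s : ℝ} (h0 : 0 ≤ s)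
    (h1 : s ≤ 1) (U : Ω → 𝒰) (A : Ω → α) (B : Ω → β) :
    condMutualInfo (prodLaw p (bern s)) (fun x => A x.1) (fun x => B x.1) (erase U) =
      s * condMutualInfo p A B U + (1 - s) * mutualInfo p A B := by
  rw [condMutualInfo_eq (prodLaw_mem hp (bern_mem h0 h1)), condMutualInfo_eq hp, mutualInfo_eq hp,
    entropy_erase hp h0 h1 U (fun _ => ()) (R := erase U) (by simp),
    entropy_erase hp h0 h1 U A (R := (fun x => A x.1) ⋈ erase U) (by simp [pair]; tauto),
    entropy_erase hp h0 h1 U B (R := (fun x => B x.1) ⋈ erase U) (by simp [pair]; tauto),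
    entropy_erase hp h0 h1 U (A ⋈ B)
      (R := (fun x => A x.1) ⋈ (fun x => B x.1) ⋈ erase U) (by simp [pair]; tauto),
    entropy_const hp (A := fun _ => ()) fun _ _ => rfl,
    entropy_congr p (A := U ⋈ fun _ => ()) (B := U) (by simp [pair]),
    entropy_congr p (A := U ⋈ A) (B := A ⋈ U) (by simp [pair]; tauto),
    entropy_congr p (A := U ⋈ B) (B := B ⋈ U) (by simp [pair]; tauto),
    entropy_congr p (A := U ⋈ A ⋈ B) (B := A ⋈ B ⋈ U) (by simp [pair]; tauto)]
  ring

theorem condMutualInfo_prodLaw_fst {p : Ω → ℝ} (hp : p ∈ stdSimplex ℝ Ω) {ρ : ι → ℝ}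
    (hρ : ρ ∈ stdSimplex ℝ ι) (A : Ω → α) (B : Ω → β) (C : Ω → γ) :
    condMutualInfo (prodLaw p ρ) (fun x => A x.1) (fun x => B x.1) (fun x => C x.1) =
      condMutualInfo p A B C := by
  rw [condMutualInfo_eq (prodLaw_mem hp hρ), condMutualInfo_eq hp,
    ← entropy_prodLaw_fst p hρ (A ⋈ C), ← entropy_prodLaw_fst p hρ (B ⋈ C),
    ← entropy_prodLaw_fst p hρ (A ⋈ B ⋈ C), ← entropy_prodLaw_fst p hρ C]
  rfl

theorem mutualInfo_prodLaw_fst {p : Ω → ℝ} (hp : p ∈ stdSimplex ℝ Ω) {ρ : ι → ℝ}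
    (hρ : ρ ∈ stdSimplex ℝ ι) (A : Ω → α) (B : Ω → β) :
    mutualInfo (prodLaw p ρ) (fun x => A x.1) (fun x => B x.1) = mutualInfo p A B := by
  rw [mutualInfo_eq_condMutualInfo (prodLaw_mem hp hρ), mutualInfo_eq_condMutualInfo hp,
    ← condMutualInfo_prodLaw_fst hp hρ A B]

/-- Beside `U` itself, the erased copy adds only the coin, which is independent of everything. -/
theorem mutualInfo_erase_pair {p : Ω → ℝ} (hp : p ∈ stdSimplex ℝ Ω) {s : ℝ} (h0 : 0 ≤ s)
    (h1 : s ≤ 1) (U : Ω → 𝒰) (B : Ω → β) :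
    mutualInfo (prodLaw p (bern s)) (erase U ⋈ fun x => U x.1) (fun x => B x.1) =
      mutualInfo p U B := by
  rw [mutualInfo_eq (prodLaw_mem hp (bern_mem h0 h1)), mutualInfo_eq hp,
    entropy_erase hp h0 h1 U U (R := erase U ⋈ fun x => U x.1) (by simp [pair]),
    entropy_prodLaw_fst p (bern_mem h0 h1),
    entropy_erase hp h0 h1 U (U ⋈ B) (R := (erase U ⋈ fun x => U x.1) ⋈ fun x => B x.1)
      (by simp [pair]; tauto),
    entropy_congr p (A := U ⋈ U ⋈ B) (B := U ⋈ B) (by simp [pair]),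
    entropy_congr p (A := U ⋈ U) (B := U) (by simp [pair])]
  ring

theorem condMutualInfo_erase_pair {p : Ω → ℝ} (hp : p ∈ stdSimplex ℝ Ω) {s : ℝ} (h0 : 0 ≤ s)
    (h1 : s ≤ 1) (U : Ω → 𝒰) (A : Ω → α) (B : Ω → β) :
    condMutualInfo (prodLaw p (bern s)) (fun x => A x.1) (fun x => B x.1)
      (erase U ⋈ fun x => U x.1) = condMutualInfo p A B U := by
  rw [condMutualInfo_eq (prodLaw_mem hp (bern_mem h0 h1)), condMutualInfo_eq hp,
    entropy_erase hp h0 h1 U U (R := erase U ⋈ fun x => U x.1) (by simp [pair]),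
    entropy_erase hp h0 h1 U (A ⋈ U) (R := (fun x => A x.1) ⋈ erase U ⋈ fun x => U x.1)
      (by simp [pair]; tauto),
    entropy_erase hp h0 h1 U (B ⋈ U) (R := (fun x => B x.1) ⋈ erase U ⋈ fun x => U x.1)
      (by simp [pair]; tauto),
    entropy_erase hp h0 h1 U (A ⋈ B ⋈ U)
      (R := (fun x => A x.1) ⋈ (fun x => B x.1) ⋈ erase U ⋈ fun x => U x.1)
      (by simp [pair]; tauto),
    entropy_congr p (A := U ⋈ U) (B := U) (by simp [pair]),
    entropy_congr p (A := U ⋈ A ⋈ U) (B := A ⋈ U) (by simp [pair]),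
    entropy_congr p (A := U ⋈ B ⋈ U) (B := B ⋈ U) (by simp [pair]),
    entropy_congr p (A := U ⋈ A ⋈ B ⋈ U) (B := A ⋈ B ⋈ U) (by simp [pair])]
  ring

end Erasure

/-! ### Constant eavesdropper: the Nair–El Gamal region lies in the outer region -/

section NairElGamal

variable {𝒳 𝒴₁ 𝒴₂ 𝒵 : Type*} [Fintype 𝒳] [Fintype 𝒴₁] [Fintype 𝒴₂] [Fintype 𝒵]
  {Ω 𝒰 𝒱 : Type*} [Fintype Ω] [Fintype 𝒰] [Fintype 𝒱]

theorem mutualInfo_congr {Ω α β α' β' : Type*} [Fintype Ω] [Fintype α] [Fintype β] [Fintype α']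
    [Fintype β'] {p : Ω → ℝ} (hp : p ∈ stdSimplex ℝ Ω)
    {A' : Ω → α'} {B' : Ω → β'} {A : Ω → α} {B : Ω → β}
    (hA : ∀ ω ω', A' ω = A' ω' ↔ A ω = A ω') (hB : ∀ ω ω', B' ω = B' ω' ↔ B ω = B ω') :
    mutualInfo p A' B' = mutualInfo p A B := by
  rw [mutualInfo_eq_condMutualInfo hp, mutualInfo_eq_condMutualInfo hp]
  exact condMutualInfo_congr hp hA hB (by simp)

/-- The arithmetic that makes erasure suffice: R ≤ c + (1 - s)a ≤ c + (1 - s)I = sc + (1 - s)C. It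
is applied with `a` the mutual information to one receiver, `I` that to both receivers, `c` a
conditional information given the erased variable's original, and `C` the information of the input.
-/
theorem rate_le_of_erasure {R R' a s C c I : ℝ} (hs1 : s ≤ 1) (hR' : R' = s * a)
    (h1 : R + R' ≤ a + c) (hI : a ≤ I) (hC : I + c = C) : R ≤ s * c + (1 - s) * C := by
  nlinarith [mul_nonneg (sub_nonneg.2 hs1) (sub_nonneg.2 hI)]

theorem OuterSatisfiable.of_nairElGamalConstraints [Subsingleton 𝒵] (P : Channel 𝒳 𝒴₁ 𝒴₂ 𝒵)
    {p : Ω → ℝ} (hp : p ∈ stdSimplex ℝ Ω) {U : Ω → 𝒰} {V : Ω → 𝒱} {X : Ω → 𝒳}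
    {Y₁ : Ω → 𝒴₁} {Y₂ : Ω → 𝒴₂} {Z : Ω → 𝒵} (hM : IsMarkov P.W p (U ⋈ V) X (Y₁ ⋈ Y₂ ⋈ Z))
    {R₁ R₂ : ℝ} (hR₁ : 0 ≤ R₁) (hR₂ : 0 ≤ R₂)
    (h : NairElGamalConstraints p U V X Y₁ Y₂ R₁ R₂) : OuterSatisfiable P R₁ R₂ := by
  classical
  obtain ⟨h1, h2, h3, h4⟩ := h
  -- The probability of keeping `U` is chosen so that the erased variable carries exactly `R₁`; if
  -- I(U; Y₁) = 0 then `R₁ = 0` and `s = 0` will do.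
  obtain ⟨s, hs0, hs1, hs⟩ : ∃ s : ℝ, 0 ≤ s ∧ s ≤ 1 ∧ R₁ = s * mutualInfo p U Y₁ := by
    rcases (hR₁.trans h1).eq_or_lt with h0 | h0
    · exact ⟨0, le_rfl, zero_le_one, by linarith⟩
    · exact ⟨R₁ / mutualInfo p U Y₁, by positivity, (div_le_one h0).2 h1, by field_simp⟩
  obtain ⟨t, ht0, ht1, ht⟩ : ∃ t : ℝ, 0 ≤ t ∧ t ≤ 1 ∧ R₂ = t * mutualInfo p V Y₂ := by
    rcases (hR₂.trans h2).eq_or_lt with h0 | h0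
    · exact ⟨0, le_rfl, zero_le_one, by linarith⟩
    · exact ⟨R₂ / mutualInfo p V Y₂, by positivity, (div_le_one h0).2 h2, by field_simp⟩
  have hbs := bern_mem hs0 hs1
  have hbt := bern_mem ht0 ht1
  have hp1 := prodLaw_mem hp hbs
  have hp2 := prodLaw_mem hp1 hbt
  obtain ⟨ω₀⟩ : Nonempty Ω := by
    by_contra h
    rw [not_nonempty_iff] at h
    simpa using hp.2
  have : NeZero (Fintype.card 𝒳) := ⟨(Fintype.card_pos_iff.2 ⟨X ω₀⟩).ne'⟩
  have : NeZero (Fintype.card (Option 𝒰)) := ⟨Fintype.card_pos.ne'⟩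
  have : NeZero (Fintype.card (Option 𝒱)) := ⟨Fintype.card_pos.ne'⟩
  let eX := Fintype.equivFin 𝒳
  let eU := Fintype.equivFin (Option 𝒰)
  let eV := Fintype.equivFin (Option 𝒱)
  have cU := (hM.of_factor (B := U) (by simp [pair]; tauto)).condMutualInfo_add hp
    (B := Y₁ ⋈ Y₂) (by simp [pair]; tauto)
  have cV := (hM.of_factor (B := V) (by simp [pair])).condMutualInfo_add hp
    (B := Y₁ ⋈ Y₂) (by simp [pair]; tauto)
  have iU : mutualInfo p U Y₁ ≤ mutualInfo p U (Y₁ ⋈ Y₂) := by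
    rw [mutualInfo_eq_condMutualInfo hp, mutualInfo_eq_condMutualInfo hp]
    exact condMutualInfo_mono_right hp _ (by simp [pair]; tauto) _
  have iV : mutualInfo p V Y₂ ≤ mutualInfo p V (Y₁ ⋈ Y₂) := by
    rw [mutualInfo_eq_condMutualInfo hp, mutualInfo_eq_condMutualInfo hp]
    exact condMutualInfo_mono_right hp _ (by simp [pair]) _
  have jU := condMutualInfo_mono_right hp X (B' := Y₂) (B := Y₁ ⋈ Y₂) (by simp [pair]) U
  have jV := condMutualInfo_mono_right hp X (B' := Y₁) (B := Y₁ ⋈ Y₂) (by simp [pair]; tauto) V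
  -- The erased variables serve the individual rates. The originals, placed in `S₁` and `S₂`,
  -- restore the sum bounds to their values before erasure.
  refine .of_masked P hp2 (A := fun x => eU (erase U x.1))
    (B := fun x => eV (erase (fun y => V y.1) x)) (S₁ := fun x => U x.1.1) (S₂ := fun x => V x.1.1)
    (X := fun x => X x.1.1) (Y₁ := fun x => Y₁ x.1.1) (Y₂ := fun x => Y₂ x.1.1)
    (Z := fun x => Z x.1.1) (M := fun x => eX (X x.1.1)) ?_ (by simp) ?_ ?_ ?_ ?_ ?_ ?_
  · refine (IsMarkov.prodLaw (fun _ => IsMarkov.prodLaw (fun _ => hM) _) _).of_factor ?_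
    rintro ⟨⟨ω, a⟩, b⟩ ⟨⟨ω', a'⟩, b'⟩
    simp only [pair, Prod.mk.injEq]
    rintro ⟨rfl, rfl, h5, h6⟩
    simp [erase, h5, h6]
  · rw [mutualInfo_congr hp2 (A := fun x => erase U x.1) (B := fun x => Y₁ x.1.1) (by simp)
      (by simp), mutualInfo_prodLaw_fst hp1 hbt (erase U) fun x => Y₁ x.1,
      mutualInfo_erase hp hs0 hs1]
    exact hs.le
  · rw [mutualInfo_congr hp2 (A := erase fun y => V y.1) (B := fun x => Y₂ x.1.1) (by simp)
      (by simp), mutualInfo_erase hp1 ht0 ht1 (fun y => V y.1) fun x => Y₂ x.1,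
      mutualInfo_prodLaw_fst hp hbs]
    exact ht.le
  · rw [condMutualInfo_congr hp2 (A := fun x => X x.1.1) (B := fun x => (Y₁ ⋈ Y₂) x.1.1)
      (C := erase fun y => V y.1) (by simp) (by simp [pair]) (by simp),
      condMutualInfo_erase hp1 ht0 ht1 (fun y => V y.1) (fun x => X x.1) fun x => (Y₁ ⋈ Y₂) x.1,
      mutualInfo_prodLaw_fst hp hbs, condMutualInfo_prodLaw_fst hp hbs]
    exact rate_le_of_erasure ht1 ht (by linarith) iV cV
  · rw [condMutualInfo_congr hp2 (A := fun x => X x.1.1) (B := fun x => (Y₁ ⋈ Y₂) x.1.1)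
      (C := fun x => erase U x.1) (by simp) (by simp [pair]) (by simp),
      condMutualInfo_prodLaw_fst hp1 hbt (fun x => X x.1) (fun x => (Y₁ ⋈ Y₂) x.1) (erase U),
      condMutualInfo_erase hp hs0 hs1]
    exact rate_le_of_erasure hs1 hs (by linarith) iU cU
  · rw [mutualInfo_congr hp2 (A := fun x => (erase U ⋈ fun x => U x.1) x.1)
        (B := fun x => Y₁ x.1.1) (by simp [pair]) (by simp),
      condMutualInfo_congr hp2 (A := fun x => X x.1.1) (B := fun x => Y₂ x.1.1)
        (C := fun x => (erase U ⋈ fun x => U x.1) x.1) (by simp) (by simp) (by simp [pair]),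
      mutualInfo_prodLaw_fst hp1 hbt (erase U ⋈ fun x => U x.1) fun x => Y₁ x.1,
      condMutualInfo_prodLaw_fst hp1 hbt (fun x => X x.1) (fun x => Y₂ x.1)
        (erase U ⋈ fun x => U x.1),
      mutualInfo_erase_pair hp hs0 hs1, condMutualInfo_erase_pair hp hs0 hs1]
    exact h3
  · rw [mutualInfo_congr hp2 (A := (erase fun y => V y.1) ⋈ fun x => (fun y => V y.1) x.1)
        (B := fun x => (fun y => Y₂ y.1) x.1) (by simp [pair]) (by simp),
      condMutualInfo_congr hp2 (A := fun x => (fun y => X y.1) x.1)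
        (B := fun x => (fun y => Y₁ y.1) x.1)
        (C := (erase fun y => V y.1) ⋈ fun x => (fun y => V y.1) x.1) (by simp) (by simp)
        (by simp [pair]),
      mutualInfo_erase_pair hp1 ht0 ht1 (fun y => V y.1) fun y => Y₂ y.1,
      condMutualInfo_erase_pair hp1 ht0 ht1 (fun y => V y.1) (fun y => X y.1) fun y => Y₁ y.1,
      mutualInfo_prodLaw_fst hp hbs, condMutualInfo_prodLaw_fst hp hbs]
    exact h4

theorem nairElGamalRegion_subset_outerRegion [Subsingleton 𝒵] (P : Channel 𝒳 𝒴₁ 𝒴₂ 𝒵) :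
    nairElGamalRegion P ⊆ outerRegion P := by
  rintro ⟨R₁, R₂⟩ ⟨h1, h2, 𝒰, 𝒱, _, _, q, hq, h⟩
  have hp := kernel_mem hq (W := fun a y => P.W a.2.2 y) fun a => P.isPMF _
  have hM : IsMarkov P.W (fun x : (𝒰 × 𝒱 × 𝒳) × 𝒴₁ × 𝒴₂ × 𝒵 => q x.1 * P.W x.1.2.2 x.2)
      (fun x => x.1) (fun x => x.1.2.2) (fun x => x.2) :=
    isMarkov_of_equiv (fun x => (P.isPMF x).2) (Equiv.refl _) q (fun a => a.2.2)
      (fun _ _ => rfl) (fun _ _ _ => rfl) (fun _ _ => rfl) (fun _ _ => rfl)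
  refine mem_outerRegion.2 ⟨h1, h2, .of_nairElGamalConstraints P hp (hM.of_factor ?_) h1 h2 h⟩
  rintro ⟨x, _⟩ ⟨x', _⟩ (rfl : x = x')
  rfl

end NairElGamal

/-! ### Pasts, futures and punctured sequences -/

section Sequences

variable {Ω 𝒴 𝒴' : Type*} {n : ℕ}

/-- The first `k` terms of a random sequence. -/
def pre (k : ℕ) (Y : Ω → Fin n → 𝒴) : Ω → Fin n → Option 𝒴 :=
  fun ω j => if j.1 < k then some (Y ω j) else none

/-- The terms of a random sequence from index `k` on. -/
def suf (k : ℕ) (Y : Ω → Fin n → 𝒴) : Ω → Fin n → Option 𝒴 :=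
  fun ω j => if k ≤ j.1 then some (Y ω j) else none

/-- The terms of a random sequence at indices other than `i`. -/
def off (i : Fin n) (Y : Ω → Fin n → 𝒴) : Ω → Fin n → Option 𝒴 :=
  fun ω j => if j ≠ i then some (Y ω j) else none

variable {Y : Ω → Fin n → 𝒴} {Y' : Ω → Fin n → 𝒴'} {ω ω' : Ω}

/-- Missing entries are `none` rather than absent, so the alphabet does not depend on `k` and the
time may later be random. Indices are zero-based: `pre k` holds those below `k`, and `suf k` those
from `k` on. -/
theorem pre_eq_iff {k : ℕ} :
    pre k Y ω = pre k Y ω' ↔ ∀ j : Fin n, j.1 < k → Y ω j = Y ω' j := by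
  rw [funext_iff]
  refine forall_congr' fun j => ?_
  by_cases h : j.1 < k <;> simp [pre, h]

theorem suf_eq_iff {k : ℕ} :
    suf k Y ω = suf k Y ω' ↔ ∀ j : Fin n, k ≤ j.1 → Y ω j = Y ω' j := by
  rw [funext_iff]
  refine forall_congr' fun j => ?_
  by_cases h : k ≤ j.1 <;> simp [suf, h]

theorem off_eq_iff {i : Fin n} :
    off i Y ω = off i Y ω' ↔ ∀ j : Fin n, j ≠ i → Y ω j = Y ω' j := by
  rw [funext_iff]
  refine forall_congr' fun j => ?_
  by_cases h : j = i <;> simp [off, h]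

theorem pre_succ_iff (i : Fin n) : pre (i.1 + 1) Y ω = pre (i.1 + 1) Y ω' ↔
    Y ω i = Y ω' i ∧ pre i.1 Y ω = pre i.1 Y ω' := by
  simp only [pre_eq_iff]
  refine ⟨fun h => ⟨h i (by omega), fun j hj => h j (by omega)⟩, fun h j hj => ?_⟩
  rcases (Nat.lt_succ_iff_lt_or_eq.1 hj) with h1 | h1
  · exact h.2 j h1
  · rw [Fin.ext h1]
    exact h.1

theorem suf_iff_succ (i : Fin n) : suf i.1 Y ω = suf i.1 Y ω' ↔
    Y ω i = Y ω' i ∧ suf (i.1 + 1) Y ω = suf (i.1 + 1) Y ω' := by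
  simp only [suf_eq_iff]
  refine ⟨fun h => ⟨h i le_rfl, fun j hj => h j (by omega)⟩, fun h j hj => ?_⟩
  rcases hj.eq_or_lt with h1 | h1
  · rw [← Fin.ext h1]
    exact h.1
  · exact h.2 j h1

theorem off_and_iff (i : Fin n) : off i Y ω = off i Y ω' ∧ Y ω i = Y ω' i ↔ Y ω = Y ω' := by
  rw [off_eq_iff, funext_iff]
  refine ⟨fun h j => ?_, fun h => ⟨fun j _ => h j, h i⟩⟩
  by_cases hj : j = i
  · rw [hj]
    exact h.2
  · exact h.1 j hj

theorem pre_zero_eq : pre 0 Y ω = pre 0 Y ω' :=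
  pre_eq_iff.2 fun j hj => absurd hj (by omega)

theorem suf_top_eq : suf n Y ω = suf n Y ω' :=
  suf_eq_iff.2 fun j hj => absurd j.2 (by omega)

theorem pre_top_iff : pre n Y ω = pre n Y ω' ↔ Y ω = Y ω' := by
  rw [pre_eq_iff, funext_iff]
  exact forall_congr' fun j => by simp [j.2]

theorem suf_zero_iff : suf 0 Y ω = suf 0 Y ω' ↔ Y ω = Y ω' := by
  rw [suf_eq_iff, funext_iff]
  exact forall_congr' fun j => by simp

theorem pre_zip_iff {k : ℕ} : pre k (fun ω j => (Y ω j, Y' ω j)) ω =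
    pre k (fun ω j => (Y ω j, Y' ω j)) ω' ↔ pre k Y ω = pre k Y ω' ∧ pre k Y' ω = pre k Y' ω' := by
  simp only [pre_eq_iff, Prod.mk.injEq]
  exact ⟨fun h => ⟨fun j hj => (h j hj).1, fun j hj => (h j hj).2⟩,
    fun h j hj => ⟨h.1 j hj, h.2 j hj⟩⟩

end Sequences

theorem sum_fin_sub (n : ℕ) (f : ℕ → ℝ) : ∑ i : Fin n, (f (i.1 + 1) - f i.1) = f n - f 0 := by
  rw [Fin.sum_univ_eq_sum_range (fun i => f (i + 1) - f i) n, Finset.sum_range_sub]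

/-! ### Csiszár's sum identity and memorylessness -/

section Csiszar

variable {Ω ι α α' α₁ α₂ β β' γ γ' δ 𝒳 𝒴 𝒬 𝒵 𝒪 : Type*} [Fintype Ω] [Fintype ι] [Fintype α]
  [Fintype α'] [Fintype α₁] [Fintype α₂] [Fintype β] [Fintype β'] [Fintype γ] [Fintype γ']
  [Fintype δ] [Fintype 𝒳] [Fintype 𝒴] [Fintype 𝒬] [Fintype 𝒵] [Fintype 𝒪] {n : ℕ}

/-- The conditioning variable determines the index, so all four entropies are mixtures with revealed
index and its entropy cancels. -/
theorem condMutualInfo_mix {p : Ω → ℝ} (hp : p ∈ stdSimplex ℝ Ω) {ρ : ι → ℝ}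
    (hρ : ρ ∈ stdSimplex ℝ ι) (A : Ω × ι → α) (B : Ω × ι → β) {C : Ω × ι → γ}
    (hC : ∀ x x', C x = C x' → x.2 = x'.2) :
    condMutualInfo (prodLaw p ρ) A B C = ∑ i, ρ i *
      condMutualInfo p (fun ω => A (ω, i)) (fun ω => B (ω, i)) (fun ω => C (ω, i)) := by
  rw [condMutualInfo_eq (prodLaw_mem hp hρ),
    entropy_congr _ (A := A ⋈ C) (B := fun x => (x.2, (fun i ω => (A ⋈ C) (ω, i)) x.2 x.1))
      (by intro x x'; have := hC x x'; simp only [pair, Prod.mk.injEq]; tauto),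
    entropy_congr _ (A := B ⋈ C) (B := fun x => (x.2, (fun i ω => (B ⋈ C) (ω, i)) x.2 x.1))
      (by intro x x'; have := hC x x'; simp only [pair, Prod.mk.injEq]; tauto),
    entropy_congr _ (A := A ⋈ B ⋈ C) (B := fun x => (x.2, (fun i ω => (A ⋈ B ⋈ C) (ω, i)) x.2 x.1))
      (by intro x x'; have := hC x x'; simp only [pair, Prod.mk.injEq]; tauto),
    entropy_congr _ (A := C) (B := fun x => (x.2, (fun i ω => C (ω, i)) x.2 x.1))
      (by intro x x'; have := hC x x'; simp only [Prod.mk.injEq]; tauto),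
    entropy_prodLaw_mix hp hρ fun i ω => (A ⋈ C) (ω, i),
    entropy_prodLaw_mix hp hρ fun i ω => (B ⋈ C) (ω, i),
    entropy_prodLaw_mix hp hρ fun i ω => (A ⋈ B ⋈ C) (ω, i),
    entropy_prodLaw_mix hp hρ fun i ω => C (ω, i)]
  have h : ∀ a b c d e : ℝ, e + a + (e + b) - (e + c) - (e + d) = a + b - c - d := fun _ _ _ _ _ => by
    ring
  rw [h, ← Finset.sum_add_distrib, ← Finset.sum_sub_distrib, ← Finset.sum_sub_distrib]
  refine Finset.sum_congr rfl fun i _ => ?_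
  rw [condMutualInfo_eq hp]
  simp only [pair]
  unfold pair
  ring

/-- The Csiszár sum identity, for the difference of two mutual informations. -/
theorem sum_condMutualInfo_sub {p : Ω → ℝ} (hp : p ∈ stdSimplex ℝ Ω) (U : Ω → α) (D : Ω → δ)
    (Y : Ω → Fin n → 𝒴) (Z : Ω → Fin n → 𝒵) {B : Fin n → Ω → β} {C : Fin n → Ω → γ}
    (hB : ∀ i ω ω', B i ω = B i ω' ↔ Y ω i = Y ω' i)
    (hC : ∀ i ω ω', C i ω = C i ω' ↔ suf (i.1 + 1) Z ω = suf (i.1 + 1) Z ω' ∧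
      pre i.1 Y ω = pre i.1 Y ω' ∧ D ω = D ω') :
    ∑ i, condMutualInfo p U (B i) (C i) - ∑ i, condMutualInfo p U (fun ω => Z ω i) (C i) =
      entropy p (D ⋈ Y) - entropy p (D ⋈ Z) - entropy p (U ⋈ D ⋈ Y) + entropy p (U ⋈ D ⋈ Z) := by
  -- Adjoining the current `Y` to the conditioning gives the hybrid sequence at `i + 1`, adjoining
  -- the current `Z` gives the one at `i`. The difference is therefore a telescoping increment, once
  -- without and once with `U`.
  have h : ∀ i : Fin n, condMutualInfo p U (B i) (C i) -
      condMutualInfo p U (fun ω => Z ω i) (C i) =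
      (entropy p (D ⋈ pre (i.1 + 1) Y ⋈ suf (i.1 + 1) Z) - entropy p (D ⋈ pre i.1 Y ⋈ suf i.1 Z)) -
      (entropy p (U ⋈ D ⋈ pre (i.1 + 1) Y ⋈ suf (i.1 + 1) Z) -
        entropy p (U ⋈ D ⋈ pre i.1 Y ⋈ suf i.1 Z)) := fun i => by
    rw [condMutualInfo_eq hp, condMutualInfo_eq hp,
      entropy_congr p (A := B i ⋈ C i) (B := D ⋈ pre (i.1 + 1) Y ⋈ suf (i.1 + 1) Z)
        (by simp only [pair, Prod.mk.injEq, hB, hC, pre_succ_iff]; tauto),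
      entropy_congr p (A := (fun ω => Z ω i) ⋈ C i) (B := D ⋈ pre i.1 Y ⋈ suf i.1 Z)
        (by simp only [pair, Prod.mk.injEq, hC, suf_iff_succ]; tauto),
      entropy_congr p (A := U ⋈ B i ⋈ C i) (B := U ⋈ D ⋈ pre (i.1 + 1) Y ⋈ suf (i.1 + 1) Z)
        (by simp only [pair, Prod.mk.injEq, hB, hC, pre_succ_iff]; tauto),
      entropy_congr p (A := U ⋈ (fun ω => Z ω i) ⋈ C i) (B := U ⋈ D ⋈ pre i.1 Y ⋈ suf i.1 Z)
        (by simp only [pair, Prod.mk.injEq, hC, suf_iff_succ]; tauto)]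
    ring
  rw [← Finset.sum_sub_distrib, Finset.sum_congr rfl fun i _ => h i, Finset.sum_sub_distrib,
    sum_fin_sub n fun k => entropy p (D ⋈ pre k Y ⋈ suf k Z),
    sum_fin_sub n fun k => entropy p (U ⋈ D ⋈ pre k Y ⋈ suf k Z),
    entropy_congr p (A := D ⋈ pre n Y ⋈ suf n Z) (B := D ⋈ Y)
      (by intro ω ω'; simp [pair, pre_top_iff, suf_top_eq (Y := Z) (ω := ω) (ω' := ω')]),
    entropy_congr p (A := D ⋈ pre 0 Y ⋈ suf 0 Z) (B := D ⋈ Z)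
      (by intro ω ω'; simp [pair, suf_zero_iff, pre_zero_eq (Y := Y) (ω := ω) (ω' := ω')]),
    entropy_congr p (A := U ⋈ D ⋈ pre n Y ⋈ suf n Z) (B := U ⋈ D ⋈ Y)
      (by intro ω ω'; simp [pair, pre_top_iff, suf_top_eq (Y := Z) (ω := ω) (ω' := ω')]),
    entropy_congr p (A := U ⋈ D ⋈ pre 0 Y ⋈ suf 0 Z) (B := U ⋈ D ⋈ Z)
      (by intro ω ω'; simp [pair, suf_zero_iff, pre_zero_eq (Y := Y) (ω := ω) (ω' := ω')])]
  ring

/-- For a memoryless channel, `∑ H(Qᵢ | Xᵢ Zᵢ) ≤ H(Qⁿ | Zⁿ N)`. -/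
theorem sum_condEntropy_le {W : 𝒳 → 𝒪 → ℝ} {p : Ω → ℝ} (hp : p ∈ stdSimplex ℝ Ω)
    {A : Fin n → Ω → α} {X : Fin n → Ω → 𝒳} {O : Ω → Fin n → 𝒪}
    (hM : ∀ i, IsMarkov W p (A i) (X i) fun ω => O ω i) {N : Ω → δ} {Q : Ω → Fin n → 𝒬}
    {Z : Ω → Fin n → 𝒵} (hN : ∀ i ω ω', A i ω = A i ω' → N ω = N ω')
    (hA : ∀ i ω ω', A i ω = A i ω' → off i O ω = off i O ω')
    (hQ : ∀ i ω ω', O ω i = O ω' i → Q ω i = Q ω' i)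
    (hZ : ∀ i ω ω', O ω i = O ω' i → Z ω i = Z ω' i) :
    ∑ i, (entropy p (X i ⋈ (fun ω => Z ω i) ⋈ fun ω => Q ω i) -
        entropy p (X i ⋈ fun ω => Z ω i)) ≤
      entropy p (Q ⋈ Z ⋈ N) - entropy p (Z ⋈ N) := by
  have h : ∀ i : Fin n, entropy p (X i ⋈ (fun ω => Z ω i) ⋈ fun ω => Q ω i) -
      entropy p (X i ⋈ fun ω => Z ω i) ≤
      entropy p (pre (i.1 + 1) Q ⋈ Z ⋈ N) - entropy p (pre i.1 Q ⋈ Z ⋈ N) := fun i => by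
    -- By memorylessness H(Qᵢ | XᵢZᵢ) does not change on further conditioning on `N`, the other `Z`s
    -- and the earlier `Q`s. Dropping `Xᵢ` then increases it, and the chain rule sums the result.
    have h1 := (hM i).entropy_eq_of_factor hp (B := N ⋈ off i Z ⋈ pre i.1 Q)
      (C := fun ω => Z ω i) (D := fun ω => Q ω i) (fun ω ω' h => by
        have h2 := off_eq_iff.1 (hA i ω ω' h)
        simp only [pair, Prod.mk.injEq]
        exact ⟨hN i ω ω' h, off_eq_iff.2 fun j hj => hZ j ω ω' (h2 j hj),
          pre_eq_iff.2 fun j hj => hQ j ω ω' (h2 j (by rintro rfl; omega))⟩) (hZ i) (hQ i)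
    have h2 := entropy_submod hp (fun ω => Q ω i) (X i) (pre i.1 Q ⋈ Z ⋈ N)
    rw [entropy_congr p (A := (N ⋈ off i Z ⋈ pre i.1 Q) ⋈ X i ⋈ (fun ω => Z ω i) ⋈ fun ω => Q ω i)
        (B := (fun ω => Q ω i) ⋈ X i ⋈ pre i.1 Q ⋈ Z ⋈ N)
        (by
          intro ω ω'
          have := off_and_iff (Y := Z) (ω := ω) (ω' := ω') i
          simp only [pair, Prod.mk.injEq]
          tauto),
      entropy_congr p (A := (N ⋈ off i Z ⋈ pre i.1 Q) ⋈ X i ⋈ (fun ω => Z ω i))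
        (B := X i ⋈ pre i.1 Q ⋈ Z ⋈ N)
        (by
          intro ω ω'
          have := off_and_iff (Y := Z) (ω := ω) (ω' := ω') i
          simp only [pair, Prod.mk.injEq]
          tauto)] at h1
    rw [entropy_congr p (A := pre (i.1 + 1) Q ⋈ Z ⋈ N) (B := (fun ω => Q ω i) ⋈ pre i.1 Q ⋈ Z ⋈ N)
      (by simp only [pair, Prod.mk.injEq, pre_succ_iff]; tauto)]
    linarith
  refine (Finset.sum_le_sum fun i _ => h i).trans_eq ?_
  rw [sum_fin_sub n fun k => entropy p (pre k Q ⋈ Z ⋈ N),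
    entropy_congr p (A := pre n Q ⋈ Z ⋈ N) (B := Q ⋈ Z ⋈ N) (by simp [pair, pre_top_iff]),
    entropy_congr p (A := pre 0 Q ⋈ Z ⋈ N) (B := Z ⋈ N)
      (by intro ω ω'; simp [pair, pre_zero_eq (Y := Q) (ω := ω) (ω' := ω')])]

/-- Single-letterization of the sum rate. In each summand I(Xᵢ; Qᵢ | C') equals H(Qᵢ | C') - H(Qᵢ |
XᵢZᵢ). The rest consists of increments of two hybrid entropies: one of the past of `Y` with the
future of `Z`, the other also containing `U` and the future of `Q`. These telescope, and the noise
terms are bounded by `sum_condEntropy_le`. -/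
theorem le_sum_condMutualInfo {W : 𝒳 → 𝒪 → ℝ} {p : Ω → ℝ} (hp : p ∈ stdSimplex ℝ Ω)
    {A : Fin n → Ω → α} {X : Fin n → Ω → 𝒳} {O : Ω → Fin n → 𝒪}
    (hM : ∀ i, IsMarkov W p (A i) (X i) fun ω => O ω i) {U : Ω → α₁} {U' : Ω → α₂}
    {Y : Ω → Fin n → 𝒴} {Q : Ω → Fin n → 𝒬} {Z : Ω → Fin n → 𝒵}
    (hU : ∀ i ω ω', A i ω = A i ω' → U ω = U ω') (hU' : ∀ i ω ω', A i ω = A i ω' → U' ω = U' ω')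
    (hA : ∀ i ω ω', A i ω = A i ω' → off i O ω = off i O ω')
    (hY : ∀ i ω ω', O ω i = O ω' i → Y ω i = Y ω' i)
    (hQ : ∀ i ω ω', O ω i = O ω' i → Q ω i = Q ω' i)
    (hZ : ∀ i ω ω', O ω i = O ω' i → Z ω i = Z ω' i)
    {US : Fin n → Ω → α'} {B : Fin n → Ω → β} {E : Fin n → Ω → β'} {C : Fin n → Ω → γ}
    {C' : Fin n → Ω → γ'}
    (hUS : ∀ i ω ω', US i ω = US i ω' ↔ U ω = U ω' ∧ suf (i.1 + 1) Q ω = suf (i.1 + 1) Q ω')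
    (hB : ∀ i ω ω', B i ω = B i ω' ↔ Y ω i = Y ω' i)
    (hE : ∀ i ω ω', E i ω = E i ω' ↔ Z ω i = Z ω' i ∧ Q ω i = Q ω' i)
    (hC : ∀ i ω ω', C i ω = C i ω' ↔ suf (i.1 + 1) Z ω = suf (i.1 + 1) Z ω' ∧
      pre i.1 Y ω = pre i.1 Y ω')
    (hC' : ∀ i ω ω', C' i ω = C' i ω' ↔ suf (i.1 + 1) Z ω = suf (i.1 + 1) Z ω' ∧
      Z ω i = Z ω' i ∧ pre i.1 Y ω = pre i.1 Y ω') :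
    entropy p Y - entropy p Z - entropy p (U ⋈ Y) + entropy p (U ⋈ Q ⋈ Z) -
        (entropy p (Q ⋈ Z ⋈ U ⋈ U') - entropy p (Z ⋈ U ⋈ U')) ≤
      ∑ i, condMutualInfo p (X i) (fun ω => Q ω i) (C' i) + ∑ i, condMutualInfo p (US i) (B i) (C i) -
        ∑ i, condMutualInfo p (US i) (E i) (C i) := by
  have h : ∀ i : Fin n, condMutualInfo p (X i) (fun ω => Q ω i) (C' i) +
      condMutualInfo p (US i) (B i) (C i) - condMutualInfo p (US i) (E i) (C i) =
      (entropy p (pre (i.1 + 1) Y ⋈ suf (i.1 + 1) Z) - entropy p (pre i.1 Y ⋈ suf i.1 Z)) -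
      (entropy p (U ⋈ suf (i.1 + 1) Q ⋈ pre (i.1 + 1) Y ⋈ suf (i.1 + 1) Z) -
        entropy p (U ⋈ suf i.1 Q ⋈ pre i.1 Y ⋈ suf i.1 Z)) -
      (entropy p (X i ⋈ (fun ω => Z ω i) ⋈ fun ω => Q ω i) -
        entropy p (X i ⋈ fun ω => Z ω i)) := fun i => by
    have h1 := (hM i).entropy_eq_of_factor hp (B := pre i.1 Y ⋈ suf (i.1 + 1) Z)
      (C := fun ω => Z ω i) (D := fun ω => Q ω i) (fun ω ω' h => by
        have h2 := off_eq_iff.1 (hA i ω ω' h)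
        simp only [pair, Prod.mk.injEq]
        exact ⟨pre_eq_iff.2 fun j hj => hY j ω ω' (h2 j (by rintro rfl; omega)),
          suf_eq_iff.2 fun j hj => hZ j ω ω' (h2 j (by rintro rfl; omega))⟩) (hZ i) (hQ i)
    rw [entropy_congr p (B := X i ⋈ (fun ω => Q ω i) ⋈ C' i)
        (by simp only [pair, Prod.mk.injEq, hC']; tauto),
      entropy_congr p (A := (pre i.1 Y ⋈ suf (i.1 + 1) Z) ⋈ X i ⋈ fun ω => Z ω i)
        (B := X i ⋈ C' i) (by simp only [pair, Prod.mk.injEq, hC']; tauto)] at h1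
    rw [condMutualInfo_eq hp, condMutualInfo_eq hp, condMutualInfo_eq hp,
      entropy_congr p (A := B i ⋈ C i) (B := pre (i.1 + 1) Y ⋈ suf (i.1 + 1) Z)
        (by simp only [pair, Prod.mk.injEq, hB, hC, pre_succ_iff]; tauto),
      entropy_congr p (A := C' i) (B := pre i.1 Y ⋈ suf i.1 Z)
        (by simp only [pair, Prod.mk.injEq, hC', suf_iff_succ]; tauto),
      entropy_congr p (A := US i ⋈ B i ⋈ C i)
        (B := U ⋈ suf (i.1 + 1) Q ⋈ pre (i.1 + 1) Y ⋈ suf (i.1 + 1) Z)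
        (by simp only [pair, Prod.mk.injEq, hB, hC, hUS, pre_succ_iff]; tauto),
      entropy_congr p (A := US i ⋈ E i ⋈ C i)
        (B := U ⋈ suf i.1 Q ⋈ pre i.1 Y ⋈ suf i.1 Z)
        (by simp only [pair, Prod.mk.injEq, hE, hC, hUS, suf_iff_succ]; tauto),
      entropy_congr p (A := E i ⋈ C i) (B := (fun ω => Q ω i) ⋈ C' i)
        (by simp only [pair, Prod.mk.injEq, hE, hC, hC']; tauto)]
    linarith
  have h2 := sum_condEntropy_le hp hM (N := U ⋈ U') (Q := Q) (Z := Z)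
    (fun i ω ω' h => by simp only [pair, hU i ω ω' h, hU' i ω ω' h]) hA hQ hZ
  rw [← Finset.sum_add_distrib, ← Finset.sum_sub_distrib, Finset.sum_congr rfl fun i _ => h i,
    Finset.sum_sub_distrib, Finset.sum_sub_distrib,
    sum_fin_sub n fun k => entropy p (pre k Y ⋈ suf k Z),
    sum_fin_sub n fun k => entropy p (U ⋈ suf k Q ⋈ pre k Y ⋈ suf k Z),
    entropy_congr p (A := pre n Y ⋈ suf n Z) (B := Y)
      (by intro ω ω'; simp [pair, pre_top_iff, suf_top_eq (Y := Z) (ω := ω) (ω' := ω')]),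
    entropy_congr p (A := pre 0 Y ⋈ suf 0 Z) (B := Z)
      (by intro ω ω'; simp [pair, suf_zero_iff, pre_zero_eq (Y := Y) (ω := ω) (ω' := ω')]),
    entropy_congr p (A := U ⋈ suf n Q ⋈ pre n Y ⋈ suf n Z) (B := U ⋈ Y)
      (by
        intro ω ω'
        simp [pair, pre_top_iff, suf_top_eq (Y := Z) (ω := ω) (ω' := ω'),
          suf_top_eq (Y := Q) (ω := ω) (ω' := ω')]),
    entropy_congr p (A := U ⋈ suf 0 Q ⋈ pre 0 Y ⋈ suf 0 Z) (B := U ⋈ Q ⋈ Z)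
      (by intro ω ω'; simp [pair, suf_zero_iff, pre_zero_eq (Y := Y) (ω := ω) (ω' := ω')])]
  linarith

end Csiszar

/-! ### n-letter bounds and single-letterization -/

section Converse

variable {Ω α α₁ α₂ β β' γ δ 𝒴 𝒴' 𝒬 𝒵' : Type*} [Fintype Ω] [Fintype α] [Fintype α₁] [Fintype α₂]
  [Fintype β] [Fintype β'] [Fintype γ] [Fintype δ] [Fintype 𝒴] [Fintype 𝒴'] [Fintype 𝒬]
  [Fintype 𝒵'] {n : ℕ}

/-- The right side is H(U | DZ) - H(U | DY). Fano bounds the second term by `e`. As `D` is a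
function of the other message, the first is at least H(U | U'Z) = H(UU' | Z) - H(U' | Z) ≥ L - e, by
the leakage bound. -/
theorem rate_bound {p : Ω → ℝ} (hp : p ∈ stdSimplex ℝ Ω) {U : Ω → α₁} {U' : Ω → α₂} {D : Ω → δ}
    {Y' : Ω → 𝒴'} {Y : Ω → 𝒴} {Z : Ω → 𝒵'} {L L' e : ℝ}
    (hD : ∀ ω ω', U' ω = U' ω' → D ω = D ω') (hY : ∀ ω ω', Y ω = Y ω' → Y' ω = Y' ω')
    (hL : L + L' ≤ entropy p (U ⋈ U')) (hL' : entropy p U' ≤ L')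
    (hf : entropy p (U ⋈ Y') - entropy p Y' ≤ e)
    (hl : entropy p (U ⋈ U') + entropy p Z - entropy p ((U ⋈ U') ⋈ Z) ≤ e) :
    L - 2 * e ≤ entropy p (D ⋈ Y) - entropy p (D ⋈ Z) - entropy p (U ⋈ D ⋈ Y) +
      entropy p (U ⋈ D ⋈ Z) := by
  have h1 := entropy_submod hp U (D ⋈ Y) Y'
  have h2 := entropy_submod hp U U' (D ⋈ Z)
  have h3 := entropy_subadd hp U' Z
  rw [entropy_congr p (A := U ⋈ (D ⋈ Y) ⋈ Y') (B := U ⋈ D ⋈ Y)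
      (by intro ω ω'; have := hY ω ω'; simp only [pair, Prod.mk.injEq]; tauto),
    entropy_congr p (A := (D ⋈ Y) ⋈ Y') (B := D ⋈ Y)
      (by intro ω ω'; have := hY ω ω'; simp only [pair, Prod.mk.injEq]; tauto)] at h1
  rw [entropy_congr p (A := U ⋈ U' ⋈ D ⋈ Z) (B := (U ⋈ U') ⋈ Z)
      (by intro ω ω'; have := hD ω ω'; simp only [pair, Prod.mk.injEq]; tauto),
    entropy_congr p (A := U' ⋈ D ⋈ Z) (B := U' ⋈ Z)
      (by intro ω ω'; have := hD ω ω'; simp only [pair, Prod.mk.injEq]; tauto)] at h2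
  linarith

/-- The right side is H(UU' | Z) - H(U | Y) - H(U' | UQZ): one loss of `e` from leakage and two from
Fano. The leakage bound forces `e ≥ 0`, so this may be weakened to `4 * e`, the sum of the losses
allowed to the two individual rates. -/
theorem sum_rate_bound {p : Ω → ℝ} (hp : p ∈ stdSimplex ℝ Ω) {U : Ω → α₁} {U' : Ω → α₂}
    {Y' : Ω → 𝒴'} {Y : Ω → 𝒴} {Q : Ω → 𝒬} {Z : Ω → 𝒵'} {L L' e : ℝ}
    (hY : ∀ ω ω', Y ω = Y ω' → Y' ω = Y' ω') (hL : L + L' ≤ entropy p (U ⋈ U'))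
    (hf : entropy p (U ⋈ Y') - entropy p Y' ≤ e) (hf' : entropy p (U' ⋈ Q) - entropy p Q ≤ e)
    (hl : entropy p (U ⋈ U') + entropy p Z - entropy p ((U ⋈ U') ⋈ Z) ≤ e) :
    L + L' - 4 * e ≤ entropy p Y - entropy p Z - entropy p (U ⋈ Y) + entropy p (U ⋈ Q ⋈ Z) -
        (entropy p (Q ⋈ Z ⋈ U ⋈ U') - entropy p (Z ⋈ U ⋈ U')) := by
  have h1 := entropy_submod hp U Y Y'
  have h2 := entropy_submod hp U' (U ⋈ Z) Q
  have h3 := entropy_subadd hp (U ⋈ U') Z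
  rw [entropy_congr p (A := U ⋈ Y ⋈ Y') (B := U ⋈ Y)
      (by intro ω ω'; have := hY ω ω'; simp only [pair, Prod.mk.injEq]; tauto),
    entropy_congr p (A := Y ⋈ Y') (B := Y)
      (by intro ω ω'; have := hY ω ω'; simp only [pair, Prod.mk.injEq]; tauto)] at h1
  rw [entropy_congr p (A := U' ⋈ (U ⋈ Z) ⋈ Q) (B := Q ⋈ Z ⋈ U ⋈ U') (by simp [pair]; tauto),
    entropy_congr p (A := (U ⋈ Z) ⋈ Q) (B := U ⋈ Q ⋈ Z) (by simp [pair]; tauto)] at h2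
  rw [entropy_congr p (A := (U ⋈ U') ⋈ Z) (B := Z ⋈ U ⋈ U') (by simp [pair]; tauto)] at h3 hl
  linarith

theorem condMutualInfo_mix_unif_sub {p : Ω → ℝ} (hp : p ∈ stdSimplex ℝ Ω) [NeZero n]
    (A : Ω × Fin n → α) (B : Ω × Fin n → β) (B' : Ω × Fin n → β') {C : Ω × Fin n → γ}
    (hC : ∀ x x', C x = C x' → x.2 = x'.2) :
    condMutualInfo (prodLaw p (unif (Fin n))) A B C -
        condMutualInfo (prodLaw p (unif (Fin n))) A B' C =
      (∑ i, condMutualInfo p (fun ω => A (ω, i)) (fun ω => B (ω, i)) (fun ω => C (ω, i)) -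
        ∑ i, condMutualInfo p (fun ω => A (ω, i)) (fun ω => B' (ω, i)) (fun ω => C (ω, i))) / n := by
  rw [condMutualInfo_mix hp (unif_mem _) A B hC, condMutualInfo_mix hp (unif_mem _) A B' hC]
  simp only [unif, Fintype.card_fin, ← Finset.mul_sum]
  ring

theorem condMutualInfo_mix_unif_add_sub {ε α' γ' : Type*} [Fintype ε] [Fintype α'] [Fintype γ']
    {p : Ω → ℝ} (hp : p ∈ stdSimplex ℝ Ω) [NeZero n] (X : Ω × Fin n → α') (E : Ω × Fin n → ε)
    (A : Ω × Fin n → α) (B : Ω × Fin n → β) (B' : Ω × Fin n → β') {C : Ω × Fin n → γ}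
    {C' : Ω × Fin n → γ'} (hC : ∀ x x', C x = C x' → x.2 = x'.2)
    (hC' : ∀ x x', C' x = C' x' → x.2 = x'.2) :
    condMutualInfo (prodLaw p (unif (Fin n))) X E C' +
      condMutualInfo (prodLaw p (unif (Fin n))) A B C -
        condMutualInfo (prodLaw p (unif (Fin n))) A B' C =
      (∑ i, condMutualInfo p (fun ω => X (ω, i)) (fun ω => E (ω, i)) (fun ω => C' (ω, i)) +
        ∑ i, condMutualInfo p (fun ω => A (ω, i)) (fun ω => B (ω, i)) (fun ω => C (ω, i)) -
        ∑ i, condMutualInfo p (fun ω => A (ω, i)) (fun ω => B' (ω, i)) (fun ω => C (ω, i))) / n := by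
  rw [add_sub_assoc, condMutualInfo_mix_unif_sub hp A B B' hC,
    condMutualInfo_mix hp (unif_mem _) X E hC']
  simp only [unif, Fintype.card_fin, ← Finset.mul_sum]
  ring

variable {𝒳 𝒴₁ 𝒴₂ 𝒵 : Type*} [Fintype 𝒳] [Fintype 𝒴₁] [Fintype 𝒴₂] [Fintype 𝒵]

/-- Single-letterization: the constraints hold for the auxiliary variables formed from the
messages, the past outputs of the receivers and the future outputs, at a uniform time. -/
theorem OuterSatisfiable.of_block (P : Channel 𝒳 𝒴₁ 𝒴₂ 𝒵) [NeZero n] {p : Ω → ℝ}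
    (hp : p ∈ stdSimplex ℝ Ω) {W₁ : Ω → α₁} {W₂ : Ω → α₂} {X : Fin n → Ω → 𝒳}
    {Y₁ : Ω → Fin n → 𝒴₁} {Y₂ : Ω → Fin n → 𝒴₂} {Z : Ω → Fin n → 𝒵} {A : Fin n → Ω → α}
    (hM : ∀ i, IsMarkov P.W p (A i) (X i) fun ω => (Y₁ ω i, Y₂ ω i, Z ω i))
    (hW₁ : ∀ i ω ω', A i ω = A i ω' → W₁ ω = W₁ ω') (hW₂ : ∀ i ω ω', A i ω = A i ω' → W₂ ω = W₂ ω')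
    (hA : ∀ i ω ω', A i ω = A i ω' →
      off i (fun ω j => (Y₁ ω j, Y₂ ω j, Z ω j)) ω = off i (fun ω j => (Y₁ ω j, Y₂ ω j, Z ω j)) ω')
    {L₁ L₂ e : ℝ} (hL : L₁ + L₂ ≤ entropy p (W₁ ⋈ W₂)) (hL₁ : entropy p W₁ ≤ L₁)
    (hL₂ : entropy p W₂ ≤ L₂) (hf₁ : entropy p (W₁ ⋈ Y₁) - entropy p Y₁ ≤ e)
    (hf₂ : entropy p (W₂ ⋈ Y₂) - entropy p Y₂ ≤ e)
    (hl : entropy p (W₁ ⋈ W₂) + entropy p Z - entropy p ((W₁ ⋈ W₂) ⋈ Z) ≤ e) :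
    OuterSatisfiable P ((L₁ - 2 * e) / n) ((L₂ - 2 * e) / n) := by
  have hn : (0 : ℝ) ≤ n := Nat.cast_nonneg n
  have hq := prodLaw_mem hp (unif_mem (Fin n))
  have hL' : L₂ + L₁ ≤ entropy p (W₂ ⋈ W₁) := by
    rw [entropy_congr p (A := W₂ ⋈ W₁) (B := W₁ ⋈ W₂) (by simp [pair]; tauto)]
    linarith
  have hl' : entropy p (W₂ ⋈ W₁) + entropy p Z - entropy p ((W₂ ⋈ W₁) ⋈ Z) ≤ e := by
    rw [entropy_congr p (A := W₂ ⋈ W₁) (B := W₁ ⋈ W₂) (by simp [pair]; tauto),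
      entropy_congr p (A := (W₂ ⋈ W₁) ⋈ Z) (B := (W₁ ⋈ W₂) ⋈ Z) (by simp [pair]; tauto)]
    exact hl
  -- The time must be part of `T`, as every constraint is conditioned on `T` and so becomes an
  -- average over times. The futures of the opposite receivers in `S₁, S₂` are what the sum-rate
  -- telescoping requires.
  refine .of_isMarkov P hq (T := fun x => (x.2, suf (x.2.1 + 1) Z x.1))
    (V₁ := fun x => pre x.2.1 Y₁ x.1) (V₂ := fun x => pre x.2.1 Y₂ x.1) (U₁ := fun x => W₁ x.1)
    (U₂ := fun x => W₂ x.1) (S₁ := fun x => suf (x.2.1 + 1) Y₂ x.1)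
    (S₂ := fun x => suf (x.2.1 + 1) Y₁ x.1) (X := fun x => X x.2 x.1) (Y₁ := fun x => Y₁ x.1 x.2)
    (Y₂ := fun x => Y₂ x.1 x.2) (Z := fun x => Z x.1 x.2)
    ((IsMarkov.prodLaw hM _).of_factor ?_) ?_
  · rintro ⟨ω, i⟩ ⟨ω', i'⟩
    simp only [Prod.mk.injEq]
    rintro ⟨rfl, h⟩
    have h1 := off_eq_iff.1 (hA i ω ω' h)
    simp only [Prod.mk.injEq] at h1
    simp only [pair, Prod.mk.injEq, hW₁ i ω ω' h, hW₂ i ω ω' h, suf_eq_iff, pre_eq_iff, true_and]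
    refine ⟨fun j hj => (h1 j ?_).2.2, fun j hj => (h1 j ?_).1, fun j hj => (h1 j ?_).2.1,
      fun j hj => (h1 j ?_).2.1, fun j hj => (h1 j ?_).1⟩ <;> (rintro rfl; omega)
  constructor
  -- The four bounds on a rate are one argument with `D` trivial or the other message, and `Y` the
  -- own output or both outputs zipped.
  · rw [condMutualInfo_mix_unif_sub hp _ _ _ (by simp [pair])]
    refine div_le_div_of_nonneg_right ((rate_bound hp (D := fun _ => ()) (Y := Y₁) (by simp)
      (by simp) hL hL₂ hf₁ hl).trans_eq (sum_condMutualInfo_sub hp W₁ _ _ Z ?_ ?_).symm) hn <;>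
      simp [pair]
  · rw [condMutualInfo_mix_unif_sub hp _ _ _ (by simp [pair])]
    refine div_le_div_of_nonneg_right ((rate_bound hp (D := fun _ => ())
      (Y := fun ω j => (Y₁ ω j, Y₂ ω j)) (by simp) (by simp [funext_iff, forall_and]; tauto)
      hL hL₂ hf₁ hl).trans_eq (sum_condMutualInfo_sub hp W₁ _ _ Z ?_ ?_).symm) hn <;>
      simp [pair, pre_zip_iff]
  · rw [condMutualInfo_mix_unif_sub hp _ _ _ (by simp [pair])]
    refine div_le_div_of_nonneg_right ((rate_bound hp (D := W₂) (Y := Y₁) (by simp)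
      (by simp) hL hL₂ hf₁ hl).trans_eq (sum_condMutualInfo_sub hp W₁ _ _ Z ?_ ?_).symm) hn <;>
      simp [pair]
  · rw [condMutualInfo_mix_unif_sub hp _ _ _ (by simp [pair])]
    refine div_le_div_of_nonneg_right ((rate_bound hp (D := W₂)
      (Y := fun ω j => (Y₁ ω j, Y₂ ω j)) (by simp) (by simp [funext_iff, forall_and]; tauto)
      hL hL₂ hf₁ hl).trans_eq (sum_condMutualInfo_sub hp W₁ _ _ Z ?_ ?_).symm) hn <;>
      simp [pair, pre_zip_iff]
    tauto
  · rw [condMutualInfo_mix_unif_sub hp _ _ _ (by simp [pair])]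
    refine div_le_div_of_nonneg_right ((rate_bound hp (D := fun _ => ()) (Y := Y₂) (by simp)
      (by simp) hL' hL₁ hf₂ hl').trans_eq (sum_condMutualInfo_sub hp W₂ _ _ Z ?_ ?_).symm) hn <;>
      simp [pair]
  · rw [condMutualInfo_mix_unif_sub hp _ _ _ (by simp [pair])]
    refine div_le_div_of_nonneg_right ((rate_bound hp (D := fun _ => ())
      (Y := fun ω j => (Y₂ ω j, Y₁ ω j)) (by simp) (by simp [funext_iff, forall_and]; tauto)
      hL' hL₁ hf₂ hl').trans_eq (sum_condMutualInfo_sub hp W₂ _ _ Z ?_ ?_).symm) hn <;>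
      simp [pair, pre_zip_iff]
    tauto
  · rw [condMutualInfo_mix_unif_sub hp _ _ _ (by simp [pair])]
    refine div_le_div_of_nonneg_right ((rate_bound hp (D := W₁) (Y := Y₂) (by simp)
      (by simp) hL' hL₁ hf₂ hl').trans_eq (sum_condMutualInfo_sub hp W₂ _ _ Z ?_ ?_).symm) hn <;>
      simp [pair]
  · rw [condMutualInfo_mix_unif_sub hp _ _ _ (by simp [pair])]
    refine div_le_div_of_nonneg_right ((rate_bound hp (D := W₁)
      (Y := fun ω j => (Y₂ ω j, Y₁ ω j)) (by simp) (by simp [funext_iff, forall_and]; tauto)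
      hL' hL₁ hf₂ hl').trans_eq (sum_condMutualInfo_sub hp W₂ _ _ Z ?_ ?_).symm) hn <;>
      simp [pair, pre_zip_iff]
    tauto
  · rw [condMutualInfo_mix_unif_add_sub hp _ _ _ _ _ (by simp [pair])
      (by simp [pair]), ← add_div]
    refine div_le_div_of_nonneg_right (le_trans ?_ ((sum_rate_bound hp (Y := Y₁) (by simp)
      hL hf₁ hf₂ hl).trans (le_sum_condMutualInfo hp
        (O := fun ω j => (Y₁ ω j, Y₂ ω j, Z ω j)) hM hW₁ hW₂ hA
        ?_ ?_ ?_ ?_ ?_ ?_ ?_ ?_))) hn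
    · linarith
    all_goals simp [pair]
    all_goals tauto
  · rw [condMutualInfo_mix_unif_add_sub hp _ _ _ _ _ (by simp [pair])
      (by simp [pair]), ← add_div]
    refine div_le_div_of_nonneg_right (le_trans ?_ ((sum_rate_bound hp
      (Y := fun ω j => (Y₁ ω j, Y₂ ω j)) (by simp [funext_iff, forall_and]; tauto)
      hL hf₁ hf₂ hl).trans (le_sum_condMutualInfo hp
        (O := fun ω j => (Y₁ ω j, Y₂ ω j, Z ω j)) hM hW₁ hW₂ hA
        ?_ ?_ ?_ ?_ ?_ ?_ ?_ ?_))) hn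
    · linarith
    all_goals simp [pair, pre_zip_iff]
    all_goals tauto
  · rw [condMutualInfo_mix_unif_add_sub hp _ _ _ _ _ (by simp [pair])
      (by simp [pair]), ← add_div]
    refine div_le_div_of_nonneg_right (le_trans ?_ ((sum_rate_bound hp (Y := Y₂) (by simp)
      hL' hf₂ hf₁ hl').trans (le_sum_condMutualInfo hp
        (O := fun ω j => (Y₁ ω j, Y₂ ω j, Z ω j)) hM hW₂ hW₁ hA
        ?_ ?_ ?_ ?_ ?_ ?_ ?_ ?_))) hn
    · linarith
    all_goals simp [pair]
    all_goals tauto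
  · rw [condMutualInfo_mix_unif_add_sub hp _ _ _ _ _ (by simp [pair])
      (by simp [pair]), ← add_div]
    refine div_le_div_of_nonneg_right (le_trans ?_ ((sum_rate_bound hp
      (Y := fun ω j => (Y₂ ω j, Y₁ ω j)) (by simp [funext_iff, forall_and]; tauto)
      hL' hf₂ hf₁ hl').trans (le_sum_condMutualInfo hp
        (O := fun ω j => (Y₁ ω j, Y₂ ω j, Z ω j)) hM hW₂ hW₁ hA
        ?_ ?_ ?_ ?_ ?_ ?_ ?_ ?_))) hn
    · linarith
    all_goals simp [pair, pre_zip_iff]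
    all_goals tauto

end Converse

/-! ### The law of a code and the asymptotic argument -/

section CodeLaw

variable {𝒳 𝒴₁ 𝒴₂ 𝒵 : Type*} [Fintype 𝒳] [Fintype 𝒴₁] [Fintype 𝒴₂] [Fintype 𝒵] {n : ℕ}

theorem sum_prod_channel (P : Channel 𝒳 𝒴₁ 𝒴₂ 𝒵) (x : Fin n → 𝒳) :
    ∑ y₁ : Fin n → 𝒴₁, ∑ y₂ : Fin n → 𝒴₂, ∑ z : Fin n → 𝒵, ∏ i, P.W (x i) (y₁ i, y₂ i, z i) = 1 := by
  classical
  let e : (Fin n → 𝒴₁) × (Fin n → 𝒴₂) × (Fin n → 𝒵) ≃ (Fin n → 𝒴₁ × 𝒴₂ × 𝒵) :=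
    { toFun := fun y i => (y.1 i, y.2.1 i, y.2.2 i)
      invFun := fun y => (fun i => (y i).1, fun i => (y i).2.1, fun i => (y i).2.2)
      left_inv := fun _ => rfl
      right_inv := fun _ => rfl }
  have h := Finset.prod_univ_sum (fun _ : Fin n => (Finset.univ : Finset (𝒴₁ × 𝒴₂ × 𝒵)))
    fun i y => P.W (x i) y
  simp only [(P.isPMF _).2, Finset.prod_const_one, Fintype.piFinset_univ] at h
  rw [h, ← Equiv.sum_comp e]
  simp only [Fintype.sum_prod_type]
  rfl

namespace Code

theorem sum_law_mul (P : Channel 𝒳 𝒴₁ 𝒴₂ 𝒵) (c : Code 𝒳 𝒴₁ 𝒴₂ n)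
    (f : Fin c.M₁ → Fin c.M₂ → ℝ) :
    ∑ ω : c.Space 𝒵, c.law P ω * f ω.1 ω.2.1 =
      ∑ w₁, ∑ w₂, 1 / ((c.M₁ : ℝ) * (c.M₂ : ℝ)) * f w₁ w₂ := by
  simp only [Fintype.sum_prod_type, law]
  refine Finset.sum_congr rfl fun w₁ _ => Finset.sum_congr rfl fun w₂ _ => ?_
  calc _ = ∑ x, 1 / ((c.M₁ : ℝ) * (c.M₂ : ℝ)) * c.enc w₁ w₂ x * f w₁ w₂ *
        ∑ y₁ : Fin n → 𝒴₁, ∑ y₂ : Fin n → 𝒴₂, ∑ z : Fin n → 𝒵,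
          ∏ i, P.W (x i) (y₁ i, y₂ i, z i) := by
        simp only [Finset.mul_sum]
        refine Finset.sum_congr rfl fun x _ => Finset.sum_congr rfl fun y₁ _ =>
          Finset.sum_congr rfl fun y₂ _ => Finset.sum_congr rfl fun z _ => ?_
        ring
    _ = _ := by
        simp only [sum_prod_channel, mul_one, ← Finset.sum_mul, ← Finset.mul_sum,
          (c.enc_isPMF w₁ w₂).2]

theorem law_mem (P : Channel 𝒳 𝒴₁ 𝒴₂ 𝒵) (c : Code 𝒳 𝒴₁ 𝒴₂ n) :
    c.law P ∈ stdSimplex ℝ (c.Space 𝒵) := by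
  have h1 : (c.M₁ : ℝ) ≠ 0 := by exact_mod_cast c.M₁_pos.ne'
  have h2 : (c.M₂ : ℝ) ≠ 0 := by exact_mod_cast c.M₂_pos.ne'
  constructor
  · rintro ⟨w₁, w₂, x, y₁, y₂, z⟩
    exact mul_nonneg (mul_nonneg (by positivity) ((c.enc_isPMF w₁ w₂).1 x))
      (Finset.prod_nonneg fun i _ => (P.isPMF _).1 _)
  · have h := c.sum_law_mul P fun _ _ => 1
    simp only [mul_one] at h
    rw [h]
    simp
    field_simp

theorem entropy_messages (P : Channel 𝒳 𝒴₁ 𝒴₂ 𝒵) (c : Code 𝒳 𝒴₁ 𝒴₂ n) :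
    entropy (c.law P) c.messages = Real.logb 2 c.M₁ + Real.logb 2 c.M₂ := by
  classical
  have h1 : (c.M₁ : ℝ) ≠ 0 := by exact_mod_cast c.M₁_pos.ne'
  have h2 : (c.M₂ : ℝ) ≠ 0 := by exact_mod_cast c.M₂_pos.ne'
  have h : ∀ w : Fin c.M₁ × Fin c.M₂, prob (c.law P) (fun ω => c.messages ω = w) =
      1 / ((c.M₁ : ℝ) * (c.M₂ : ℝ)) := by
    rintro ⟨w₁, w₂⟩
    have h3 := c.sum_law_mul P fun a b => if (a, b) = (w₁, w₂) then 1 else 0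
    simp only [mul_ite, mul_one, mul_zero] at h3
    have h4 : ∑ a : Fin c.M₁, ∑ b : Fin c.M₂,
        (if (a, b) = (w₁, w₂) then 1 / ((c.M₁ : ℝ) * (c.M₂ : ℝ)) else 0) =
        1 / ((c.M₁ : ℝ) * (c.M₂ : ℝ)) := by
      rw [← Fintype.sum_prod_type' (f := fun a b =>
        if (a, b) = (w₁, w₂) then 1 / ((c.M₁ : ℝ) * (c.M₂ : ℝ)) else 0)]
      simp
    rw [h4] at h3
    rw [← h3, prob]
    refine Finset.sum_congr rfl fun ω _ => ?_
    simp only [messages]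
    congr
  simp only [entropy, h]
  rw [Finset.sum_const, Finset.card_univ, Fintype.card_prod, Fintype.card_fin, Fintype.card_fin,
    Real.logb_div one_ne_zero (mul_ne_zero h1 h2), Real.logb_one, Real.logb_mul h1 h2, nsmul_eq_mul]
  push_cast
  field_simp
  ring

/-- The block law is a product over times given the input word, so the factor at time `i` splits
off. The messages, the whole input word and all outputs at other times can therefore precede the
input at time `i`. -/
theorem isMarkov (P : Channel 𝒳 𝒴₁ 𝒴₂ 𝒵) (c : Code 𝒳 𝒴₁ 𝒴₂ n) (i : Fin n) :
    IsMarkov P.W (c.law P) (fun ω => (ω.1, ω.2.1, ω.2.2.1, off i (fun (ω : c.Space 𝒵) j =>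
        (ω.2.2.2.1 j, ω.2.2.2.2.1 j, ω.2.2.2.2.2 j)) ω)) (fun ω => ω.2.2.1 i)
      (fun ω => (ω.2.2.2.1 i, ω.2.2.2.2.1 i, ω.2.2.2.2.2 i)) := by
  classical
  let s := (Equiv.funSplitAt i (𝒴₁ × 𝒴₂ × 𝒵)).symm
  have hs : ∀ y r, s (y, r) i = y := fun y r => by simp [s]
  have hs' : ∀ y r (j : {j // j ≠ i}), s (y, r) j = r j := fun y r j => by simp [s, j.2]
  let e : (Fin c.M₁ × Fin c.M₂ × (Fin n → 𝒳) × ({j // j ≠ i} → 𝒴₁ × 𝒴₂ × 𝒵)) × (𝒴₁ × 𝒴₂ × 𝒵) ≃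
      c.Space 𝒵 :=
    { toFun := fun ω => (ω.1.1, ω.1.2.1, ω.1.2.2.1, fun j => (s (ω.2, ω.1.2.2.2) j).1,
        fun j => (s (ω.2, ω.1.2.2.2) j).2.1, fun j => (s (ω.2, ω.1.2.2.2) j).2.2)
      invFun := fun ω => ((ω.1, ω.2.1, ω.2.2.1, fun j =>
        (ω.2.2.2.1 j, ω.2.2.2.2.1 j, ω.2.2.2.2.2 j)),
          (ω.2.2.2.1 i, ω.2.2.2.2.1 i, ω.2.2.2.2.2 i))
      left_inv := fun ⟨⟨w₁, w₂, x, r⟩, y⟩ => by simp only [Prod.mk.eta, hs, hs']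
      right_inv := fun ⟨w₁, w₂, x, y₁, y₂, z⟩ => by
        have : s ((y₁ i, y₂ i, z i), fun j => (y₁ j, y₂ j, z j)) = fun j => (y₁ j, y₂ j, z j) :=
          (Equiv.funSplitAt i (𝒴₁ × 𝒴₂ × 𝒵)).symm_apply_apply fun j => (y₁ j, y₂ j, z j)
        simp only [this] }
  refine isMarkov_of_equiv (fun x => (P.isPMF x).2) e
    (fun ω => 1 / ((c.M₁ : ℝ) * (c.M₂ : ℝ)) * c.enc ω.1 ω.2.1 ω.2.2.1 *
      ∏ j : {j // j ≠ i}, P.W (ω.2.2.1 j) (ω.2.2.2 j)) (fun ω => ω.2.2.1 i) ?_ ?_ ?_ ?_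
  · rintro ⟨w₁, w₂, x, r⟩ y
    change 1 / ((c.M₁ : ℝ) * (c.M₂ : ℝ)) * c.enc w₁ w₂ x * ∏ j, P.W (x j) (s (y, r) j) = _
    rw [Fintype.prod_eq_mul_prod_subtype_ne _ i]
    simp only [hs, hs']
    ring
  · rintro ⟨w₁, w₂, x, r⟩ y y'
    refine congrArg (fun a => (w₁, w₂, x, a)) (off_eq_iff.2 fun j hj => ?_)
    have h1 := hs' y r ⟨j, hj⟩
    have h2 := hs' y' r ⟨j, hj⟩
    simp only at h1 h2
    simp only [e, Equiv.coe_fn_mk, h1, h2]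
  · intro ω y
    rfl
  · intro ω y
    simp [e, hs]

end Code

/-- Fano's inequality for a uniform message, without the message size in the bound. -/
theorem fano_rate {Ω α β : Type*} [Fintype Ω] [Fintype α] [Fintype β] {p : Ω → ℝ}
    (hp : p ∈ stdSimplex ℝ Ω) (U : Ω → α) (Y : Ω → Fin n → β) (g : (Fin n → β) → Option α) {q : ℝ}
    (hU : Real.logb 2 (Fintype.card α) ≤ entropy p U)
    (hq : prob p (fun ω => g (Y ω) ≠ some (U ω)) ≤ q) (hq2 : q ≤ 1 / 2) :
    entropy p (U ⋈ Y) - entropy p Y ≤ 1 + 2 * q * (n * Real.logb 2 (Fintype.card β) + 1) := by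
  classical
  have h1 := fano hp U Y g
  -- Nothing bounds the rates of the codes from above, so log₂ |α| must be controlled: it is at most
  -- H(U) ≤ H(UY), hence at most the entropy of `Y` plus Fano's term. With `q ≤ 1/2` half of log₂
  -- |α| is absorbed on the left, and the resulting bound is put back into Fano's.
  have h2 := entropy_mono hp (A := U) (B := U ⋈ Y) (by simp [pair]; tauto)
  have h3 := entropy_le_log_card hp Y
  rw [Fintype.card_fun, Fintype.card_fin, Nat.cast_pow, Real.logb_pow] at h3
  have h4 : 0 ≤ Real.logb 2 (Fintype.card α) := by
    rcases Nat.eq_zero_or_pos (Fintype.card α) with h | h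
    · simp [h]
    · exact Real.logb_nonneg (by norm_num) (by exact_mod_cast h)
  have h5 := mul_le_mul_of_nonneg_right hq h4
  have h6 := mul_le_mul_of_nonneg_right hq2 h4
  have h7 : 0 ≤ q := (prob_nonneg hp.1 _).trans hq
  have h8 : Real.logb 2 (Fintype.card α) ≤ 2 * (n * Real.logb 2 (Fintype.card β) + 1) := by
    linarith
  have h9 := mul_le_mul_of_nonneg_left h8 h7
  linarith

theorem OuterSatisfiable.of_code (P : Channel 𝒳 𝒴₁ 𝒴₂ 𝒵) [NeZero n] (c : Code 𝒳 𝒴₁ 𝒴₂ n) {e : ℝ}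
    (hq : c.errorProb P ≤ 1 / 2)
    (h₁ : 1 + 2 * c.errorProb P * (n * Real.logb 2 (Fintype.card 𝒴₁) + 1) ≤ e)
    (h₂ : 1 + 2 * c.errorProb P * (n * Real.logb 2 (Fintype.card 𝒴₂) + 1) ≤ e)
    (hl : c.leakage P ≤ e) :
    OuterSatisfiable P ((Real.logb 2 c.M₁ - 2 * e) / n) ((Real.logb 2 c.M₂ - 2 * e) / n) := by
  have hp := c.law_mem P
  have hW := c.entropy_messages P
  have hW₁ := entropy_le_log_card hp fun ω => ω.1
  have hW₂ := entropy_le_log_card hp fun ω => ω.2.1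
  rw [Fintype.card_fin] at hW₁ hW₂
  -- The joint message entropy is the sum of the two maximal entropies, so each message has maximal
  -- entropy by subadditivity; Fano's bound needs this.
  have hs := entropy_subadd hp (fun ω => ω.1) fun ω => ω.2.1
  change entropy _ c.messages ≤ _ at hs
  rw [Code.leakage, mutualInfo_eq hp] at hl
  refine .of_block P hp (W₁ := fun ω => ω.1) (W₂ := fun ω => ω.2.1) (X := fun i ω => ω.2.2.1 i)
    (Y₁ := fun ω => ω.2.2.2.1) (Y₂ := fun ω => ω.2.2.2.2.1) (Z := fun ω => ω.2.2.2.2.2)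
    (c.isMarkov P) ?_ ?_ ?_ hW.ge hW₁ hW₂ ?_ ?_ hl
  · simp; tauto
  · simp; tauto
  · simp
  · refine (fano_rate hp _ _ c.dec₁ ?_ ?_ hq).trans h₁
    · rw [Fintype.card_fin]
      linarith
    · exact prob_mono hp.1 fun ω h => Or.inl h
  · refine (fano_rate hp _ _ c.dec₂ ?_ ?_ hq).trans h₂
    · rw [Fintype.card_fin]
      linarith
    · exact prob_mono hp.1 fun ω h => Or.inr h

theorem OuterSatisfiable.mono {P : Channel 𝒳 𝒴₁ 𝒴₂ 𝒵} {a b a' b' : ℝ}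
    (h : OuterSatisfiable P a b) (ha : a' ≤ a) (hb : b' ≤ b) : OuterSatisfiable P a' b' := by
  obtain ⟨𝒯, 𝒱₁, 𝒱₂, 𝒰₁, 𝒰₂, 𝒮₁, 𝒮₂, _, _, _, _, _, _, _, q, r, hq, hr, h⟩ := h
  exact ⟨𝒯, 𝒱₁, 𝒱₂, 𝒰₁, 𝒰₂, 𝒮₁, 𝒮₂, _, _, _, _, _, _, _, q, r, hq, hr, h.mono ha hb⟩

theorem eventually_fano_le {q : ℕ → ℝ} (hq0 : ∀ n, 0 ≤ q n) (hq : Tendsto q atTop (𝓝 0)) {K ε : ℝ}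
    (hK : 0 ≤ K) (hε : 0 < ε) : ∀ᶠ n : ℕ in atTop, 1 + 2 * q n * (n * K + 1) ≤ n * ε := by
  filter_upwards [hq.eventually_le_const (show 0 < ε / (4 * (K + 1)) by positivity),
    eventually_ge_atTop 1, tendsto_natCast_atTop_atTop.eventually_ge_atTop (2 / ε)] with n h1 h2 h3
  have h2' : (1 : ℝ) ≤ n := by exact_mod_cast h2
  rw [div_le_iff₀ hε] at h3
  rw [le_div_iff₀ (by positivity)] at h1
  have h4 : 2 * q n * (n * K + 1) ≤ 2 * q n * (n * (K + 1)) :=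
    mul_le_mul_of_nonneg_left (by linarith) (by linarith [hq0 n])
  have h5 := mul_le_mul_of_nonneg_left h1 (show (0 : ℝ) ≤ n by positivity)
  linarith

theorem Achievable.outerSatisfiable {P : Channel 𝒳 𝒴₁ 𝒴₂ 𝒵} {R : ℝ × ℝ} (h : Achievable P R)
    {ε : ℝ} (hε : 0 < ε) : OuterSatisfiable P (R.1 - ε) (R.2 - ε) := by
  obtain ⟨-, -, c, h1, h2, h3, -, h5⟩ := h
  have hK : ∀ m : ℕ, 0 ≤ Real.logb 2 m := fun m => by
    rcases Nat.eq_zero_or_pos m with h | h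
    · simp [h]
    · exact Real.logb_nonneg (by norm_num) (by exact_mod_cast h)
  have hq0 : ∀ n, 0 ≤ (c n).errorProb P := fun n => prob_nonneg ((c n).law_mem P).1 _
  -- One large block length suffices. The rate may fall short by `ε / 2`, and with `e = n * (ε / 4)`
  -- the loss `2 * e / n` is the other half.
  obtain ⟨n, h1, h2, h3, h4, h4', h5, h6⟩ := ((h1 (ε / 2) (by positivity)).and
    ((h2 (ε / 2) (by positivity)).and ((h3.eventually_le_const (show (0 : ℝ) < 1 / 2 by norm_num)).and
    ((eventually_fano_le hq0 h3 (hK (Fintype.card 𝒴₁)) (show 0 < ε / 4 by positivity)).and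
    ((eventually_fano_le hq0 h3 (hK (Fintype.card 𝒴₂)) (show 0 < ε / 4 by positivity)).and
    ((h5.eventually_le_const (show 0 < ε / 4 by positivity)).and (eventually_ge_atTop 1))))))).exists
  have : NeZero n := ⟨by omega⟩
  have hn : (0 : ℝ) < n := by exact_mod_cast h6
  rw [div_le_iff₀ hn] at h5
  rw [le_div_iff₀ hn] at h1 h2
  refine (OuterSatisfiable.of_code P (c n) h3 h4 h4' (by linarith)).mono ?_ ?_ <;>
    rw [le_div_iff₀ hn] <;> linarith

theorem secrecyCapacityRegion_subset (P : Channel 𝒳 𝒴₁ 𝒴₂ 𝒵) :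
    secrecyCapacityRegion P ⊆ closure (outerRegion P) :=
  closure_minimal (fun _ h => mem_closure_outerRegion h.1 h.2.1 fun _ hε => h.outerSatisfiable hε)
    isClosed_closure

end CodeLaw

end WiretapBC
end

theorem theorem1 {𝒳 𝒴₁ 𝒴₂ 𝒵 : Type*} [Fintype 𝒳] [Fintype 𝒴₁] [Fintype 𝒴₂] [Fintype 𝒵]
    (P : WiretapBC.Channel 𝒳 𝒴₁ 𝒴₂ 𝒵) :
    WiretapBC.secrecyCapacityRegion P ⊆ closure (WiretapBC.outerRegion P) ∧
      (Subsingleton 𝒵 → WiretapBC.outerRegion P = WiretapBC.nairElGamalRegion P) :=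
  ⟨WiretapBC.secrecyCapacityRegion_subset P, fun _ =>
    (WiretapBC.outerRegion_subset_nairElGamalRegion P).antisymm
      (WiretapBC.nairElGamalRegion_subset_outerRegion P)⟩
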